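/- **Proposition 5.3.** Let $\alpha\in(0,1)$, $T>0$, and let $\Omega\subset\mathbb R^3$ be a bounded domain with boundary $\Gamma$ of class $C^{2,\alpha}$ and outward unit normal $\boldsymbol n$; put $Q=(0,T)\times\Omega$. Let $\Gamma$ be the disjoint union of $\Gamma_+$, $\Gamma_-$, $\Gamma_0$, each consisting of finitely many (possibly no) components of $\Gamma$. For a vector field $\boldsymbol v$ write $v^{\boldsymbol n}=\boldsymbol v\cdot\boldsymbol n$ and $\boldsymbol v^{\tau}=\boldsymbol v-v^{\boldsymbol n}\boldsymbol n$ on $\Gamma$, and $\boldsymbol v^\perp=\boldsymbol n\times\boldsymbol v$. Let $\nabla_\Gamma$ and $\mathrm{div}_\Gamma$ be the gradient and divergence on the surface $\Gamma$, and $\mathrm{curl}_\Gamma\boldsymbol v=-\mathrm{div}_\Gamma(\boldsymbol v^\perp)$ for tangential $\boldsymbol v$. Let $U^{\boldsymbol n}$ be a function on $[0,T]\times\Gamma$ with $U^{\boldsymbol n}<0$ on $\Gamma_+$, $U^{\boldsymbol n}>0$ on $\Gamma_-$ and $U^{\boldsymbol n}=0$ on $\Gamma_0$ for all $t\in[0,T]$.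 Let $C^{k,\alpha}_\sigma(Q)$ (respectively $C^{k,\alpha}_\sigma(\Omega)$) be the set of divergence-free fields of class $C^{k,\alpha}$ in $(t,x)$ on $Q$ (respectively in $x$ on $\Omega$), up to the boundary, whose normal component is $U^{\boldsymbol n}$ on $[0,T]\times\Gamma$ (respectively $U^{\boldsymbol n}(0)$ on $\Gamma$). Let $\mathcal U\in C^{2,\alpha}_\sigma(Q)$; let $\boldsymbol f\in C^{1,\alpha}(Q)$ be divergence-free with $\boldsymbol f\cdot\boldsymbol n=0$ on $[0,T]\times\Gamma$; and let $\boldsymbol u_0\in C^{1,\alpha}_\sigma(\Omega)$ satisfy $\boldsymbol u_0^{\tau}=\mathcal U(0)^{\tau}$ on $\Gamma_+$. Suppose that $(\boldsymbol u,p)\in C^{1,\alpha}_\sigma(Q)\times C^{\alpha}(Q)$ satisfies $$\partial_t\boldsymbol u+\boldsymbol u\cdot\nabla\boldsymbol u+\nabla p=\boldsymbol f\ \text{ in } Q,\qquad \boldsymbol u(0)=\boldsymbol u_0\ \text{ on }\Omega,$$ so that in particular $\mathrm{div}\,\boldsymbol u=0$ in $Q$ and $\boldsymbol u\cdot\boldsymbol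 n=U^{\boldsymbol n}$ on $[0,T]\times\Gamma$. For each $t\in[0,T]$ let $q=q(t)\in C^2(\Omega)\cap C^1(\overline\Omega)$ be a solution of $$\Delta q=-\sum_{i,j}\partial_j u^i\,\partial_i u^j\ \text{ in }\Omega,\qquad \nabla q\cdot\boldsymbol n=-\partial_tU^{\boldsymbol n}-N[\boldsymbol u]\ \text{ on }\Gamma,$$ where $N[\boldsymbol u]=(\boldsymbol u\cdot\nabla\boldsymbol u)\cdot\boldsymbol n$ on $\Gamma_-\cup\Gamma_0$ and $N[\boldsymbol u]=(\boldsymbol u\cdot\nabla\boldsymbol u)\cdot\boldsymbol n+\mathrm{div}_\Gamma\big(U^{\boldsymbol n}(\boldsymbol u^{\tau}-\mathcal U^{\tau})\big)$ on $\Gamma_+$. Let $\boldsymbol H=\boldsymbol H^{\tau}+H^{\boldsymbol n}\boldsymbol n$ on $[0,T]\times\Gamma_+$ be given by $$\boldsymbol H^{\tau}=\frac1{U^{\boldsymbol n}}\Big[-\partial_t\mathcal U^{\tau}-\nabla_\Gamma\big(q+\tfrac12|\mathcal U|^2\big)+\boldsymbol f^{\tau}\Big]^{\perp}+\frac1{U^{\boldsymbol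 n}}\,\big(\mathrm{curl}_\Gamma\,\mathcal U^{\tau}\big)\,\boldsymbol u^{\tau},\qquad H^{\boldsymbol n}=\mathrm{curl}_\Gamma\,\mathcal U^{\tau}.$$ If $\mathrm{curl}\,\boldsymbol u=\boldsymbol H$ on $[0,T]\times\Gamma_+$, then $\boldsymbol u=\mathcal U$ on $[0,T]\times\Gamma_+$ (equivalently, $\boldsymbol u^{\tau}=\mathcal U^{\tau}$ there). -/

import Mathlib

open scoped NNReal RealInnerProductSpace

noncomputable section

/-- Three-dimensional Euclidean space. -/
abbrev E3 : Type := EuclideanSpace ℝ (Fin 3)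

namespace InflowEuler

/-! ### Hölder classes -/

/-- `f` is of class `C^{k,a}` on `S`: it is `C^k` on `S`, its derivatives up to order `k` are bounded
on `S`, and the derivative of order `k` is Hölder continuous on `S` with exponent `a`.
It is used for `S` open and for `S` the closure of a domain with `C²` boundary (or the product of a
compact time interval with such a closure). In the second case derivatives at boundary points are
derivatives within `S`, which are the continuous extensions of the interior derivatives. -/
def IsHolder {X Y : Type*} [NormedAddCommGroup X] [NormedSpace ℝ X]
    [NormedAddCommGroup Y] [NormedSpace ℝ Y]
    (k : ℕ) (a : ℝ≥0) (f : X → Y) (S : Set X) : Prop :=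
  ContDiffOn ℝ k f S ∧
  (∀ j ≤ k, ∃ C : ℝ, ∀ x ∈ S, ‖iteratedFDerivWithin ℝ j f S x‖ ≤ C) ∧
  ∃ C : ℝ≥0, HolderOnWith C a (iteratedFDerivWithin ℝ k f S) S

/-- The boundary of the open set `Ω` is of class `C^{k,a}` (for `k ≥ 1`), and `Ω` lies locally on one
side of it: near each boundary point, `Ω` is the set where a `C^{k,a}` function with nonvanishing
derivative is negative. -/
def HasHolderBoundary (k : ℕ) (a : ℝ≥0) (Ω : Set E3) : Prop :=
  ∀ x ∈ frontier Ω, ∃ (V : Set E3) (ρ : E3 → ℝ),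
    IsOpen V ∧ x ∈ V ∧ IsHolder k a ρ V ∧ (∀ y ∈ V, fderiv ℝ ρ y ≠ 0) ∧
    Ω ∩ V = {y ∈ V | ρ y < 0}

/-! ### Geometry of the boundary -/

/-- `ν` is the outward unit normal vector to `Ω` at `x`: to first order at `x`, `Ω` is the half space
`{y | ⟪y - x, ν⟫ < 0}`. -/
def IsOutwardNormal (Ω : Set E3) (x ν : E3) : Prop :=
  ‖ν‖ = 1 ∧ ∀ ε > 0, ∃ δ > 0, ∀ y : E3, ‖y - x‖ < δ →
    (⟪y - x, ν⟫ < -ε * ‖y - x‖ → y ∈ Ω) ∧ (⟪y - x, ν⟫ > ε * ‖y - x‖ → y ∉ Ω)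

open Classical in
/-- The outward unit normal vector to `Ω` at the boundary point `x`. -/
def normal (Ω : Set E3) (x : E3) : E3 :=
  if h : ∃ ν, IsOutwardNormal Ω x ν then h.choose else 0

/-- The component `v^τ = v - (v · n) n` of the vector `v` that is tangential to the boundary at `x`. -/
def tang (Ω : Set E3) (x v : E3) : E3 := v - ⟪v, normal Ω x⟫ • normal Ω x

/-- The cross product on `E3`. -/
def cross (a b : E3) : E3 := WithLp.toLp 2 (crossProduct a.ofLp b.ofLp)

/-- `v^⊥ = n × v`. -/
def perp (Ω : Set E3) (x v : E3) : E3 := cross (normal Ω x) v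

/-- The tangential gradient `∇_Γ g` on `Γ = ∂Ω`. The derivative of `g` within `Γ` is determined only
on tangent vectors; the projection removes the undetermined normal part, so that the result depends
only on the restriction of `g` to `Γ`. -/
def surfaceGrad (Ω : Set E3) (g : E3 → ℝ) (x : E3) : E3 :=
  tang Ω x (gradientWithin g (frontier Ω) x)

/-- The surface divergence `div_Γ v` of a tangential vector field `v` on `Γ = ∂Ω`: the trace over the
tangent plane of the derivative of `v` along `Γ`, that is, the trace of the derivative of `v` within
`Γ` composed with the orthogonal projection to the tangent plane. -/
def surfaceDiv (Ω : Set E3) (v : E3 → E3) (x : E3) : ℝ :=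
  ∑ i : Fin 3, fderivWithin ℝ v (frontier Ω) x (tang Ω x (EuclideanSpace.single i 1)) i

/-- The surface curl `curl_Γ v = - div_Γ (v^⊥)` of a tangential vector field `v` on `Γ = ∂Ω`. -/
def surfaceCurl (Ω : Set E3) (v : E3 → E3) (x : E3) : ℝ :=
  -surfaceDiv Ω (fun y => perp Ω y (v y)) x

/-- `A` is the union of finitely many connected components of `G`. -/
def IsFiniteUnionOfComponents (A G : Set E3) : Prop :=
  ∃ S : Set E3, S.Finite ∧ S ⊆ G ∧ A = ⋃ x ∈ S, connectedComponentIn G x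

/-- The boundary of `Ω` is the disjoint union of the inflow part `Γp`, the outflow part `Γm` and the
impermeable part `Γz`, each of which consists of finitely many boundary components. -/
structure IsBoundarySplitting (Ω Γp Γm Γz : Set E3) : Prop where
  union_eq : Γp ∪ Γm ∪ Γz = frontier Ω
  disjoint_pm : Disjoint Γp Γm
  disjoint_pz : Disjoint Γp Γz
  disjoint_mz : Disjoint Γm Γz
  inflow : IsFiniteUnionOfComponents Γp (frontier Ω)
  outflow : IsFiniteUnionOfComponents Γm (frontier Ω)
  impermeable : IsFiniteUnionOfComponents Γz (frontier Ω)

/-! ### Differential operators on `[0,T] × closure Ω`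

Derivatives are taken within `closure Ω` (within `[0,T]` for time derivatives), so that they make sense
up to the boundary. At interior points they are the usual ones. -/

/-- `∂_j v`. -/
def partialDeriv (Ω : Set E3) (j : Fin 3) (v : E3 → E3) (x : E3) : E3 :=
  fderivWithin ℝ v (closure Ω) x (EuclideanSpace.single j 1)

/-- `div v`. -/
def div (Ω : Set E3) (v : E3 → E3) (x : E3) : ℝ := ∑ i, partialDeriv Ω i v x i

/-- `curl v`. -/
def curl (Ω : Set E3) (v : E3 → E3) (x : E3) : E3 :=
  !₂[partialDeriv Ω 1 v x 2 - partialDeriv Ω 2 v x 1,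
     partialDeriv Ω 2 v x 0 - partialDeriv Ω 0 v x 2,
     partialDeriv Ω 0 v x 1 - partialDeriv Ω 1 v x 0]

/-- `v · ∇v`, the vector with components `∑ j, v^j ∂_j v^i`. -/
def advect (Ω : Set E3) (v : E3 → E3) (x : E3) : E3 := ∑ j, v x j • partialDeriv Ω j v x

/-- `∇v · (∇v)ᵀ = ∑ i j, ∂_j v^i ∂_i v^j`. -/
def gradDotGradTranspose (Ω : Set E3) (v : E3 → E3) (x : E3) : ℝ :=
  ∑ i, ∑ j, partialDeriv Ω j v x i * partialDeriv Ω i v x j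

/-- `∂_t g` at time `t ∈ [0,T]`. -/
def timeDeriv {Y : Type*} [NormedAddCommGroup Y] [NormedSpace ℝ Y]
    (T : ℝ) (g : ℝ → Y) (t : ℝ) : Y := derivWithin g (Set.Icc 0 T) t

/-! ### Function spaces -/

/-- The closed space-time cylinder over `Ω`. -/
def cylinder (T : ℝ) (Ω : Set E3) : Set (ℝ × E3) := Set.Icc 0 T ×ˢ closure Ω

/-- `v ∈ C_σ^{k,a}(Q)`, `Q = (0,T) × Ω`: `v` is of class `C^{k,a}` in time and space, divergence free,
and has normal component `Un` on `[0,T] × ∂Ω`. -/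
structure IsCSigma (k : ℕ) (a : ℝ≥0) (T : ℝ) (Ω : Set E3) (Un : ℝ → E3 → ℝ)
    (v : ℝ → E3 → E3) : Prop where
  holder : IsHolder k a (Function.uncurry v) (cylinder T Ω)
  div_eq_zero : ∀ t ∈ Set.Ioo 0 T, ∀ x ∈ Ω, div Ω (v t) x = 0
  normal_eq : ∀ t ∈ Set.Icc 0 T, ∀ x ∈ frontier Ω, ⟪v t x, normal Ω x⟫ = Un t x

/-- `v ∈ C_σ^{k,a}(Ω)`: `v` is of class `C^{k,a}`, divergence free, and has normal component `Un` on
`∂Ω`. -/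
structure IsCSigmaSpace (k : ℕ) (a : ℝ≥0) (Ω : Set E3) (Un : E3 → ℝ) (v : E3 → E3) : Prop where
  holder : IsHolder k a v (closure Ω)
  div_eq_zero : ∀ x ∈ Ω, div Ω v x = 0
  normal_eq : ∀ x ∈ frontier Ω, ⟪v x, normal Ω x⟫ = Un x

/-! ### The equations and the boundary vorticity -/

/-- The sign conditions on the prescribed normal velocity. -/
structure IsNormalVelocity (T : ℝ) (Γp Γm Γz : Set E3) (Un : ℝ → E3 → ℝ) : Prop where
  inflow : ∀ t ∈ Set.Icc 0 T, ∀ x ∈ Γp, Un t x < 0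
  outflow : ∀ t ∈ Set.Icc 0 T, ∀ x ∈ Γm, 0 < Un t x
  impermeable : ∀ t ∈ Set.Icc 0 T, ∀ x ∈ Γz, Un t x = 0

/-- `(u, p)` satisfies `∂_t u + u · ∇u + ∇p = f` in `(0,T) × Ω` in the classical sense, and
`u(0) = u₀` on `Ω`. -/
structure SolvesEuler (T : ℝ) (Ω : Set E3) (f : ℝ → E3 → E3) (u₀ : E3 → E3)
    (u : ℝ → E3 → E3) (p : ℝ → E3 → ℝ) : Prop where
  differentiable : ∀ t ∈ Set.Ioo 0 T, ∀ x ∈ Ω, DifferentiableAt ℝ (p t) x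
  momentum : ∀ t ∈ Set.Ioo 0 T, ∀ x ∈ Ω,
    timeDeriv T (fun s => u s x) t + advect Ω (u t) x + gradient (p t) x = f t x
  initial : ∀ x ∈ Ω, u 0 x = u₀ x

/-- `N[u]` at time `t`: it is `(u · ∇u) · n` on the outflow and impermeable parts of the boundary and
`(u · ∇u) · n + div_Γ (U^n (u^τ - 𝒰^τ))` on the inflow part `Γp`. -/
def modifiedAdvection (Ω Γp : Set E3) (Un : ℝ → E3 → ℝ) (U u : ℝ → E3 → E3) (t : ℝ) (x : E3) : ℝ :=
  ⟪advect Ω (u t) x, normal Ω x⟫ +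
    Γp.indicator (surfaceDiv Ω fun y => Un t y • (tang Ω y (u t y) - tang Ω y (U t y))) x

/-- `q` is a (classical) solution, at each time `t ∈ [0,T]`, of the Neumann problem
`Δq = - ∇u · (∇u)ᵀ` in `Ω`, `∇q · n = - ∂_t U^n - N[u]` on `∂Ω`. -/
structure SolvesApproxPressure (T : ℝ) (Ω Γp : Set E3) (Un : ℝ → E3 → ℝ) (U u : ℝ → E3 → E3)
    (q : ℝ → E3 → ℝ) : Prop where
  contDiffOn_closure : ∀ t ∈ Set.Icc 0 T, ContDiffOn ℝ 1 (q t) (closure Ω)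
  contDiffOn_interior : ∀ t ∈ Set.Icc 0 T, ContDiffOn ℝ 2 (q t) Ω
  laplace : ∀ t ∈ Set.Icc 0 T, ∀ x ∈ Ω,
    Laplacian.laplacian (q t) x = -gradDotGradTranspose Ω (u t) x
  neumann : ∀ t ∈ Set.Icc 0 T, ∀ x ∈ frontier Ω,
    ⟪gradientWithin (q t) (closure Ω) x, normal Ω x⟫ =
      -timeDeriv T (fun s => Un s x) t - modifiedAdvection Ω Γp Un U u t x

/-- `H^n = curl_Γ 𝒰^τ`. -/
def vorticityNormal (Ω : Set E3) (U : ℝ → E3 → E3) (t : ℝ) (x : E3) : ℝ :=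
  surfaceCurl Ω (fun y => tang Ω y (U t y)) x

/-- `H^τ = (1/U^n) [-∂_t 𝒰^τ - ∇_Γ (q + |𝒰|²/2) + f^τ]^⊥ + (1/U^n) (curl_Γ 𝒰^τ) u^τ`. -/
def vorticityTangential (T : ℝ) (Ω : Set E3) (Un : ℝ → E3 → ℝ) (U f u : ℝ → E3 → E3)
    (q : ℝ → E3 → ℝ) (t : ℝ) (x : E3) : E3 :=
  (1 / Un t x) • perp Ω x
      (-timeDeriv T (fun s => tang Ω x (U s x)) t
        - surfaceGrad Ω (fun y => q t y + 1 / 2 * ‖U t y‖ ^ 2) x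
        + tang Ω x (f t x))
    + (1 / Un t x) • (surfaceCurl Ω (fun y => tang Ω y (U t y)) x • tang Ω x (u t x))

/-- The generated boundary vorticity `H = H^τ + H^n n` on the inflow boundary. -/
def boundaryVorticity (T : ℝ) (Ω : Set E3) (Un : ℝ → E3 → ℝ) (U f u : ℝ → E3 → E3)
    (q : ℝ → E3 → ℝ) (t : ℝ) (x : E3) : E3 :=
  vorticityTangential T Ω Un U f u q t x + vorticityNormal Ω U t x • normal Ω x

end InflowEuler

end

/-! Put `z = u - 𝒰`, which is tangential on `Γ`, and `r = p - q`. On `Γ₊` the normal part of the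
condition `curl u = H` says `curl_Γ z = 0`. The tangential part, inserted into `u · ∇u = ∇(|u|²/2) +
curl u × u`, turns the tangential momentum equation into `∂_t z = -∇_Γ (r + (|u|² - |𝒰|²)/2)`. The
problem for `q` makes `r` harmonic in `Ω`, with `∂_n r = div_Γ (U^n z)` on `Γ₊` and `∂_n r = 0` on
the rest of `Γ`.

The energy `½ ∫_{Γ₊} (-U^n) |z|²` has a positive weight. The pressure contributes `∫_{Γ₊} U^n z ·
∇_Γ r = -∫_Γ r ∂_n r = -∫_Ω |∇r|² ≤ 0` to its time derivative. In the remaining gradient, `|u|² -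
|𝒰|² = |z|² + 2 𝒰 · z`. The gradient of `|z|²` is integrated by parts. In `z · ∇(𝒰 · z)` the
derivative of `z` becomes `𝒰^τ · ∇(|z|²/2)` because `curl_Γ z = 0`, and is integrated by parts too.
What is left is bounded by a constant times the energy, which vanishes initially, so Gronwall gives
`z = 0` on `Γ₊`.

Surface integrals are replaced by layer integrals `D.layer n g`: volume integrals against a bump of
the defining function `d` concentrated where `1/(n+1) ≤ d ≤ 2/(n+1)`. With `m = ∇d` they stand for a
fixed multiple of `∫_Γ g / |m|`. The surface divergence theorem becomes the exact identity
`layer_tr_eq_zero` for fields tangential to the level sets of `d`, Green's identity becomes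
`layer_mul_inner_nonpos`, and pointwise inequalities on `Γ` pass to thin layers with small error by
`eventually_layer_le`. Since `u` is only `C¹`, `r` is shown to be harmonic in the weak sense
(`integral_fderiv_pressureGap_eq_zero`). The algebra on `Γ₊` is `energyDiv_boundary`; it gives
`boundary_inequality` and then `eventually_energy_le`. The Gronwall lemma
`eventually_le_of_eventually_deriv_le` makes the layer energies tend to zero, and
`eq_zero_of_layer_le` recovers pointwise vanishing on the boundary. -/

open scoped NNReal RealInnerProductSpace

namespace InflowEuler

open MeasureTheory Filter Topology Set

/-! ### Traces and integration by parts with compactly supported test functions -/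

/-- The trace of a linear map of `E3`, as the sum of its diagonal entries. -/
noncomputable def tr (A : E3 →L[ℝ] E3) : ℝ := ∑ i : Fin 3, A (EuclideanSpace.single i 1) i

/-- The trace as a continuous linear functional. -/
noncomputable def trL : (E3 →L[ℝ] E3) →L[ℝ] ℝ :=
  ∑ i : Fin 3, (EuclideanSpace.proj i : E3 →L[ℝ] ℝ).comp
    (ContinuousLinearMap.apply ℝ E3 (EuclideanSpace.single i 1 : E3))

theorem trL_apply (A : E3 →L[ℝ] E3) : trL A = tr A := by
  simp [trL, tr]

theorem tr_add (A B : E3 →L[ℝ] E3) : tr (A + B) = tr A + tr B := by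
  simp only [← trL_apply, map_add]

theorem tr_smul (c : ℝ) (A : E3 →L[ℝ] E3) : tr (c • A) = c * tr A := by
  simp only [← trL_apply, map_smul, smul_eq_mul]

theorem tr_zero : tr (0 : E3 →L[ℝ] E3) = 0 := by
  simp only [← trL_apply, map_zero]

theorem tr_smulRight (φ : E3 →L[ℝ] ℝ) (v : E3) : tr (φ.smulRight v) = φ v := by
  have hv : v = ∑ i : Fin 3, v i • (EuclideanSpace.single i 1 : E3) := by
    ext j; fin_cases j <;> simp [Fin.sum_univ_three]
  conv_rhs => rw [hv]
  simp [tr, map_sum, mul_comm]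

theorem continuous_tr : Continuous tr := by
  have : tr = fun A => trL A := by ext A; rw [trL_apply]
  rw [this]; exact trL.continuous

theorem inner_eq_sum (a b : E3) : ⟪a, b⟫ = a 0 * b 0 + a 1 * b 1 + a 2 * b 2 := by
  simp [PiLp.inner_apply, Fin.sum_univ_three, mul_comm]

/-- The divergence theorem for a field which vanishes outside a compact subset. -/
theorem integral_tr_eq_zero {Ω K : Set E3} (hΩ : IsOpen Ω) (hK : IsCompact K) (hKΩ : K ⊆ Ω)
    {Z : E3 → E3} {Z' : E3 → E3 →L[ℝ] E3} (hZ : ∀ x ∈ Ω, HasFDerivAt Z (Z' x) x)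
    (hZ' : ContinuousOn Z' Ω) (h0 : ∀ x ∈ Ω, x ∉ K → Z x = 0) :
    ∫ x in Ω, tr (Z' x) = 0 := by
  have hKc : IsClosed K := hK.isClosed
  have hoff : ∀ x ∈ Ω, x ∉ K → Z' x = 0 := by
    intro x hx hxK
    have : Z =ᶠ[𝓝 x] fun _ => 0 := by
      filter_upwards [hΩ.mem_nhds hx, hKc.isOpen_compl.mem_nhds hxK] with y hy hyK using h0 y hy hyK
    exact (hZ x hx).unique ((hasFDerivAt_const (0 : E3) x).congr_of_eventuallyEq this)
  -- Extension by zero keeps differentiability everywhere, since `Z` already vanishes on the open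
  -- set `Ω \ K`. Integration by parts on the whole space against the constant `1` then applies.
  have hd : ∀ x, HasFDerivAt (K.indicator Z) (K.indicator Z' x) x := by
    intro x
    by_cases hx : x ∈ Ω
    · have h1 : K.indicator Z' x = Z' x := by
        by_cases hxK : x ∈ K
        · simp [hxK]
        · simp [hxK, hoff x hx hxK]
      rw [h1]
      refine (hZ x hx).congr_of_eventuallyEq ?_
      filter_upwards [hΩ.mem_nhds hx] with y hy
      by_cases hyK : y ∈ K
      · simp [hyK]
      · simp [hyK, h0 y hy hyK]
    · have hxK : x ∉ K := fun h => hx (hKΩ h)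
      rw [indicator_of_notMem hxK]
      refine (hasFDerivAt_const (0 : E3) x).congr_of_eventuallyEq ?_
      filter_upwards [hKc.isOpen_compl.mem_nhds hxK] with y hyK
      exact indicator_of_notMem hyK _
  have hZc : ContinuousOn Z Ω := fun x hx => (hZ x hx).continuousAt.continuousWithinAt
  have hiZ : Integrable (K.indicator Z) :=
    ((hZc.mono hKΩ).integrableOn_compact hK).integrable_indicator hKc.measurableSet
  have hiZ' : Integrable (K.indicator Z') :=
    ((hZ'.mono hKΩ).integrableOn_compact hK).integrable_indicator hKc.measurableSet
  have hcomp : ∀ i : Fin 3, ∫ x, K.indicator Z' x (EuclideanSpace.single i 1) i = 0 := by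
    intro i
    have hI : Integrable (fun x => K.indicator Z' x (EuclideanSpace.single i 1)) :=
      (ContinuousLinearMap.apply ℝ E3 (EuclideanSpace.single i 1 : E3)).integrable_comp hiZ'
    have hIi : Integrable (fun x => K.indicator Z' x (EuclideanSpace.single i 1) i) :=
      (EuclideanSpace.proj i : E3 →L[ℝ] ℝ).integrable_comp hI
    have hZi : Integrable (fun x => K.indicator Z x i) :=
      (EuclideanSpace.proj i : E3 →L[ℝ] ℝ).integrable_comp hiZ
    have := integral_bilinear_hasFDerivAt_right_eq_neg_left_of_integrable (μ := volume)
      (f := fun _ : E3 => (1 : ℝ)) (f' := fun _ => 0) (g := fun x => K.indicator Z x i)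
      (g' := fun x => (EuclideanSpace.proj i : E3 →L[ℝ] ℝ).comp (K.indicator Z' x))
      (v := EuclideanSpace.single i 1) (B := ContinuousLinearMap.mul ℝ ℝ)
      (by simp) (by simpa using hIi) (by simpa using hZi)
      (fun x _ => hasFDerivAt_const _ _)
      (fun x _ => (EuclideanSpace.proj i : E3 →L[ℝ] ℝ).hasFDerivAt.comp x (hd x))
    simpa using this
  have h1 : ∫ x in Ω, tr (Z' x) = ∫ x, tr (K.indicator Z' x) := by
    rw [← integral_indicator hΩ.measurableSet]
    congr 1; ext x
    by_cases hx : x ∈ Ω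
    · by_cases hxK : x ∈ K
      · simp [hx, hxK]
      · simp [hx, hxK, hoff x hx hxK]
    · have hxK : x ∉ K := fun h => hx (hKΩ h)
      simp [hx, hxK, tr_zero]
  rw [h1]
  simp only [tr]
  rw [integral_finsetSum]
  · exact Finset.sum_eq_zero fun i _ => hcomp i
  · intro i _
    exact (EuclideanSpace.proj i : E3 →L[ℝ] ℝ).integrable_comp
      ((ContinuousLinearMap.apply ℝ E3 (EuclideanSpace.single i 1 : E3)).integrable_comp hiZ')

/-- Integration by parts of a scalar factor: `∫ φ div Z = - ∫ ∇φ · Z`, with the two terms joined. -/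
theorem integral_mul_tr_add_eq_zero {Ω K : Set E3} (hΩ : IsOpen Ω) (hK : IsCompact K) (hKΩ : K ⊆ Ω)
    {φ : E3 → ℝ} {φ' : E3 → E3 →L[ℝ] ℝ} (hφ : ∀ x ∈ Ω, HasFDerivAt φ (φ' x) x)
    (hφ' : ContinuousOn φ' Ω) (h0 : ∀ x ∈ Ω, x ∉ K → φ x = 0)
    {Z : E3 → E3} {Z' : E3 → E3 →L[ℝ] E3} (hZ : ∀ x ∈ Ω, HasFDerivAt Z (Z' x) x)
    (hZ' : ContinuousOn Z' Ω) :
    ∫ x in Ω, (φ x * tr (Z' x) + φ' x (Z x)) = 0 := by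
  have hφc : ContinuousOn φ Ω := fun x hx => (hφ x hx).continuousAt.continuousWithinAt
  have hZc : ContinuousOn Z Ω := fun x hx => (hZ x hx).continuousAt.continuousWithinAt
  have := integral_tr_eq_zero hΩ hK hKΩ (Z := fun x => φ x • Z x)
    (Z' := fun x => φ x • Z' x + (φ' x).smulRight (Z x))
    (fun x hx => (hφ x hx).smul (hZ x hx))
    ((hφc.smul hZ').add (by
      have h2 : Continuous fun p : (E3 →L[ℝ] ℝ) × E3 => p.1.smulRight p.2 := by fun_prop
      exact h2.comp_continuousOn (hφ'.prodMk hZc)))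
    (fun x hx hxK => by simp [h0 x hx hxK])
  simpa only [tr_add, tr_smul, tr_smulRight] using this

theorem setIntegral_eq_of_vanishing {Ω K : Set E3} (hΩ : MeasurableSet Ω) (hKΩ : K ⊆ Ω) {F : E3 → ℝ}
    (h0 : ∀ x ∈ Ω, x ∉ K → F x = 0) : ∫ x in Ω, F x = ∫ x in K, F x :=
  setIntegral_eq_of_subset_of_forall_sdiff_eq_zero hΩ hKΩ fun x hx => h0 x hx.1 hx.2

theorem fderiv_eq_zero_off {Ω K : Set E3} (hΩ : IsOpen Ω) (hK : IsClosed K)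
    {φ : E3 → ℝ} {φ' : E3 → E3 →L[ℝ] ℝ} (hφ : ∀ x ∈ Ω, HasFDerivAt φ (φ' x) x)
    (h0 : ∀ x ∈ Ω, x ∉ K → φ x = 0) : ∀ x ∈ Ω, x ∉ K → φ' x = 0 := by
  intro x hx hxK
  have : φ =ᶠ[𝓝 x] fun _ => 0 := by
    filter_upwards [hΩ.mem_nhds hx, hK.isOpen_compl.mem_nhds hxK] with y hy hyK using h0 y hy hyK
  exact (hφ x hx).unique ((hasFDerivAt_const (0 : ℝ) x).congr_of_eventuallyEq this)

/-- One row of the weak identity `div (v · ∇v) = ∇v · (∇v)ᵀ`, proved with difference quotients. -/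
theorem integral_row_eq_zero {Ω K : Set E3} (hΩ : IsOpen Ω) (hK : IsCompact K) (hKΩ : K ⊆ Ω)
    {φ : E3 → ℝ} {φ' : E3 → E3 →L[ℝ] ℝ} (hφ : ∀ x ∈ Ω, HasFDerivAt φ (φ' x) x)
    (hφ' : ContinuousOn φ' Ω) (h0 : ∀ x ∈ Ω, x ∉ K → φ x = 0)
    {u : E3 → E3} {u' : E3 → E3 →L[ℝ] E3} (hu : ∀ x ∈ Ω, HasFDerivAt u (u' x) x)
    (hu' : ContinuousOn u' Ω) (hdiv : ∀ x ∈ Ω, tr (u' x) = 0) {C : ℝ}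
    (hC : ∀ x ∈ Ω, ‖u' x‖ ≤ C) (j : Fin 3) (e : E3) (he : ‖e‖ = 1) :
    ∫ x in K, (u x j * φ' x (u' x e) + φ x * (u' x (u' x e)) j) = 0 := by
  obtain ⟨δ, hδ, hδΩ⟩ := hK.exists_thickening_subset_open hΩ hKΩ
  have hφc : ContinuousOn φ Ω := fun x hx => (hφ x hx).continuousAt.continuousWithinAt
  have huc : ContinuousOn u Ω := fun x hx => (hu x hx).continuousAt.continuousWithinAt
  let Ω' := Metric.thickening (δ / 2) K
  have hΩ'o : IsOpen Ω' := Metric.isOpen_thickening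
  have hKΩ' : K ⊆ Ω' := Metric.self_subset_thickening (by linarith) K
  have hsub : ∀ x ∈ Ω', ∀ y, ‖y - x‖ < δ / 2 → y ∈ Ω := by
    intro x hx y hy
    apply hδΩ
    rw [Metric.mem_thickening_iff] at hx ⊢
    obtain ⟨z, hz, hxz⟩ := hx
    refine ⟨z, hz, ?_⟩
    calc dist y z ≤ dist y x + dist x z := dist_triangle _ _ _
      _ < δ := by rw [dist_eq_norm]; linarith
  have hΩ'Ω : Ω' ⊆ Ω := fun x hx => hsub x hx x (by simpa using by linarith)
  -- The field `∂_e u` need not be differentiable. Its difference quotient `w h` is `C¹` and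
  -- divergence free on `Ω'`, the margin `δ / 2` keeping the shifted points in `Ω`.
  let w : ℝ → E3 → E3 := fun h x => h⁻¹ • (u (x + h • e) - u x)
  let w' : ℝ → E3 → E3 →L[ℝ] E3 := fun h x => h⁻¹ • (u' (x + h • e) - u' x)
  have hmem : ∀ h : ℝ, |h| < δ / 2 → ∀ x ∈ Ω', x + h • e ∈ Ω := by
    intro h hh x hx
    exact hsub x hx _ (by simpa [norm_smul, he] using hh)
  have hw : ∀ h : ℝ, |h| < δ / 2 → ∀ x ∈ Ω', HasFDerivAt (w h) (w' h x) x := by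
    intro h hh x hx
    have h1 : HasFDerivAt (fun x => u (x + h • e)) (u' (x + h • e)) x :=
      (hasFDerivAt_comp_add_right (h • e)).2 (hu _ (hmem h hh x hx))
    exact (h1.sub (hu x (hΩ'Ω hx))).const_smul h⁻¹
  have hw'c : ∀ h : ℝ, |h| < δ / 2 → ContinuousOn (w' h) Ω' := by
    intro h hh
    have h1 : ContinuousOn (fun x => u' (x + h • e)) Ω' :=
      hu'.comp (by fun_prop) fun x hx => hmem h hh x hx
    exact (h1.sub (hu'.mono hΩ'Ω)).const_smul h⁻¹
  have hwc : ∀ h : ℝ, |h| < δ / 2 → ContinuousOn (w h) Ω' := fun h hh x hx =>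
    (hw h hh x hx).continuousAt.continuousWithinAt
  have key : ∀ h : ℝ, |h| < δ / 2 →
      ∫ x in K, (u x j * φ' x (w h x) + φ x * (u' x (w h x)) j) = 0 := by
    intro h hh
    have huj : ∀ x ∈ Ω', HasFDerivAt (fun x => u x j)
        ((EuclideanSpace.proj j : E3 →L[ℝ] ℝ).comp (u' x)) x := fun x hx =>
      (EuclideanSpace.proj j : E3 →L[ℝ] ℝ).hasFDerivAt.comp x (hu x (hΩ'Ω hx))
    have hujc : ContinuousOn (fun x => u x j) Ω' := fun x hx =>
      (huj x hx).continuousAt.continuousWithinAt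
    -- Testing `div (w h) = 0` with `φ u_j` leaves only first derivatives of `u`, so the limit `h →
    -- 0` can be taken.
    have := integral_mul_tr_add_eq_zero hΩ'o hK hKΩ' (φ := fun x => φ x * u x j)
      (fun x hx => (hφ x (hΩ'Ω hx)).mul (huj x hx))
      (((hφc.mono hΩ'Ω).smul (continuousOn_const.clm_comp (hu'.mono hΩ'Ω))).add
        (hujc.smul (hφ'.mono hΩ'Ω)))
      (fun x hx hxK => by simp [h0 x (hΩ'Ω hx) hxK])
      (hw h hh) (hw'c h hh)
    rw [setIntegral_eq_of_vanishing hΩ'o.measurableSet hKΩ'] at this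
    · rw [← this]
      refine setIntegral_congr_fun hK.measurableSet fun x hx => ?_
      have e1 : tr (w' h x) = 0 := by
        have : w' h x = h⁻¹ • (u' (x + h • e) + (-1 : ℝ) • u' x) := by
          simp only [w']; module
        rw [this, tr_smul, tr_add, tr_smul, hdiv _ (hmem h hh x (hKΩ' hx)), hdiv _ (hKΩ hx)]
        simp
      simp [e1]
      ring
    · intro x hx hxK
      have := fderiv_eq_zero_off hΩ hK.isClosed hφ h0 x (hΩ'Ω hx) hxK
      simp [this, h0 x (hΩ'Ω hx) hxK]
  have hev : ∀ᶠ h : ℝ in 𝓝[≠] 0, |h| < δ / 2 := by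
    apply nhdsWithin_le_nhds
    have : ContinuousAt (fun h : ℝ => |h|) 0 := by fun_prop
    exact this.eventually_lt continuousAt_const (by simpa using by linarith)
  have hlim : Tendsto (fun h => ∫ x in K, (u x j * φ' x (w h x) + φ x * (u' x (w h x)) j))
      (𝓝[≠] 0) (𝓝 (∫ x in K, (u x j * φ' x (u' x e) + φ x * (u' x (u' x e)) j))) := by
    have hboundc : ContinuousOn (fun x => (|u x j| * ‖φ' x‖ + |φ x| * ‖u' x‖) * C) K := by
      have : ContinuousOn (fun x => u x j) K :=
        (EuclideanSpace.proj j : E3 →L[ℝ] ℝ).continuous.comp_continuousOn (huc.mono hKΩ)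
      exact (((this.abs).mul (hφ'.mono hKΩ).norm).add
        ((hφc.mono hKΩ).abs.mul (hu'.mono hKΩ).norm)).mul continuousOn_const
    refine tendsto_integral_filter_of_dominated_convergence
      (fun x => (|u x j| * ‖φ' x‖ + |φ x| * ‖u' x‖) * C) ?_ ?_
      (hboundc.integrableOn_compact hK) ?_
    · filter_upwards [hev] with h hh
      refine ContinuousOn.aestronglyMeasurable ?_ hK.measurableSet
      have h1 : ContinuousOn (fun x => u x j) K :=
        (EuclideanSpace.proj j : E3 →L[ℝ] ℝ).continuous.comp_continuousOn (huc.mono hKΩ)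
      have h2 := (hwc h hh).mono hKΩ'
      exact (h1.mul ((hφ'.mono hKΩ).clm_apply h2)).add ((hφc.mono hKΩ).mul
        ((EuclideanSpace.proj j : E3 →L[ℝ] ℝ).continuous.comp_continuousOn
          ((hu'.mono hKΩ).clm_apply h2)))
    · filter_upwards [hev] with h hh
      filter_upwards [ae_restrict_mem hK.measurableSet] with x hx
      -- The mean value inequality bounds the quotients uniformly in `h`, which provides the
      -- dominating function.
      have hwb : ‖w h x‖ ≤ C := by
        have hball : ∀ y ∈ Metric.ball x (δ / 2), y ∈ Ω := fun y hy =>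
          hsub x (hKΩ' hx) y (by simpa [dist_eq_norm] using hy)
        have h3 := (convex_ball x (δ / 2)).norm_image_sub_le_of_norm_hasFDerivWithin_le
          (f := u) (f' := u') (C := C)
          (fun y hy => (hu y (hball y hy)).hasFDerivWithinAt) (fun y hy => hC y (hball y hy))
          (Metric.mem_ball_self (by linarith))
          (show x + h • e ∈ Metric.ball x (δ / 2) by simpa [norm_smul, he] using hh)
        have h4 : ‖x + h • e - x‖ = |h| := by simp [norm_smul, he]
        rw [h4] at h3
        have hC0 : 0 ≤ C := (norm_nonneg _).trans (hC x (hKΩ hx))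
        simp only [w, norm_smul, norm_inv, Real.norm_eq_abs]
        by_cases hz : |h| = 0
        · simpa [hz] using hC0
        · rw [inv_mul_le_iff₀ (lt_of_le_of_ne (abs_nonneg h) (Ne.symm hz))]
          linarith
      have hj : ∀ v : E3, |v j| ≤ ‖v‖ := fun v => by
        simpa using PiLp.norm_apply_le v j
      calc ‖u x j * φ' x (w h x) + φ x * (u' x (w h x)) j‖
          ≤ |u x j| * |φ' x (w h x)| + |φ x| * |(u' x (w h x)) j| := by
            rw [← abs_mul, ← abs_mul]; exact abs_add_le _ _
        _ ≤ |u x j| * (‖φ' x‖ * C) + |φ x| * (‖u' x‖ * C) := by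
            gcongr
            · exact ((φ' x).le_opNorm _).trans (by gcongr)
            · exact (hj _).trans (((u' x).le_opNorm _).trans (by gcongr))
        _ = (|u x j| * ‖φ' x‖ + |φ x| * ‖u' x‖) * C := by ring
    · filter_upwards [ae_restrict_mem hK.measurableSet] with x hx
      have hwl : Tendsto (fun h => w h x) (𝓝[≠] 0) (𝓝 (u' x e)) := by
        have h1 := ((hu x (hKΩ hx)).hasLineDerivAt e)
        simpa [w, HasLineDerivAt] using (hasDerivAt_iff_tendsto_slope_zero.1 h1)
      have h2 : Continuous fun v : E3 => u x j * φ' x v + φ x * (u' x v) j := by fun_prop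
      exact (h2.tendsto _).comp hwl
  refine tendsto_nhds_unique hlim ?_
  refine tendsto_const_nhds.congr' ?_
  filter_upwards [hev] with h hh using (key h hh).symm

/-- The weak form of `div (v · ∇v) = ∇v · (∇v)ᵀ` for a divergence free field of class `C¹`. -/
theorem integral_advect_weak {Ω K : Set E3} (hΩ : IsOpen Ω) (hK : IsCompact K) (hKΩ : K ⊆ Ω)
    {φ : E3 → ℝ} {φ' : E3 → E3 →L[ℝ] ℝ} (hφ : ∀ x ∈ Ω, HasFDerivAt φ (φ' x) x)
    (hφ' : ContinuousOn φ' Ω) (h0 : ∀ x ∈ Ω, x ∉ K → φ x = 0)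
    {u : E3 → E3} {u' : E3 → E3 →L[ℝ] E3} (hu : ∀ x ∈ Ω, HasFDerivAt u (u' x) x)
    (hu' : ContinuousOn u' Ω) (hdiv : ∀ x ∈ Ω, tr (u' x) = 0) {C : ℝ}
    (hC : ∀ x ∈ Ω, ‖u' x‖ ≤ C) :
    ∫ x in Ω, (φ x * tr ((u' x).comp (u' x)) + φ' x (u' x (u x))) = 0 := by
  have hφc : ContinuousOn φ Ω := fun x hx => (hφ x hx).continuousAt.continuousWithinAt
  have huc : ContinuousOn u Ω := fun x hx => (hu x hx).continuousAt.continuousWithinAt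
  rw [setIntegral_eq_of_vanishing hΩ.measurableSet hKΩ]
  · have hrow := fun j : Fin 3 => integral_row_eq_zero hΩ hK hKΩ hφ hφ' h0 hu hu' hdiv hC j
      (EuclideanSpace.single j 1) (by simp)
    -- Row `j` is used in the direction `e_j`; summing over `j` produces both `u · ∇u` and the trace
    -- of `u' ∘ u'`.
    have hsum : ∀ x, φ x * tr ((u' x).comp (u' x)) + φ' x (u' x (u x)) =
        ∑ j : Fin 3, (u x j * φ' x (u' x (EuclideanSpace.single j 1))
          + φ x * (u' x (u' x (EuclideanSpace.single j 1))) j) := by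
      intro x
      have hv : u x = ∑ i : Fin 3, u x i • (EuclideanSpace.single i 1 : E3) := by
        ext j; fin_cases j <;> simp [Fin.sum_univ_three]
      have : φ' x (u' x (u x)) = ∑ j : Fin 3, u x j * φ' x (u' x (EuclideanSpace.single j 1)) := by
        conv_lhs => rw [hv]
        simp [map_sum]
      rw [this, Finset.sum_add_distrib, ← Finset.mul_sum, add_comm]
      simp [tr]
    simp only [hsum]
    rw [integral_finsetSum]
    · exact Finset.sum_eq_zero fun j _ => hrow j
    · intro j _
      refine ContinuousOn.integrableOn_compact hK ?_
      have h1 : ContinuousOn (fun x => u x j) K :=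
        (EuclideanSpace.proj j : E3 →L[ℝ] ℝ).continuous.comp_continuousOn (huc.mono hKΩ)
      have h2 : ContinuousOn (fun x => u' x (EuclideanSpace.single j 1)) K :=
        (hu'.mono hKΩ).clm_apply continuousOn_const
      exact (h1.mul ((hφ'.mono hKΩ).clm_apply h2)).add ((hφc.mono hKΩ).mul
        ((EuclideanSpace.proj j : E3 →L[ℝ] ℝ).continuous.comp_continuousOn
          ((hu'.mono hKΩ).clm_apply h2)))
  · intro x hx hxK
    simp [h0 x hx hxK, fderiv_eq_zero_off hΩ hK.isClosed hφ h0 x hx hxK]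

/-! ### One-dimensional cutoffs -/

/-- A smooth bump supported in `[1,2]`. -/
noncomputable def unitBump : ContDiffBump (3 / 2 : ℝ) := ⟨1 / 4, 1 / 2, by norm_num, by norm_num⟩

/-- The primitive of `unitBump`. -/
noncomputable def unitStep (s : ℝ) : ℝ := ∫ t in (0 : ℝ)..s, unitBump t

theorem unitBump_eq_zero {s : ℝ} (h : s ≤ 1 ∨ 2 ≤ s) : unitBump s = 0 := by
  apply unitBump.zero_of_le_dist
  rw [Real.dist_eq]
  change (1 / 2 : ℝ) ≤ _
  rcases h with h | h
  · rw [abs_of_nonpos (by linarith)]; linarith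
  · rw [abs_of_nonneg (by linarith)]; linarith

theorem hasDerivAt_unitStep (s : ℝ) : HasDerivAt unitStep (unitBump s) s :=
  intervalIntegral.integral_hasDerivAt_right (unitBump.continuous.intervalIntegrable _ _)
    (unitBump.continuous.stronglyMeasurableAtFilter _ _) unitBump.continuous.continuousAt

theorem unitStep_eq_zero {s : ℝ} (h : s ≤ 1) : unitStep s = 0 := by
  have : ∫ t in (0 : ℝ)..s, unitBump t = ∫ t in (0 : ℝ)..s, (0 : ℝ) := by
    refine intervalIntegral.integral_congr fun t ht => unitBump_eq_zero (Or.inl ?_)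
    rw [mem_uIcc] at ht
    rcases ht with ht | ht <;> linarith [ht.1, ht.2]
  simpa [unitStep] using this

theorem unitStep_mono : Monotone unitStep :=
  monotone_of_deriv_nonneg (fun s => (hasDerivAt_unitStep s).differentiableAt) fun s => by
    rw [(hasDerivAt_unitStep s).deriv]; exact unitBump.nonneg

theorem unitStep_nonneg (s : ℝ) : 0 ≤ unitStep s := by
  rcases le_total s 1 with h | h
  · rw [unitStep_eq_zero h]
  · rw [← unitStep_eq_zero le_rfl]; exact unitStep_mono h

theorem unitStep_eq_of_two_le {s : ℝ} (h : 2 ≤ s) : unitStep s = unitStep 2 := by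
  have h1 : unitStep s - unitStep 2 = ∫ t in (2 : ℝ)..s, unitBump t :=
    intervalIntegral.integral_interval_sub_left (unitBump.continuous.intervalIntegrable _ _)
      (unitBump.continuous.intervalIntegrable _ _)
  have : ∫ t in (2 : ℝ)..s, unitBump t = ∫ t in (2 : ℝ)..s, (0 : ℝ) := by
    refine intervalIntegral.integral_congr fun t ht => unitBump_eq_zero (Or.inr ?_)
    rw [uIcc_of_le h] at ht
    exact ht.1
  rw [this] at h1
  simp at h1
  linarith

theorem unitStep_le (s : ℝ) : unitStep s ≤ unitStep 2 := by
  rcases le_total s 2 with h | h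
  · exact unitStep_mono h
  · exact (unitStep_eq_of_two_le h).le

/-- The total mass of the bump is not normalised to one. Positivity suffices, because the constant
is divided out of the limit of the divergence theorem in `integral_fderiv_eq_zero`. -/
theorem unitStep_two_pos : 0 < unitStep 2 := by
  have h1 : unitStep 2 - unitStep 1 = ∫ t in (1 : ℝ)..2, unitBump t :=
    intervalIntegral.integral_interval_sub_left (unitBump.continuous.intervalIntegrable _ _)
      (unitBump.continuous.intervalIntegrable _ _)
  have h2 : 0 < ∫ t in (1 : ℝ)..2, unitBump t :=
    intervalIntegral.intervalIntegral_pos_of_pos_on (unitBump.continuous.intervalIntegrable _ _)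
      (fun x hx => unitBump.pos_of_mem_ball (by
        rw [Metric.mem_ball, Real.dist_eq]
        change _ < (1 / 2 : ℝ)
        rw [abs_lt]; constructor <;> linarith [hx.1, hx.2])) (by norm_num)
  rw [unitStep_eq_zero le_rfl] at h1
  linarith

/-- The density of the boundary layer of thickness `1/(n+1)`. -/
noncomputable def layerDensity (n : ℕ) (s : ℝ) : ℝ := (n + 1) * unitBump ((n + 1) * s)

/-- The primitive of `layerDensity`. -/
noncomputable def layerStep (n : ℕ) (s : ℝ) : ℝ := unitStep ((n + 1) * s)

theorem hasDerivAt_layerStep (n : ℕ) (s : ℝ) : HasDerivAt (layerStep n) (layerDensity n s) s := by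
  have := (hasDerivAt_unitStep ((n + 1) * s)).comp s ((hasDerivAt_id s).const_mul ((n : ℝ) + 1))
  convert! this using 1
  simp [layerDensity, mul_comm]

theorem layerDensity_nonneg (n : ℕ) (s : ℝ) : 0 ≤ layerDensity n s :=
  mul_nonneg (by positivity) unitBump.nonneg

theorem contDiff_layerDensity (n : ℕ) : ContDiff ℝ 1 (layerDensity n) :=
  contDiff_const.mul (unitBump.contDiff.comp (contDiff_const.mul contDiff_id))

theorem continuous_layerStep (n : ℕ) : Continuous (layerStep n) :=
  continuous_iff_continuousAt.2 fun s => (hasDerivAt_layerStep n s).continuousAt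

theorem layerDensity_eq_zero {n : ℕ} {s : ℝ} (h : s ≤ 1 / (n + 1) ∨ 2 / (n + 1) ≤ s) :
    layerDensity n s = 0 := by
  have hn : (0 : ℝ) < n + 1 := by positivity
  rw [layerDensity, unitBump_eq_zero, mul_zero]
  rcases h with h | h
  · left; rwa [le_div_iff₀ hn, mul_comm] at h
  · right; rwa [div_le_iff₀ hn, mul_comm] at h

theorem layerStep_eq_zero {n : ℕ} {s : ℝ} (h : s ≤ 1 / (n + 1)) : layerStep n s = 0 := by
  have hn : (0 : ℝ) < n + 1 := by positivity
  apply unitStep_eq_zero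
  rwa [le_div_iff₀ hn, mul_comm] at h

theorem layerStep_nonneg (n : ℕ) (s : ℝ) : 0 ≤ layerStep n s := unitStep_nonneg _

theorem layerStep_le (n : ℕ) (s : ℝ) : layerStep n s ≤ unitStep 2 := unitStep_le _

theorem tendsto_layerStep {s : ℝ} (hs : 0 < s) :
    Tendsto (fun n => layerStep n s) atTop (𝓝 (unitStep 2)) := by
  refine tendsto_const_nhds.congr' ?_
  obtain ⟨N, hN⟩ := exists_nat_gt (2 / s)
  filter_upwards [eventually_ge_atTop N] with n hn
  refine (unitStep_eq_of_two_le ?_).symm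
  rw [div_lt_iff₀ hs] at hN
  have : (N : ℝ) ≤ n := by exact_mod_cast hn
  nlinarith

/-! ### Defining functions and boundary layers -/

/-- A `C²` function `d` on the whole space which is positive exactly on `Ω` and whose gradient `m` does
not vanish on the boundary, with a `C¹` function `κ` equal to `1 / |m|²` near the boundary. -/
structure DefiningFunction (Ω : Set E3) where
  /-- the defining function -/
  d : E3 → ℝ
  /-- its gradient -/
  m : E3 → E3
  /-- its Hessian -/
  m' : E3 → E3 →L[ℝ] E3
  /-- the inverse square of the gradient near the boundary -/
  κ : E3 → ℝ
  /-- the derivative of `κ` -/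
  κ' : E3 → E3 →L[ℝ] ℝ
  hasFDerivAt_d : ∀ x, HasFDerivAt d (innerSL ℝ (m x)) x
  hasFDerivAt_m : ∀ x, HasFDerivAt m (m' x) x
  continuous_m' : Continuous m'
  symm : ∀ x a b, ⟪m' x a, b⟫ = ⟪a, m' x b⟫
  hasFDerivAt_κ : ∀ x, HasFDerivAt κ (κ' x) x
  continuous_κ' : Continuous κ'
  pos_iff : ∀ x, x ∈ Ω ↔ 0 < d x
  κ_eq : ∀ x ∈ frontier Ω, ∀ᶠ y in 𝓝 x, κ y * ‖m y‖ ^ 2 = 1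

namespace DefiningFunction

variable {Ω : Set E3} (D : DefiningFunction Ω)

theorem continuous_d : Continuous D.d :=
  continuous_iff_continuousAt.2 fun x => (D.hasFDerivAt_d x).continuousAt

theorem continuous_m : Continuous D.m :=
  continuous_iff_continuousAt.2 fun x => (D.hasFDerivAt_m x).continuousAt

theorem continuous_κ : Continuous D.κ :=
  continuous_iff_continuousAt.2 fun x => (D.hasFDerivAt_κ x).continuousAt

theorem isOpen (D : DefiningFunction Ω) : IsOpen Ω := by
  have : Ω = D.d ⁻¹' Ioi 0 := by ext x; exact D.pos_iff x
  rw [this]; exact isOpen_Ioi.preimage D.continuous_d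

theorem nonneg_of_mem_closure {x : E3} (hx : x ∈ closure Ω) : 0 ≤ D.d x := by
  have : IsClosed (D.d ⁻¹' Ici 0) := isClosed_Ici.preimage D.continuous_d
  exact closure_minimal (fun y hy => ((D.pos_iff y).1 hy).le) this hx

theorem eq_zero_of_mem_frontier {x : E3} (hx : x ∈ frontier Ω) : D.d x = 0 := by
  refine le_antisymm ?_ (D.nonneg_of_mem_closure (frontier_subset_closure hx))
  by_contra! h
  have := (D.pos_iff x).2 h
  rw [D.isOpen.frontier_eq] at hx
  exact hx.2 this

theorem m_ne_zero {x : E3} (hx : x ∈ frontier Ω) : D.m x ≠ 0 := by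
  intro h
  have := (D.κ_eq x hx).self_of_nhds
  simp [h] at this

/-- The part of `Ω` at distance about `1/(n+1)` from the boundary. -/
def core (n : ℕ) : Set E3 := closure Ω ∩ {x | 1 / ((n : ℝ) + 1) ≤ D.d x}

theorem core_subset (n : ℕ) : D.core n ⊆ Ω := fun x hx =>
  (D.pos_iff x).2 (lt_of_lt_of_le (by positivity) hx.2)

theorem isCompact_core (hb : Bornology.IsBounded Ω) (n : ℕ) : IsCompact (D.core n) :=
  hb.isCompact_closure.inter_right (isClosed_Ici.preimage D.continuous_d)

theorem lt_of_notMem_core {n : ℕ} {x : E3} (hx : x ∈ Ω) (h : x ∉ D.core n) :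
    D.d x < 1 / ((n : ℝ) + 1) := by
  by_contra! h'
  exact h ⟨subset_closure hx, h'⟩

theorem layerDensity_off {n : ℕ} {x : E3} (hx : x ∈ Ω) (h : x ∉ D.core n) :
    layerDensity n (D.d x) = 0 := layerDensity_eq_zero (Or.inl (D.lt_of_notMem_core hx h).le)

theorem layerStep_off {n : ℕ} {x : E3} (hx : x ∈ Ω) (h : x ∉ D.core n) :
    layerStep n (D.d x) = 0 := layerStep_eq_zero (D.lt_of_notMem_core hx h).le

/-- The mean of `g` over the boundary layer of thickness about `1/(n+1)`. -/
noncomputable def layer (n : ℕ) (g : E3 → ℝ) : ℝ := ∫ x in Ω, layerDensity n (D.d x) * g x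

theorem continuous_density (n : ℕ) : Continuous fun x => layerDensity n (D.d x) :=
  (contDiff_layerDensity n).continuous.comp D.continuous_d

theorem continuous_step (n : ℕ) : Continuous fun x => layerStep n (D.d x) :=
  (continuous_layerStep n).comp D.continuous_d

theorem integrableOn_of_off (hb : Bornology.IsBounded Ω) {n : ℕ} {F : E3 → ℝ}
    (hF : ContinuousOn F Ω) (h0 : ∀ x ∈ Ω, x ∉ D.core n → F x = 0) : IntegrableOn F Ω := by
  have h1 : IntegrableOn F (D.core n) :=
    (hF.mono (D.core_subset n)).integrableOn_compact (D.isCompact_core hb n)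
  exact h1.of_forall_sdiff_eq_zero D.isOpen.measurableSet fun x hx => h0 x hx.1 hx.2

theorem integrableOn_layer (hb : Bornology.IsBounded Ω) (n : ℕ) {g : E3 → ℝ}
    (hg : ContinuousOn g Ω) : IntegrableOn (fun x => layerDensity n (D.d x) * g x) Ω :=
  D.integrableOn_of_off hb (n := n) ((D.continuous_density n).continuousOn.mul hg)
    fun x hx hxK => by simp [D.layerDensity_off hx hxK]

theorem layer_add (hb : Bornology.IsBounded Ω) (n : ℕ) {g h : E3 → ℝ}
    (hg : ContinuousOn g Ω) (hh : ContinuousOn h Ω) :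
    D.layer n (fun x => g x + h x) = D.layer n g + D.layer n h := by
  simp only [layer, mul_add]
  exact integral_add (D.integrableOn_layer hb n hg) (D.integrableOn_layer hb n hh)

theorem layer_const_mul (n : ℕ) (c : ℝ) (g : E3 → ℝ) :
    D.layer n (fun x => c * g x) = c * D.layer n g := by
  simp only [layer, ← integral_const_mul]
  congr 1; ext x; ring

theorem layer_mono (hb : Bornology.IsBounded Ω) (n : ℕ) {g h : E3 → ℝ}
    (hg : ContinuousOn g Ω) (hh : ContinuousOn h Ω)
    (hle : ∀ x ∈ Ω, D.d x < 2 / ((n : ℝ) + 1) → g x ≤ h x) : D.layer n g ≤ D.layer n h := by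
  refine setIntegral_mono_on (D.integrableOn_layer hb n hg) (D.integrableOn_layer hb n hh)
    D.isOpen.measurableSet fun x hx => ?_
  rcases lt_or_ge (D.d x) (2 / ((n : ℝ) + 1)) with h | h
  · exact mul_le_mul_of_nonneg_left (hle x hx h) (layerDensity_nonneg _ _)
  · simp [layerDensity_eq_zero (Or.inr h)]

theorem layer_congr (hb : Bornology.IsBounded Ω) (n : ℕ) {g h : E3 → ℝ}
    (hg : ContinuousOn g Ω) (hh : ContinuousOn h Ω)
    (hle : ∀ x ∈ Ω, D.d x < 2 / ((n : ℝ) + 1) → g x = h x) : D.layer n g = D.layer n h :=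
  le_antisymm (D.layer_mono hb n hg hh fun x hx h => (hle x hx h).le)
    (D.layer_mono hb n hh hg fun x hx h => (hle x hx h).ge)

/-- Layer integrals of the divergence of fields tangential to the level sets vanish. -/
theorem layer_tr_eq_zero (hb : Bornology.IsBounded Ω) (n : ℕ) {Y : E3 → E3}
    {Y' : E3 → E3 →L[ℝ] E3} (hY : ∀ x ∈ Ω, HasFDerivAt Y (Y' x) x) (hY' : ContinuousOn Y' Ω)
    (htan : ∀ x ∈ Ω, ⟪D.m x, Y x⟫ = 0) : D.layer n (fun x => tr (Y' x)) = 0 := by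
  have hdd : ∀ s, HasDerivAt (layerDensity n) (deriv (layerDensity n) s) s := fun s =>
    ((contDiff_layerDensity n).differentiable (by simp) s).hasDerivAt
  have hdc : Continuous (deriv (layerDensity n)) :=
    (contDiff_layerDensity n).continuous_deriv (by simp)
  -- The gradient of the test function is a multiple of `m`, hence orthogonal to `Y`: the identity
  -- is exact for each `n`.
  have := integral_mul_tr_add_eq_zero D.isOpen (D.isCompact_core hb n) (D.core_subset n)
    (φ := fun x => layerDensity n (D.d x))
    (fun x _ => (hdd (D.d x)).comp_hasFDerivAt x (D.hasFDerivAt_d x))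
    ((hdc.comp D.continuous_d).smul ((innerSL ℝ).continuous.comp D.continuous_m)).continuousOn
    (fun x hx hxK => D.layerDensity_off hx hxK) hY hY'
  rw [← this]
  refine setIntegral_congr_fun D.isOpen.measurableSet fun x hx => ?_
  simp [htan x hx]

/-- The divergence theorem in the set enclosed by a boundary layer. -/
theorem layer_inner_add (hb : Bornology.IsBounded Ω) (n : ℕ) {Z : E3 → E3}
    {Z' : E3 → E3 →L[ℝ] E3} (hZ : ∀ x ∈ Ω, HasFDerivAt Z (Z' x) x) (hZ' : ContinuousOn Z' Ω) :
    D.layer n (fun x => ⟪D.m x, Z x⟫) = -∫ x in Ω, layerStep n (D.d x) * tr (Z' x) := by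
  have hZc : ContinuousOn Z Ω := fun x hx => (hZ x hx).continuousAt.continuousWithinAt
  have := integral_mul_tr_add_eq_zero D.isOpen (D.isCompact_core hb n) (D.core_subset n)
    (φ := fun x => layerStep n (D.d x))
    (fun x _ => (hasDerivAt_layerStep n (D.d x)).comp_hasFDerivAt x (D.hasFDerivAt_d x))
    ((D.continuous_density n).smul ((innerSL ℝ).continuous.comp D.continuous_m)).continuousOn
    (fun x hx hxK => D.layerStep_off hx hxK) hZ hZ'
  rw [integral_add] at this
  · rw [layer, eq_neg_iff_add_eq_zero, add_comm, ← this]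
    simp
  · exact D.integrableOn_of_off hb (n := n) ((D.continuous_step n).continuousOn.mul
      (continuous_tr.comp_continuousOn hZ')) fun x hx hxK => by simp [D.layerStep_off hx hxK]
  · have := D.integrableOn_layer hb n (g := fun x => ⟪D.m x, Z x⟫)
      (D.continuous_m.continuousOn.inner hZc)
    simpa [IntegrableOn] using this

/-- A property that holds near the boundary holds in all sufficiently thin boundary layers. -/
theorem eventually_layer (hb : Bornology.IsBounded Ω) {p : E3 → Prop}
    (hp : ∀ x ∈ frontier Ω, ∀ᶠ y in 𝓝[closure Ω] x, p y) :
    ∀ᶠ n : ℕ in atTop, ∀ x ∈ Ω, D.d x < 2 / ((n : ℝ) + 1) → p x := by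
  choose! W hWo hxW hWp using fun x hx => mem_nhdsWithin.1 (hp x hx)
  let V := ⋃ x ∈ frontier Ω, W x
  have hVo : IsOpen V := isOpen_biUnion fun x hx => hWo x hx
  -- Away from the neighbourhood `V` of the boundary, `d` has a positive minimum by compactness, so
  -- thin layers lie in `V`.
  have hcpt : IsCompact (closure Ω \ V) := hb.isCompact_closure.diff hVo
  have hpos : ∀ x ∈ closure Ω \ V, 0 < D.d x := by
    intro x hx
    rw [← D.pos_iff]
    by_contra h
    have : x ∈ frontier Ω := by rw [D.isOpen.frontier_eq]; exact ⟨hx.1, h⟩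
    exact hx.2 (mem_biUnion this (hxW x this))
  obtain ⟨η, hη, hle⟩ : ∃ η > 0, ∀ x ∈ closure Ω \ V, η ≤ D.d x := by
    rcases (closure Ω \ V).eq_empty_or_nonempty with he | hne
    · exact ⟨1, one_pos, fun x hx => by simp [he] at hx⟩
    · obtain ⟨x0, hx0, hmin⟩ := hcpt.exists_isMinOn hne D.continuous_d.continuousOn
      exact ⟨D.d x0, hpos x0 hx0, fun x hx => hmin hx⟩
  obtain ⟨N, hN⟩ := exists_nat_gt (2 / η)
  filter_upwards [eventually_ge_atTop N] with n hn x hx hlt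
  have hxV : x ∈ V := by
    by_contra h
    have h1 := hle x ⟨subset_closure hx, h⟩
    rw [div_lt_iff₀ hη] at hN
    have : (N : ℝ) ≤ n := by exact_mod_cast hn
    rw [lt_div_iff₀ (by positivity)] at hlt
    nlinarith
  obtain ⟨y, hy, hxy⟩ := mem_iUnion₂.1 hxV
  exact hWp y hy ⟨hxy, subset_closure hx⟩

/-- The field `κ m` has inner product one with `m` near the boundary, so the divergence theorem
turns the mass of a layer into a volume integral bounded independently of `n`. This replaces a bound
on the surface area. -/
theorem exists_layer_one_le (hb : Bornology.IsBounded Ω) :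
    ∃ M > 0, ∀ᶠ n in atTop, D.layer n (fun _ => 1) ≤ M := by
  let Z' : E3 → E3 →L[ℝ] E3 := fun x => D.κ x • D.m' x + (D.κ' x).smulRight (D.m x)
  have hZ : ∀ x, HasFDerivAt (fun x => D.κ x • D.m x) (Z' x) x := fun x =>
    (D.hasFDerivAt_κ x).smul (D.hasFDerivAt_m x)
  have hZ' : Continuous Z' := (D.continuous_κ.smul D.continuous_m').add (by
      have h2 : Continuous fun p : (E3 →L[ℝ] ℝ) × E3 => p.1.smulRight p.2 := by fun_prop
      exact h2.comp (D.continuous_κ'.prodMk D.continuous_m))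
  obtain ⟨C, hC⟩ := hb.isCompact_closure.exists_bound_of_continuousOn
    (continuous_tr.comp hZ').continuousOn
  refine ⟨|unitStep 2 * C * volume.real Ω| + 1, by positivity, ?_⟩
  filter_upwards [D.eventually_layer hb
    (fun x hx => nhdsWithin_le_nhds (D.κ_eq x hx))] with n hn
  have h1 : D.layer n (fun _ => 1) = D.layer n (fun x => ⟪D.m x, D.κ x • D.m x⟫) := by
    refine D.layer_congr hb n continuousOn_const
      (D.continuous_m.inner (D.continuous_κ.smul D.continuous_m)).continuousOn fun x hx hd => ?_
    rw [inner_smul_right, real_inner_self_eq_norm_sq, hn x hx hd]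
  rw [h1, D.layer_inner_add hb n (fun x _ => hZ x) hZ'.continuousOn]
  refine (le_abs_self _).trans ?_
  rw [abs_neg, ← Real.norm_eq_abs]
  have h2 := norm_setIntegral_le_of_norm_le_const (μ := volume) (s := Ω)
    (f := fun x => layerStep n (D.d x) * tr (Z' x)) (C := unitStep 2 * C)
    hb.measure_lt_top (fun x hx => by
      rw [norm_mul, Real.norm_of_nonneg (layerStep_nonneg _ _)]
      exact mul_le_mul (layerStep_le _ _) (hC x (subset_closure hx)) (norm_nonneg _)
        (unitStep_nonneg _))
  exact h2.trans ((le_abs_self _).trans (by linarith))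

/-- Layer integrals only see the boundary values in the limit. -/
theorem eventually_layer_le (hb : Bornology.IsBounded Ω) {g : E3 → ℝ}
    (hg : ContinuousOn g (closure Ω)) (hle : ∀ x ∈ frontier Ω, g x ≤ 0) {δ : ℝ} (hδ : 0 < δ) :
    ∀ᶠ n in atTop, D.layer n g ≤ δ := by
  obtain ⟨M, hM, hMn⟩ := D.exists_layer_one_le hb
  have hnear : ∀ x ∈ frontier Ω, ∀ᶠ y in 𝓝[closure Ω] x, g y ≤ δ / M := fun x hx =>
    ((hg x (frontier_subset_closure hx)).eventually_lt continuousWithinAt_const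
      ((hle x hx).trans_lt (by positivity : (0 : ℝ) < δ / M))).mono fun y hy => hy.le
  filter_upwards [hMn, D.eventually_layer hb hnear] with n h1 h2
  calc D.layer n g ≤ D.layer n (fun _ => δ / M * 1) :=
        D.layer_mono hb n (hg.mono subset_closure) continuousOn_const
          fun x hx hd => by simpa using h2 x hx hd
    _ = δ / M * D.layer n (fun _ => 1) := D.layer_const_mul n _ _
    _ ≤ δ / M * M := by gcongr
    _ = δ := by field_simp

/-- Both `M` and the threshold for `n` are independent of `g`, so the bound can be used for all
times at once. -/
theorem exists_abs_layer_le (hb : Bornology.IsBounded Ω) :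
    ∃ M > 0, ∀ᶠ n in atTop, ∀ (g : E3 → ℝ) (C : ℝ), ContinuousOn g Ω → (∀ x ∈ Ω, |g x| ≤ C) →
      0 ≤ C → |D.layer n g| ≤ C * M := by
  obtain ⟨M, hM, hMn⟩ := D.exists_layer_one_le hb
  refine ⟨M, hM, ?_⟩
  filter_upwards [hMn] with n h1 g C hg hgC hC
  have h2 : ∀ c : ℝ, D.layer n (fun _ => c) = c * D.layer n (fun _ => 1) := fun c => by
    rw [← D.layer_const_mul n]; simp
  have h3 := D.layer_mono hb n hg (h := fun _ => C) continuousOn_const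
    fun x hx _ => (abs_le.1 (hgC x hx)).2
  have h4 := D.layer_mono hb n (g := fun _ => -C) continuousOn_const hg
    fun x hx _ => (abs_le.1 (hgC x hx)).1
  rw [h2] at h3 h4
  have h5 : C * D.layer n (fun _ => 1) ≤ C * M := by gcongr
  rw [abs_le]
  constructor <;> linarith

end DefiningFunction

/-! ### Recovering boundary values from layer integrals -/

theorem eventually_pos_of_hasDerivAt {f : ℝ → ℝ} {f' : ℝ} (h : HasDerivAt f f' 0) (h0 : f 0 = 0)
    (hf' : 0 < f') : ∀ᶠ s in 𝓝[>] (0 : ℝ), 0 < f s := by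
  have h1 := (hasDerivAt_iff_tendsto_slope_zero.1 h).mono_left
    (nhdsWithin_mono (0 : ℝ) fun s (hs : 0 < s) => (ne_of_gt hs : s ≠ 0))
  filter_upwards [h1.eventually (lt_mem_nhds hf'), self_mem_nhdsWithin] with s hs hs0
  simp only [zero_add, h0, sub_zero, smul_eq_mul] at hs
  exact pos_of_mul_pos_right hs (inv_nonneg.2 (le_of_lt hs0))

namespace DefiningFunction

variable {Ω : Set E3} (D : DefiningFunction Ω)

theorem hasDerivAt_line (x v : E3) :
    HasDerivAt (fun s : ℝ => D.d (x + s • v)) ⟪D.m x, v⟫ 0 := by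
  have := (D.hasFDerivAt_d x).hasLineDerivAt v
  simpa [HasLineDerivAt] using this

theorem eventually_pos {x v : E3} (hx : x ∈ frontier Ω) (hv : 0 < ⟪D.m x, v⟫) :
    ∀ᶠ s in 𝓝[>] (0 : ℝ), 0 < D.d (x + s • v) :=
  eventually_pos_of_hasDerivAt (D.hasDerivAt_line x v)
    (by simpa using D.eq_zero_of_mem_frontier hx) hv

theorem eventually_neg {x v : E3} (hx : x ∈ frontier Ω) (hv : ⟪D.m x, v⟫ < 0) :
    ∀ᶠ s in 𝓝[>] (0 : ℝ), D.d (x + s • v) < 0 := by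
  have := eventually_pos_of_hasDerivAt (D.hasDerivAt_line x v).neg
    (by simpa using D.eq_zero_of_mem_frontier hx) (by linarith)
  filter_upwards [this] with s hs using by simpa using hs

/-- If the layer integrals of `|g|` tend to zero then `Ω` has no perimeter where `g` does not vanish. -/
theorem integral_fderiv_eq_zero (hb : Bornology.IsBounded Ω) {g : E3 → ℝ}
    (hg : ContinuousOn g (closure Ω))
    (hlim : ∀ δ > 0, ∀ᶠ n in atTop, D.layer n (fun x => |g x|) ≤ δ)
    {B : Set E3} {c : ℝ} (hc : 0 < c) (hgB : ∀ x ∈ Ω, x ∈ B → c ≤ |g x|)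
    {ζ : E3 → ℝ} {ζ' : E3 → E3 →L[ℝ] ℝ} (hζ : ∀ x, HasFDerivAt ζ (ζ' x) x) (hζ' : Continuous ζ')
    (h0 : ∀ x, x ∉ B → ζ x = 0) (e : E3) : ∫ x in Ω, ζ' x e = 0 := by
  have hζc : Continuous ζ := continuous_iff_continuousAt.2 fun x => (hζ x).continuousAt
  -- The divergence theorem for `ζ e`. On the support of `ζ` the left side is controlled by the
  -- layer integral of `|g|`, which tends to zero. The right side tends to a nonzero multiple of the
  -- integral in question.
  have hstep : ∀ n, D.layer n (fun x => ⟪D.m x, ζ x • e⟫) =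
      -∫ x in Ω, layerStep n (D.d x) * ζ' x e := by
    intro n
    have := D.layer_inner_add hb n (Z := fun x => ζ x • e) (Z' := fun x => (ζ' x).smulRight e)
      (fun x _ => (hζ x).smul_const e) (by
        have h2 : Continuous fun p : (E3 →L[ℝ] ℝ) => p.smulRight e := by fun_prop
        exact (h2.comp hζ').continuousOn)
    simpa only [tr_smulRight] using this
  have hcont : Continuous fun x => ζ' x e := hζ'.clm_apply continuous_const
  have hint : IntegrableOn (fun x => ζ' x e) Ω :=
    (hcont.continuousOn.integrableOn_compact hb.isCompact_closure).mono_set subset_closure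
  have hlim1 : Tendsto (fun n => ∫ x in Ω, layerStep n (D.d x) * ζ' x e) atTop
      (𝓝 (∫ x in Ω, unitStep 2 * ζ' x e)) := by
    refine tendsto_integral_of_dominated_convergence (fun x => unitStep 2 * ‖ζ' x e‖) ?_ ?_ ?_ ?_
    · exact fun n => ((D.continuous_step n).mul hcont).aestronglyMeasurable
    · exact hint.norm.const_mul _
    · intro n
      refine ae_of_all _ fun x => ?_
      rw [norm_mul, Real.norm_of_nonneg (layerStep_nonneg _ _)]
      exact mul_le_mul_of_nonneg_right (layerStep_le _ _) (norm_nonneg _)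
    · filter_upwards [ae_restrict_mem D.isOpen.measurableSet] with x hx
      exact (tendsto_layerStep ((D.pos_iff x).1 hx)).mul_const _
  have hqc : Continuous fun x => ⟪D.m x, ζ x • e⟫ :=
    D.continuous_m.inner (hζc.smul continuous_const)
  obtain ⟨C, hC⟩ := hb.isCompact_closure.exists_bound_of_continuousOn hqc.continuousOn
  have hC0 : 0 ≤ |C| := abs_nonneg C
  have hle : ∀ x ∈ Ω, |⟪D.m x, ζ x • e⟫| ≤ |C| / c * |g x| := by
    intro x hx
    by_cases hxB : x ∈ B
    · calc |⟪D.m x, ζ x • e⟫| ≤ |C| := (hC x (subset_closure hx)).trans (le_abs_self _)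
        _ = |C| / c * c := by field_simp
        _ ≤ _ := by gcongr; exact hgB x hx hxB
    · rw [h0 x hxB]; simp; positivity
  have hgΩ : ContinuousOn (fun x => |g x|) Ω := (hg.mono subset_closure).abs
  have hlim2 : Tendsto (fun n => D.layer n (fun x => ⟪D.m x, ζ x • e⟫)) atTop (𝓝 0) := by
    rw [Metric.tendsto_atTop']
    intro ε hε
    -- The added `1` keeps the denominator positive when `C = 0`.
    have := hlim (ε / 2 / (|C| / c + 1)) (by positivity)
    obtain ⟨N, hN⟩ := eventually_atTop.1 this
    refine ⟨N, fun n hn => ?_⟩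
    have h1 := D.layer_mono hb n hqc.continuousOn (hgΩ.const_smul (|C| / c))
      fun x hx _ => (abs_le.1 (hle x hx)).2
    have h2 := D.layer_mono hb n (hgΩ.const_smul (-(|C| / c))) hqc.continuousOn
      fun x hx _ => by
        have := (abs_le.1 (hle x hx)).1
        simpa using this
    change D.layer n _ ≤ D.layer n (fun x => |C| / c * |g x|) at h1
    change D.layer n (fun x => -(|C| / c) * |g x|) ≤ D.layer n _ at h2
    rw [D.layer_const_mul] at h1 h2
    have h3 := hN n hn.le
    have hl0 : 0 ≤ D.layer n (fun x => |g x|) :=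
      setIntegral_nonneg D.isOpen.measurableSet fun x _ =>
        mul_nonneg (layerDensity_nonneg _ _) (abs_nonneg _)
    have h4 : |C| / c * D.layer n (fun x => |g x|) ≤ ε / 2 := by
      calc |C| / c * D.layer n (fun x => |g x|)
          ≤ (|C| / c + 1) * (ε / 2 / (|C| / c + 1)) := by gcongr; linarith
        _ = ε / 2 := by field_simp
    rw [Real.dist_eq, sub_zero, abs_lt]
    constructor <;> linarith
  simp only [hstep] at hlim2
  have h5 := tendsto_nhds_unique hlim2 hlim1.neg
  rw [integral_const_mul] at h5
  have := unitStep_two_pos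
  have h6 : unitStep 2 * ∫ x in Ω, ζ' x e = 0 := by linarith
  exact (mul_eq_zero.1 h6).resolve_left this.ne'

/-- A nonnegative function whose layer integrals tend to zero vanishes on the boundary. -/
theorem eq_zero_of_layer_le (hb : Bornology.IsBounded Ω) {g : E3 → ℝ}
    (hg : ContinuousOn g (closure Ω)) (hg0 : ∀ x ∈ frontier Ω, 0 ≤ g x)
    (hlim : ∀ δ > 0, ∀ᶠ n in atTop, D.layer n g ≤ δ) : ∀ x ∈ frontier Ω, g x = 0 := by
  intro x₀ hx₀
  by_contra hne
  have hpos : 0 < g x₀ := lt_of_le_of_ne (hg0 x₀ hx₀) (Ne.symm hne)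
  have hgΩ := hg.mono (subset_closure (s := Ω))
  -- Inside `Ω` the function `g` may be negative, but `|g| - g` vanishes on the boundary, so its
  -- layer integrals are eventually small.
  have hlim' : ∀ δ > 0, ∀ᶠ n in atTop, D.layer n (fun x => |g x|) ≤ δ := by
    intro δ hδ
    have h1 := D.eventually_layer_le hb (g := fun x => |g x| - g x) (hg.abs.sub hg)
      (fun x hx => by rw [abs_of_nonneg (hg0 x hx)]; simp) (half_pos hδ)
    filter_upwards [h1, hlim (δ / 2) (half_pos hδ)] with n h2 h3
    have := D.layer_add hb n (g := fun x => |g x| - g x) (hgΩ.abs.sub hgΩ) hgΩ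
    simp only [sub_add_cancel] at this
    linarith
  obtain ⟨ρ, hρ, hgρ⟩ : ∃ ρ > 0, ∀ y ∈ Ω, y ∈ Metric.ball x₀ ρ → g x₀ / 2 ≤ |g y| := by
    have h1 : ∀ᶠ y in 𝓝[closure Ω] x₀, g x₀ / 2 < g y :=
      continuousWithinAt_const.eventually_lt (hg x₀ (frontier_subset_closure hx₀)) (by linarith)
    obtain ⟨ρ, hρ, h2⟩ := Metric.mem_nhdsWithin_iff.1 h1
    exact ⟨ρ, hρ, fun y hy hyρ => (h2 ⟨hyρ, subset_closure hy⟩).le.trans (le_abs_self _)⟩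
  have hmm : 0 < ⟪D.m x₀, D.m x₀⟫ := real_inner_self_pos.2 (D.m_ne_zero hx₀)
  have hsmall : ∀ᶠ s in 𝓝[>] (0 : ℝ), ‖s • D.m x₀‖ < ρ / 2 := by
    apply nhdsWithin_le_nhds
    have : ContinuousAt (fun s : ℝ => ‖s • D.m x₀‖) 0 := by fun_prop
    exact this.eventually_lt continuousAt_const (by simpa using hρ)
  have hneg := D.eventually_neg (v := -D.m x₀) hx₀ (by rw [inner_neg_right]; linarith)
  obtain ⟨s, ⟨⟨hs1, hs2⟩, hs3⟩, hs0⟩ :=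
    (((D.eventually_pos hx₀ hmm).and hneg).and hsmall |>.and self_mem_nhdsWithin).exists
  have hs0' : 0 < s := hs0
  -- A bump centred at `y t` is moved across the boundary along `m x₀`, from outside to inside. If
  -- `g x₀ > 0`, there is no perimeter near `x₀`, so its integral over `Ω` would be constant in `t`;
  -- yet it is zero at `-s` and positive at `s`.
  let y : ℝ → E3 := fun s => x₀ + s • D.m x₀
  have hy1 : {z | 0 < D.d z} ∈ 𝓝 (y s) :=
    (isOpen_Ioi.preimage D.continuous_d).mem_nhds hs1
  have hy2 : {z | D.d z < 0} ∈ 𝓝 (y (-s)) :=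
    (isOpen_Iio.preimage D.continuous_d).mem_nhds (by simpa [y] using hs2)
  obtain ⟨η₁, hη₁, hb1⟩ := Metric.mem_nhds_iff.1 hy1
  obtain ⟨η₂, hη₂, hb2⟩ := Metric.mem_nhds_iff.1 hy2
  -- The bound `ρ / 2` keeps the moving support in the ball where `|g|` is bounded below; `η₁` and
  -- `η₂` keep the two extreme supports inside and outside `Ω`.
  let η := min (ρ / 2) (min η₁ η₂)
  have hη : 0 < η := lt_min (by linarith) (lt_min hη₁ hη₂)
  let β : ContDiffBump (0 : E3) := ⟨η / 2, η, by linarith, by linarith⟩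
  have hβz : ∀ v : E3, η ≤ ‖v‖ → β v = 0 := fun v hv =>
    β.zero_of_le_dist (by simpa [dist_eq_norm] using hv)
  have hβd : ∀ v, HasFDerivAt β (fderiv ℝ β v) v := fun v =>
    ((β.contDiff (n := 1)).differentiable (by simp) v).hasFDerivAt
  have hβc : Continuous (fderiv ℝ β) := (β.contDiff (n := 1)).continuous_fderiv (by simp)
  obtain ⟨C, hC⟩ : ∃ C, ∀ v, ‖fderiv ℝ β v‖ ≤ C :=
    (β.hasCompactSupport.fderiv (𝕜 := ℝ)).exists_bound_of_continuous hβc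
  have hyd : ∀ t : ℝ, ∀ x, HasDerivAt (fun t => β (x - y t)) (-(fderiv ℝ β (x - y t) (D.m x₀))) t := by
    intro t x
    have h1 : HasDerivAt (fun t => x - y t) (-(D.m x₀)) t := by
      have := ((hasDerivAt_id t).smul_const (D.m x₀)).const_add x₀ |>.const_sub x
      simpa [y] using this
    have := (hβd (x - y t)).comp_hasDerivAt t h1
    rw [map_neg] at this
    exact this
  let F : ℝ → ℝ := fun t => ∫ x in Ω, β (x - y t)
  have hint : ∀ t, IntegrableOn (fun x => β (x - y t)) Ω := fun t =>
    ((β.continuous.comp (by fun_prop : Continuous fun x => x - y t)).continuousOn.integrableOn_compact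
      hb.isCompact_closure).mono_set subset_closure
  have hFd : ∀ t, HasDerivAt F (∫ x in Ω, -(fderiv ℝ β (x - y t) (D.m x₀))) t := by
    intro t
    refine (hasDerivAt_integral_of_dominated_loc_of_deriv_le (μ := volume.restrict Ω)
      (F := fun t x => β (x - y t)) (F' := fun t x => -(fderiv ℝ β (x - y t) (D.m x₀)))
      (bound := fun _ => C * ‖D.m x₀‖) (s := univ) univ_mem
      (Eventually.of_forall fun t => (hint t).aestronglyMeasurable) (hint t) ?_ ?_ ?_ ?_).2
    · exact ((hβc.comp (by fun_prop : Continuous fun x => x - y t)).clm_apply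
        continuous_const).neg.aestronglyMeasurable
    · refine ae_of_all _ fun x t _ => ?_
      rw [norm_neg]
      exact ((fderiv ℝ β (x - y t)).le_opNorm _).trans (by gcongr; exact hC _)
    · exact integrableOn_const hb.measure_lt_top.ne
    · exact ae_of_all _ fun x t _ => hyd t x
  have hF0 : ∀ t, |t| ≤ s → ∫ x in Ω, -(fderiv ℝ β (x - y t) (D.m x₀)) = 0 := by
    intro t ht
    rw [integral_neg, neg_eq_zero]
    refine D.integral_fderiv_eq_zero hb hg hlim' (half_pos hpos) hgρ
      (ζ := fun x => β (x - y t)) (ζ' := fun x => fderiv ℝ β (x - y t)) (fun x => ?_) ?_ ?_ _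
    · have := (hβd (x - y t)).comp x ((hasFDerivAt_id x).sub_const (y t))
      simpa [Function.comp_def] using this
    · exact hβc.comp (by fun_prop)
    · intro x hx
      apply hβz
      have h1 : ‖t • D.m x₀‖ < ρ / 2 := by
        refine lt_of_le_of_lt ?_ hs3
        rw [norm_smul, norm_smul, Real.norm_eq_abs, Real.norm_of_nonneg hs0'.le]
        gcongr
      have h2 : ρ ≤ ‖x - x₀‖ := by simpa [dist_eq_norm] using hx
      have h3 : x - x₀ = (x - y t) + t • D.m x₀ := by simp only [y]; abel
      have h4 := norm_add_le (x - y t) (t • D.m x₀)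
      rw [← h3] at h4
      have : η ≤ ρ / 2 := min_le_left _ _
      linarith
  have hconst := constant_of_has_deriv_right_zero (f := F) (a := -s) (b := s)
    (fun t _ => (hFd t).continuousAt.continuousWithinAt)
    (fun t ht => by
      have := (hFd t).hasDerivWithinAt (s := Ici t)
      rwa [hF0 t (abs_le.2 ⟨ht.1, ht.2.le⟩)] at this) s ⟨by linarith, le_rfl⟩
  have hFneg : F (-s) = 0 := by
    refine setIntegral_eq_zero_of_forall_eq_zero fun x hx => hβz _ ?_
    by_contra! h
    have h1 : x ∈ Metric.ball (y (-s)) η₂ := by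
      rw [Metric.mem_ball, dist_eq_norm]
      exact h.trans_le ((min_le_right _ _).trans (min_le_right _ _))
    exact absurd ((D.pos_iff x).1 hx) (not_lt.2 (le_of_lt (hb2 h1)))
  have hFpos : 0 < F s := by
    have h1 : F s = ∫ x, β (x - y s) := by
      refine setIntegral_eq_integral_of_forall_compl_eq_zero fun x hx => hβz _ ?_
      by_contra! h
      have h1 : x ∈ Metric.ball (y s) η₁ := by
        rw [Metric.mem_ball, dist_eq_norm]
        exact h.trans_le ((min_le_right _ _).trans (min_le_left _ _))
      exact hx ((D.pos_iff x).2 (hb1 h1))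
    rw [h1, integral_sub_right_eq_self (fun x => β x)]
    exact β.integral_pos
  linarith

end DefiningFunction

/-! ### Gronwall's inequality in the limit -/

/-- A Gronwall inequality in which the differential inequality only holds in the limit, pointwise. -/
theorem eventually_le_of_eventually_deriv_le {T C M : ℝ} (hC : 0 ≤ C) {E e : ℕ → ℝ → ℝ}
    (hcont : ∀ n, ContinuousOn (E n) (Icc 0 T))
    (hder : ∀ n, ∀ t ∈ Ioo 0 T, HasDerivAt (E n) (e n t) t)
    (hbound : ∀ᶠ n in atTop, ∀ t ∈ Ioo 0 T, |e n t| ≤ M ∧ |E n t| ≤ M)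
    (hkey : ∀ t ∈ Ioo 0 T, ∀ δ > 0, ∀ᶠ n in atTop, e n t - C * E n t ≤ δ)
    (hinit : ∀ δ > 0, ∀ᶠ n in atTop, E n 0 ≤ δ) :
    ∀ t ∈ Icc 0 T, ∀ δ > 0, ∀ᶠ n in atTop, E n t ≤ δ := by
  -- The positive part of the derivative of `exp (-C s) E n s`. By `hkey` it tends to zero at each
  -- time, with no uniformity in time; the uniform bound and dominated convergence make its integral
  -- tend to zero.
  let g : ℕ → ℝ → ℝ := fun n s => max 0 (Real.exp (-C * s) * (e n s - C * E n s))
  have hgm : ∀ n, AEStronglyMeasurable (g n) (volume.restrict (Ioo 0 T)) := by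
    intro n
    -- No measurability of `e n` is assumed; it agrees on `(0, T)` with `deriv (E n)`, which is
    -- always measurable.
    have h1 : AEStronglyMeasurable (fun s => max 0 (Real.exp (-C * s) * (deriv (E n) s - C * E n s)))
        (volume.restrict (Ioo 0 T)) := by
      have hE : AEStronglyMeasurable (E n) (volume.restrict (Ioo 0 T)) :=
        ((hcont n).mono Ioo_subset_Icc_self).aestronglyMeasurable measurableSet_Ioo
      have hexp : AEStronglyMeasurable (fun s : ℝ => Real.exp (-C * s)) (volume.restrict (Ioo 0 T)) :=
        (by fun_prop : Continuous fun s : ℝ => Real.exp (-C * s)).aestronglyMeasurable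
      exact aestronglyMeasurable_const.sup
        (hexp.mul ((measurable_deriv (E n)).aestronglyMeasurable.sub (hE.const_mul C)))
    refine h1.congr ?_
    filter_upwards [ae_restrict_mem measurableSet_Ioo] with s hs
    rw [(hder n s hs).deriv]
  have hexp1 : ∀ s ∈ Ioo 0 T, Real.exp (-C * s) ≤ 1 := fun s hs =>
    Real.exp_le_one_iff.2 (by nlinarith [hs.1])
  have hg0 : ∀ n s, 0 ≤ g n s := fun n s => le_max_left _ _
  have hgb : ∀ᶠ n in atTop, ∀ s ∈ Ioo 0 T, g n s ≤ M + C * M := by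
    filter_upwards [hbound] with n hn s hs
    obtain ⟨h1, h2⟩ := hn s hs
    have hM : 0 ≤ M := (abs_nonneg _).trans h1
    have h3 : |e n s - C * E n s| ≤ M + C * M := by
      refine (abs_sub _ _).trans (add_le_add h1 ?_)
      rw [abs_mul, abs_of_nonneg hC]
      gcongr
    refine max_le (by positivity) ?_
    calc Real.exp (-C * s) * (e n s - C * E n s) ≤ Real.exp (-C * s) * |e n s - C * E n s| := by
          gcongr; exact le_abs_self _
      _ ≤ 1 * (M + C * M) := by
          gcongr
          exact hexp1 s hs
      _ = _ := one_mul _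
  have hgi : ∀ᶠ n in atTop, IntegrableOn (g n) (Ioo 0 T) := by
    filter_upwards [hgb] with n hn
    refine Integrable.of_bound (hgm n) (M + C * M) ?_
    filter_upwards [ae_restrict_mem measurableSet_Ioo] with s hs
    rw [Real.norm_of_nonneg (hg0 n s)]
    exact hn s hs
  have hlim : Tendsto (fun n => ∫ s in Ioo 0 T, g n s) atTop (𝓝 0) := by
    have := tendsto_integral_filter_of_dominated_convergence (μ := volume.restrict (Ioo 0 T))
      (F := g) (f := fun _ => (0 : ℝ)) (l := atTop) (fun _ => M + C * M)
      (Eventually.of_forall hgm)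
      (by
        filter_upwards [hgb] with n hn
        filter_upwards [ae_restrict_mem measurableSet_Ioo] with s hs
        rw [Real.norm_of_nonneg (hg0 n s)]
        exact hn s hs)
      (integrableOn_const (by simp)) (by
        filter_upwards [ae_restrict_mem measurableSet_Ioo] with s hs
        rw [Metric.tendsto_atTop']
        intro ε hε
        obtain ⟨N, hN⟩ := eventually_atTop.1 (hkey s hs (ε / 2) (half_pos hε))
        refine ⟨N, fun n hn => ?_⟩
        rw [Real.dist_eq, sub_zero, abs_of_nonneg (hg0 n s)]
        refine max_lt hε ?_
        calc Real.exp (-C * s) * (e n s - C * E n s) ≤ Real.exp (-C * s) * (ε / 2) := by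
              gcongr; exact hN n hn.le
          _ ≤ 1 * (ε / 2) := by gcongr; exact hexp1 s hs
          _ < ε := by linarith)
    simpa using this
  intro t ht δ hδ
  have hpos : 0 < Real.exp (C * t) := Real.exp_pos _
  filter_upwards [hgi, hinit (δ / Real.exp (C * t) / 2) (by positivity),
    hlim.eventually (gt_mem_nhds (by positivity : 0 < δ / Real.exp (C * t) / 2))] with n h1 h2 h3
  have hsub : Ioo 0 t ⊆ Ioo 0 T := Ioo_subset_Ioo_right ht.2
  have h4 := intervalIntegral.sub_le_integral_of_hasDeriv_right_of_le (a := 0) (b := t) ht.1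
    (g := fun s => Real.exp (-C * s) * E n s)
    (g' := fun s => Real.exp (-C * s) * (e n s - C * E n s)) (φ := g n)
    ((by fun_prop : Continuous fun s : ℝ => Real.exp (-C * s)).continuousOn.mul
      ((hcont n).mono (Icc_subset_Icc_right ht.2)))
    (fun s hs => by
      have h5 : HasDerivAt (fun s : ℝ => Real.exp (-C * s)) (Real.exp (-C * s) * (-C)) s := by
        simpa using ((hasDerivAt_id s).const_mul (-C)).exp
      have := (h5.mul (hder n s (hsub hs))).hasDerivWithinAt (s := Ioi s)
      convert! this using 1
      ring)
    ((integrableOn_Icc_iff_integrableOn_Ioo (by simp) (by simp)).2 (h1.mono_set hsub))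
    (fun s _ => le_max_right _ _)
  have h6 : ∫ s in (0 : ℝ)..t, g n s ≤ ∫ s in Ioo 0 T, g n s := by
    rw [intervalIntegral.integral_of_le ht.1, integral_Ioc_eq_integral_Ioo]
    exact setIntegral_mono_set h1 (ae_of_all _ fun s => hg0 n s)
      (LE.le.eventuallyLE hsub)
  simp only [mul_zero, Real.exp_zero, one_mul] at h4
  have h7 : Real.exp (-C * t) * E n t ≤ δ / Real.exp (C * t) := by linarith
  have h8 : Real.exp (-C * t) = (Real.exp (C * t))⁻¹ := by rw [← Real.exp_neg]; ring_nf
  rw [h8, div_eq_inv_mul] at h7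
  exact le_of_mul_le_mul_left h7 (inv_pos.2 hpos)

/-! ### Construction of a defining function -/

theorem eq_sum_single (v : E3) : v = ∑ i : Fin 3, v i • (EuclideanSpace.single i 1 : E3) := by
  ext j; fin_cases j <;> simp [Fin.sum_univ_three]

/-- A bump serves at interior points, and minus a bump times the local boundary function at boundary
points. The signs inside and outside `Ω` hold globally, so such functions can be added without
cancellation. -/
theorem exists_local_defining {a : ℝ≥0} {Ω : Set E3} (hΩo : IsOpen Ω)
    (hΩ : HasHolderBoundary 2 a Ω) {x : E3} (hx : x ∈ closure Ω) :
    ∃ g : E3 → ℝ, ∃ r > 0, ContDiff ℝ 2 g ∧ (∀ y ∈ Ω, 0 ≤ g y) ∧ (∀ y, y ∉ Ω → g y ≤ 0) ∧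
      (∀ y ∈ Metric.ball x r, y ∈ Ω → 0 < g y) ∧
      ∀ y ∈ Metric.ball x r, y ∈ frontier Ω → fderiv ℝ g y ≠ 0 := by
  by_cases hxΩ : x ∈ Ω
  · obtain ⟨r, hr, hball⟩ := Metric.isOpen_iff.1 hΩo x hxΩ
    let b : ContDiffBump x := ⟨r / 2, r, by linarith, by linarith⟩
    refine ⟨b, r, hr, b.contDiff, fun y _ => b.nonneg, fun y hy => ?_,
      fun y hy _ => b.pos_of_mem_ball hy, fun y hy hyf => ?_⟩
    · refine (b.zero_of_le_dist ?_).le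
      by_contra! h
      exact hy (hball h)
    · rw [hΩo.frontier_eq] at hyf
      exact absurd (hball hy) hyf.2
  · have hxf : x ∈ frontier Ω := by rw [hΩo.frontier_eq]; exact ⟨hx, hxΩ⟩
    obtain ⟨V, ρ, hVo, hxV, hρ, hρ', hV⟩ := hΩ x hxf
    obtain ⟨r, hr, hball⟩ := Metric.nhds_basis_closedBall.mem_iff.1 (hVo.mem_nhds hxV)
    let b : ContDiffBump x := ⟨r / 2, r, by linarith, by linarith⟩
    have hbV : ∀ y, y ∉ V → b y = 0 := fun y hy => b.zero_of_le_dist (by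
      by_contra! h
      exact hy (hball (le_of_lt h)))
    have hneg : ∀ y ∈ Ω, y ∈ V → ρ y < 0 := fun y hy hyV => by
      have : y ∈ Ω ∩ V := ⟨hy, hyV⟩
      rw [hV] at this
      exact this.2
    have hpos : ∀ y, y ∉ Ω → y ∈ V → 0 ≤ ρ y := fun y hy hyV => by
      by_contra! h
      have : y ∈ {y ∈ V | ρ y < 0} := ⟨hyV, h⟩
      rw [← hV] at this
      exact hy this.1
    refine ⟨fun y => -(b y * ρ y), r / 2, by linarith, ?_, ?_, ?_, ?_, ?_⟩
    · rw [contDiff_iff_contDiffAt]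
      intro y
      by_cases hy : y ∈ V
      · exact (b.contDiffAt.mul ((hρ.1 y hy).contDiffAt (hVo.mem_nhds hy))).neg
      · have h1 : (fun y => -(b y * ρ y)) =ᶠ[𝓝 y] fun _ => 0 := by
          have : y ∉ tsupport b := fun h => hy (hball (by rwa [b.tsupport_eq] at h))
          filter_upwards [(isClosed_tsupport b).isOpen_compl.mem_nhds this] with z hz
          simp [image_eq_zero_of_notMem_tsupport hz]
        exact contDiffAt_const.congr_of_eventuallyEq h1
    · intro y hy
      by_cases hyV : y ∈ V
      · nlinarith [hneg y hy hyV, b.nonneg' y]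
      · simp [hbV y hyV]
    · intro y hy
      by_cases hyV : y ∈ V
      · nlinarith [hpos y hy hyV, b.nonneg' y]
      · simp [hbV y hyV]
    · intro y hy hyΩ
      have h1 : y ∈ Metric.ball x r := Metric.ball_subset_ball (by linarith) hy
      have h2 : 0 < b y := b.pos_of_mem_ball h1
      have h3 := hneg y hyΩ (hball (Metric.ball_subset_closedBall h1))
      nlinarith
    · intro y hy hyf
      have h1 : (fun y => -(b y * ρ y)) =ᶠ[𝓝 y] fun y => -ρ y := by
        filter_upwards [b.eventuallyEq_one_of_mem_ball hy] with z hz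
        simp [hz]
      rw [h1.fderiv_eq, fderiv_fun_neg, neg_ne_zero]
      exact hρ' y (hball (Metric.ball_subset_closedBall
        (Metric.ball_subset_ball (by linarith) hy)))

theorem fderiv_nonneg_of_eventually {g : E3 → ℝ} {y v : E3} (hg : DifferentiableAt ℝ g y)
    (h0 : g y = 0) (h : ∀ᶠ s in 𝓝[>] (0 : ℝ), 0 ≤ g (y + s • v)) : 0 ≤ fderiv ℝ g y v := by
  have h1 := hg.hasFDerivAt.hasLineDerivAt v
  have h2 : Tendsto _ (𝓝[>] (0 : ℝ)) _ := (hasDerivAt_iff_tendsto_slope_zero.1 h1).mono_left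
    (nhdsWithin_mono (0 : ℝ) fun s (hs : 0 < s) => (ne_of_gt hs : s ≠ 0))
  refine ge_of_tendsto h2 ?_
  filter_upwards [h, self_mem_nhdsWithin] with s hs hs0
  have : (0 : ℝ) ≤ s⁻¹ := inv_nonneg.2 (le_of_lt hs0)
  simpa [h0] using mul_nonneg this hs

/-- Finitely many local functions are summed. Their gradients cannot cancel at a boundary point: if
one of them increases in the direction `v`, then `v` points into `Ω`, where all the others are
nonnegative, so their derivatives along `v` are nonnegative. -/
theorem exists_defining {a : ℝ≥0} {Ω : Set E3} (hΩo : IsOpen Ω) (hb : Bornology.IsBounded Ω)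
    (hΩ : HasHolderBoundary 2 a Ω) :
    ∃ d : E3 → ℝ, ContDiff ℝ 2 d ∧ (∀ x, x ∈ Ω ↔ 0 < d x) ∧ ∀ x ∈ frontier Ω, fderiv ℝ d x ≠ 0 := by
  choose! g r hr hgc hg1 hg2 hg3 hg4 using fun x (hx : x ∈ closure Ω) =>
    exists_local_defining hΩo hΩ hx
  obtain ⟨t, ht, hcov⟩ := hb.isCompact_closure.elim_nhds_subcover (fun x => Metric.ball x (r x))
    fun x hx => Metric.ball_mem_nhds x (hr x hx)
  have hcov' : ∀ y ∈ closure Ω, ∃ x ∈ t, y ∈ Metric.ball x (r x) := fun y hy => by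
    simpa using hcov hy
  refine ⟨fun y => ∑ x ∈ t, g x y, ContDiff.sum fun x hx => hgc x (ht x hx), fun y => ⟨?_, ?_⟩, ?_⟩
  · intro hy
    obtain ⟨x, hx, hyx⟩ := hcov' y (subset_closure hy)
    exact Finset.sum_pos' (fun z hz => hg1 z (ht z hz) y hy) ⟨x, hx, hg3 x (ht x hx) y hyx hy⟩
  · intro hy
    by_contra h
    exact absurd hy (not_lt.2 (Finset.sum_nonpos fun z hz => hg2 z (ht z hz) y h))
  · intro y hy
    have hyc := frontier_subset_closure hy
    have hyΩ : y ∉ Ω := by rw [hΩo.frontier_eq] at hy; exact hy.2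
    have hz : ∀ x ∈ t, g x y = 0 := by
      intro x hx
      refine le_antisymm (hg2 x (ht x hx) y hyΩ) ?_
      have : IsClosed {y | 0 ≤ g x y} := isClosed_Ici.preimage (hgc x (ht x hx)).continuous
      exact closure_minimal (fun y hy => hg1 x (ht x hx) y hy) this hyc
    have hdiff : ∀ x ∈ t, DifferentiableAt ℝ (g x) y := fun x hx =>
      (hgc x (ht x hx)).differentiable (by simp) y
    obtain ⟨x₁, hx₁, hyx₁⟩ := hcov' y hyc
    have hne := hg4 x₁ (ht x₁ hx₁) y hyx₁ hy
    obtain ⟨v, hv⟩ : ∃ v, 0 < fderiv ℝ (g x₁) y v := by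
      by_contra! h
      refine hne (ContinuousLinearMap.ext fun v => le_antisymm (h v) ?_)
      have := h (-v)
      rw [map_neg] at this
      simpa using this
    have hev : ∀ᶠ s in 𝓝[>] (0 : ℝ), y + s • v ∈ Ω := by
      have h1 := (hdiff x₁ hx₁).hasFDerivAt.hasLineDerivAt v
      filter_upwards [eventually_pos_of_hasDerivAt h1 (by simpa using hz x₁ hx₁) hv] with s hs
      by_contra h
      exact absurd hs (not_lt.2 (hg2 x₁ (ht x₁ hx₁) _ h))
    have hsum : 0 < fderiv ℝ (fun y => ∑ x ∈ t, g x y) y v := by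
      rw [fderiv_fun_sum hdiff, sum_apply]
      refine Finset.sum_pos' (fun x hx => ?_) ⟨x₁, hx₁, hv⟩
      exact fderiv_nonneg_of_eventually (hdiff x hx) (hz x hx)
        (hev.mono fun s hs => hg1 x (ht x hx) _ hs)
    intro h
    rw [h] at hsum
    simp at hsum

/-- The function `1 / |m|²` is singular at zeros of `m`. The transition factor is zero where `|m|² ≤
c / 4` and one where `|m|² ≥ c / 2`, with `c` a lower bound of `|m|²` on `G`. -/
theorem exists_inverse_square {m : E3 → E3} (hm : ContDiff ℝ 1 m) {G : Set E3} (hG : IsCompact G)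
    (hne : ∀ x ∈ G, m x ≠ 0) :
    ∃ κ : E3 → ℝ, ContDiff ℝ 1 κ ∧ ∀ x ∈ G, ∀ᶠ y in 𝓝 x, κ y * ‖m y‖ ^ 2 = 1 := by
  have hs : ContDiff ℝ 1 fun x => ‖m x‖ ^ 2 := hm.norm_sq ℝ
  obtain ⟨c, hc, hle⟩ : ∃ c > 0, ∀ x ∈ G, c ≤ ‖m x‖ ^ 2 := by
    rcases G.eq_empty_or_nonempty with he | hn
    · exact ⟨1, one_pos, fun x hx => by simp [he] at hx⟩
    · obtain ⟨x0, hx0, hmin⟩ := hG.exists_isMinOn hn hs.continuous.continuousOn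
      refine ⟨‖m x0‖ ^ 2, ?_, fun x hx => hmin hx⟩
      have := norm_pos_iff.2 (hne x0 hx0)
      positivity
  refine ⟨fun x => Real.smoothTransition ((‖m x‖ ^ 2 - c / 4) / (c / 4)) / ‖m x‖ ^ 2, ?_, ?_⟩
  · rw [contDiff_iff_contDiffAt]
    intro x
    by_cases hx : 0 < ‖m x‖ ^ 2
    · exact (Real.smoothTransition.contDiffAt.comp x
        ((hs.sub contDiff_const).div_const _).contDiffAt).div hs.contDiffAt hx.ne'
    · have h1 : ∀ᶠ y in 𝓝 x, ‖m y‖ ^ 2 < c / 4 :=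
        hs.continuous.continuousAt.eventually_lt continuousAt_const (by linarith)
      refine (contDiffAt_const (c := (0 : ℝ))).congr_of_eventuallyEq ?_
      filter_upwards [h1] with y hy
      rw [Real.smoothTransition.zero_of_nonpos, zero_div]
      exact div_nonpos_of_nonpos_of_nonneg (by linarith) (by linarith)
  · intro x hx
    have h1 : ∀ᶠ y in 𝓝 x, c / 2 < ‖m y‖ ^ 2 :=
      continuousAt_const.eventually_lt hs.continuous.continuousAt (by linarith [hle x hx])
    filter_upwards [h1] with y hy
    rw [Real.smoothTransition.one_of_one_le, one_div, inv_mul_cancel₀ (by linarith)]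
    rw [le_div_iff₀ (by linarith)]; linarith

theorem nonempty_definingFunction {a : ℝ≥0} {Ω : Set E3} (hΩo : IsOpen Ω)
    (hb : Bornology.IsBounded Ω) (hΩ : HasHolderBoundary 2 a Ω) : Nonempty (DefiningFunction Ω) := by
  obtain ⟨d, hd, hpos, hne⟩ := exists_defining hΩo hb hΩ
  let m : E3 → E3 := fun x =>
    ∑ i : Fin 3, fderiv ℝ d x (EuclideanSpace.single i 1) • (EuclideanSpace.single i 1 : E3)
  have hd1 : ContDiff ℝ 1 (fderiv ℝ d) := hd.fderiv_right (by norm_num)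
  have hm : ContDiff ℝ 1 m :=
    ContDiff.sum fun i _ => (hd1.clm_apply contDiff_const).smul contDiff_const
  have hin : ∀ (A : E3 →L[ℝ] ℝ) (v : E3),
      ⟪∑ i : Fin 3, A (EuclideanSpace.single i 1) • (EuclideanSpace.single i 1 : E3), v⟫ = A v := by
    intro A v
    conv_rhs => rw [eq_sum_single v]
    simp [sum_inner, real_inner_smul_left, mul_comm, EuclideanSpace.inner_single_left]
  have hmd : ∀ x, innerSL ℝ (m x) = fderiv ℝ d x := fun x => by
    ext v; exact hin (fderiv ℝ d x) v
  have hm' : ∀ x a b, ⟪fderiv ℝ m x a, b⟫ = fderiv ℝ (fderiv ℝ d) x a b := by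
    intro x a b
    have h1 : fderiv ℝ m x a = ∑ i : Fin 3, fderiv ℝ (fderiv ℝ d) x a (EuclideanSpace.single i 1) •
        (EuclideanSpace.single i 1 : E3) := by
      have : HasFDerivAt m (∑ i : Fin 3,
          (((fderiv ℝ (fderiv ℝ d) x).flip (EuclideanSpace.single i 1)).smulRight
            (EuclideanSpace.single i 1 : E3))) x := by
        refine HasFDerivAt.fun_sum fun i _ => HasFDerivAt.smul_const ?_ _
        have h2 := ((hd1.differentiable (by simp) x).hasFDerivAt).clm_apply
          (hasFDerivAt_const (EuclideanSpace.single i 1 : E3) x)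
        simpa using h2
      rw [this.fderiv]
      simp
    rw [h1, hin]
  obtain ⟨κ, hκ, hκ1⟩ := exists_inverse_square hm
    (hb.isCompact_closure.of_isClosed_subset isClosed_frontier frontier_subset_closure)
    (fun x hx h => hne x hx (by rw [← hmd, h, map_zero]))
  exact ⟨{
    d := d
    m := m
    m' := fderiv ℝ m
    κ := κ
    κ' := fderiv ℝ κ
    hasFDerivAt_d := fun x => by
      rw [hmd]; exact (hd.differentiable (by simp) x).hasFDerivAt
    hasFDerivAt_m := fun x => (hm.differentiable (by simp) x).hasFDerivAt
    continuous_m' := hm.continuous_fderiv (by simp)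
    symm := fun x a b => by
      rw [hm', real_inner_comm, hm']
      exact (hd.contDiffAt.isSymmSndFDerivAt (by simp)) a b
    hasFDerivAt_κ := fun x => (hκ.differentiable (by simp) x).hasFDerivAt
    continuous_κ' := hκ.continuous_fderiv (by simp)
    pos_iff := hpos
    κ_eq := hκ1 }⟩

/-! ### Tangent vectors, the normal and the surface operators -/

theorem cross_eq (a b : E3) :
    cross a b = !₂[a 1 * b 2 - a 2 * b 1, a 2 * b 0 - a 0 * b 2, a 0 * b 1 - a 1 * b 0] := by
  simp [cross, cross_apply]

/-- The cross product as a continuous bilinear map. -/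
noncomputable def crossL : E3 →L[ℝ] E3 →L[ℝ] E3 :=
  LinearMap.toContinuousLinearMap (LinearMap.toContinuousLinearMap.toLinearMap ∘ₗ
    LinearMap.mk₂ ℝ cross
      (fun a b c => by ext i; fin_cases i <;> simp [cross_eq] <;> ring)
      (fun a b c => by ext i; fin_cases i <;> simp [cross_eq] <;> ring)
      (fun a b c => by ext i; fin_cases i <;> simp [cross_eq] <;> ring)
      (fun a b c => by ext i; fin_cases i <;> simp [cross_eq] <;> ring))

theorem crossL_apply (a b : E3) : crossL a b = cross a b := rfl

/-- The curl of a field with derivative `A`. -/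
noncomputable def curlOf (A : E3 →L[ℝ] E3) : E3 :=
  !₂[A (EuclideanSpace.single 1 1) 2 - A (EuclideanSpace.single 2 1) 1,
     A (EuclideanSpace.single 2 1) 0 - A (EuclideanSpace.single 0 1) 2,
     A (EuclideanSpace.single 0 1) 1 - A (EuclideanSpace.single 1 1) 0]

theorem curl_eq (Ω : Set E3) (v : E3 → E3) (x : E3) :
    curl Ω v x = curlOf (fderivWithin ℝ v (closure Ω) x) := rfl

theorem div_eq (Ω : Set E3) (v : E3 → E3) (x : E3) :
    div Ω v x = tr (fderivWithin ℝ v (closure Ω) x) := rfl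

theorem inner_gradientWithin (g : E3 → ℝ) (s : Set E3) (x τ : E3) :
    ⟪gradientWithin g s x, τ⟫ = fderivWithin ℝ g s x τ := by
  simp [gradientWithin]

namespace DefiningFunction

variable {Ω : Set E3} (D : DefiningFunction Ω)

theorem mem_tangentConeAt_of_pos {x v : E3} (hx : x ∈ frontier Ω) (hv : 0 < ⟪D.m x, v⟫) :
    v ∈ tangentConeAt ℝ (closure Ω) x := by
  refine mem_tangentConeAt_of_add_smul_mem (l := 𝓝[>] (0 : ℝ)) (c := fun s => s)
    (tendsto_id.mono_left (nhdsWithin_mono (0 : ℝ) fun s (hs : 0 < s) => (ne_of_gt hs : s ≠ 0))) ?_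
  filter_upwards [D.eventually_pos hx hv] with s hs
  exact subset_closure ((D.pos_iff _).2 hs)

/-- At a boundary point the tangent cone contains the open half space `⟪m, v⟫ > 0`, which spans.
Derivatives within the closure are therefore unique up to the boundary. -/
theorem uniqueDiffOn_closure (D : DefiningFunction Ω) : UniqueDiffOn ℝ (closure Ω) := by
  intro x hx
  by_cases hxΩ : x ∈ Ω
  · exact uniqueDiffWithinAt_of_mem_nhds (mem_of_superset (D.isOpen.mem_nhds hxΩ) subset_closure)
  have hxf : x ∈ frontier Ω := by rw [D.isOpen.frontier_eq]; exact ⟨hx, hxΩ⟩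
  refine ⟨?_, subset_closure hx⟩
  have htop : Submodule.span ℝ (tangentConeAt ℝ (closure Ω) x) = ⊤ := by
    rw [eq_top_iff]
    intro w _
    have hmm : 0 < ⟪D.m x, D.m x⟫ := real_inner_self_pos.2 (D.m_ne_zero hxf)
    obtain ⟨c, hc0, hc⟩ : ∃ c : ℝ, 0 < c ∧ 0 < ⟪D.m x, w + c • D.m x⟫ := by
      refine ⟨(|⟪D.m x, w⟫| + 1) / ⟪D.m x, D.m x⟫, by positivity, ?_⟩
      rw [inner_add_right, inner_smul_right, div_mul_cancel₀ _ hmm.ne']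
      linarith [neg_abs_le ⟪D.m x, w⟫]
    have h1 := Submodule.subset_span (R := ℝ) (D.mem_tangentConeAt_of_pos hxf hc)
    have h2 := Submodule.subset_span (R := ℝ) (D.mem_tangentConeAt_of_pos hxf
      (v := c • D.m x) (by rw [inner_smul_right]; positivity))
    simpa using Submodule.sub_mem _ h1 h2
  rw [htop]
  exact dense_univ

/-- The function `d` may also vanish away from the boundary, but only at critical points: where `m ≠
0`, moving along `m` from a zero of `d` enters `Ω`. -/
theorem mem_frontier_of_eq_zero {x : E3} (hd : D.d x = 0) (hm : D.m x ≠ 0) : x ∈ frontier Ω := by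
  rw [D.isOpen.frontier_eq]
  refine ⟨?_, fun h => by have := (D.pos_iff x).1 h; linarith⟩
  have h1 := eventually_pos_of_hasDerivAt (D.hasDerivAt_line x (D.m x)) (by simpa using hd)
    (real_inner_self_pos.2 hm)
  have h2 : Tendsto (fun s : ℝ => x + s • D.m x) (𝓝[>] (0 : ℝ)) (𝓝 x) := by
    have : ContinuousAt (fun s : ℝ => x + s • D.m x) 0 := by fun_prop
    have h3 := this.tendsto
    simp only [zero_smul, add_zero] at h3
    exact h3.mono_left nhdsWithin_le_nhds
  exact mem_closure_of_tendsto h2 (h1.mono fun s hs => (D.pos_iff _).2 hs)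

/-- Vectors orthogonal to the gradient of the defining function are tangent to the boundary. -/
theorem mem_tangentConeAt_frontier {x τ : E3} (hx : x ∈ frontier Ω) (hτ : ⟪D.m x, τ⟫ = 0) :
    τ ∈ tangentConeAt ℝ (frontier Ω) x := by
  have hmc : ContDiff ℝ 1 D.d := by
    rw [contDiff_one_iff_fderiv]
    refine ⟨fun x => (D.hasFDerivAt_d x).differentiableAt, ?_⟩
    have : fderiv ℝ D.d = fun x => innerSL ℝ (D.m x) := by
      ext1 x; exact (D.hasFDerivAt_d x).fderiv
    rw [this]
    exact (innerSL ℝ).continuous.comp D.continuous_m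
  have hstrict : HasStrictFDerivAt D.d (innerSL ℝ (D.m x)) x :=
    hmc.contDiffAt.hasStrictFDerivAt' (D.hasFDerivAt_d x) (by simp)
  have hmm : ⟪D.m x, D.m x⟫ ≠ 0 := (real_inner_self_pos.2 (D.m_ne_zero hx)).ne'
  have hrange : (innerSL ℝ (D.m x)).range = ⊤ := by
    refine LinearMap.range_eq_top.2 fun c => ⟨(c / ⟪D.m x, D.m x⟫) • D.m x, ?_⟩
    change ⟪D.m x, (c / ⟪D.m x, D.m x⟫) • D.m x⟫ = c
    rw [inner_smul_right, div_mul_cancel₀ _ hmm]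
  let τ' : (innerSL ℝ (D.m x)).ker := ⟨τ, hτ⟩
  -- The implicit function parametrises the level set of `d` over the kernel of its derivative. The
  -- curve `s ↦ φ (s τ')` has velocity `τ` at `0` and stays in the boundary for small `s`.
  let φ := hstrict.implicitFunction D.d (innerSL ℝ (D.m x)) hrange (D.d x)
  have hφ0 : φ 0 = x := hstrict.implicitFunction_apply_image hrange
  have hφ : HasStrictFDerivAt φ (innerSL ℝ (D.m x)).ker.subtypeL 0 :=
    hstrict.to_implicitFunction hrange
  have hlin : HasDerivAt (fun s : ℝ => s • τ') τ' 0 := by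
    have h1 := (hasDerivAt_id (0 : ℝ)).smul_const τ'
    have h2 : (1 : ℝ) • τ' = τ' := one_smul ℝ τ'
    rw [h2] at h1
    exact h1
  have hγ : HasDerivAt (fun s : ℝ => φ (s • τ')) τ 0 := by
    have h0 : HasFDerivAt φ (innerSL ℝ (D.m x)).ker.subtypeL ((0 : ℝ) • τ') := by
      rw [zero_smul]; exact hφ.hasFDerivAt
    exact h0.comp_hasDerivAt (0 : ℝ) hlin
  have hmem : ∀ᶠ s : ℝ in 𝓝 0, φ (s • τ') ∈ frontier Ω := by
    have h1 : Tendsto (fun s : ℝ => (D.d x, s • τ')) (𝓝 0) (𝓝 (D.d x, 0)) := by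
      have := hlin.continuousAt.tendsto
      rw [zero_smul] at this
      exact tendsto_const_nhds.prodMk_nhds this
    have h2 := h1.eventually (hstrict.map_implicitFunction_eq hrange)
    have h3 : Tendsto (fun s : ℝ => φ (s • τ')) (𝓝 0) (𝓝 x) := by
      have := hγ.continuousAt.tendsto
      rwa [zero_smul, hφ0] at this
    have h4 := h3.eventually (D.continuous_m.continuousAt.eventually_ne (D.m_ne_zero hx))
    filter_upwards [h2, h4] with s hs1 hs2
    exact D.mem_frontier_of_eq_zero (hs1.trans (D.eq_zero_of_mem_frontier hx)) hs2
  have hmaps := (hγ.hasFDerivAt.hasFDerivWithinAt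
    (s := {s : ℝ | φ (s • τ') ∈ frontier Ω})).mapsTo_tangent_cone
  rw [tangentConeAt_of_mem_nhds hmem] at hmaps
  have h5 := hmaps (mem_univ (1 : ℝ))
  simp only [zero_smul, hφ0] at h5
  refine tangentConeAt_mono ?_ (by simpa using h5)
  rintro _ ⟨s, hs, rfl⟩
  exact hs

/-- A derivative within the surface is arbitrary in the normal direction. On tangent vectors it is
determined, so it may be computed from any extension off the surface. -/
theorem apply_eq_of_hasFDerivWithinAt {F : Type*} [NormedAddCommGroup F] [NormedSpace ℝ F]
    {x τ : E3} (hx : x ∈ frontier Ω) (hτ : ⟪D.m x, τ⟫ = 0) {g : E3 → F} {A B : E3 →L[ℝ] F}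
    (hA : HasFDerivWithinAt g A (frontier Ω) x) (hB : HasFDerivWithinAt g B (frontier Ω) x) :
    A τ = B τ := hA.unique_on hB (D.mem_tangentConeAt_frontier hx hτ)

theorem norm_m_pos {x : E3} (hx : x ∈ frontier Ω) : 0 < ‖D.m x‖ := norm_pos_iff.2 (D.m_ne_zero hx)

theorem isOutwardNormal {x : E3} (hx : x ∈ frontier Ω) :
    IsOutwardNormal Ω x (-(‖D.m x‖⁻¹ • D.m x)) := by
  have hm := D.norm_m_pos hx
  refine ⟨by rw [norm_neg, norm_smul, norm_inv, norm_norm, inv_mul_cancel₀ hm.ne'], ?_⟩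
  intro ε hε
  have h1 := (hasFDerivAt_iff_isLittleO_nhds_zero.1 (D.hasFDerivAt_d x)).def
    (mul_pos hε hm)
  obtain ⟨δ, hδ, hball⟩ := Metric.eventually_nhds_iff.1 h1
  refine ⟨δ, hδ, fun y hy => ?_⟩
  have h2 := hball (y := y - x) (by simpa using hy)
  rw [add_sub_cancel, D.eq_zero_of_mem_frontier hx, sub_zero, Real.norm_eq_abs, abs_le,
    innerSL_apply_apply] at h2
  have h3 : ⟪y - x, -(‖D.m x‖⁻¹ • D.m x)⟫ = -(⟪D.m x, y - x⟫ / ‖D.m x‖) := by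
    rw [inner_neg_right, inner_smul_right, real_inner_comm, div_eq_inv_mul]
  rw [h3]
  constructor
  · intro h
    rw [D.pos_iff]
    have : ε * ‖y - x‖ < ⟪D.m x, y - x⟫ / ‖D.m x‖ := by linarith
    rw [lt_div_iff₀ hm] at this
    nlinarith [h2.1]
  · intro h hy
    rw [D.pos_iff] at hy
    have : ⟪D.m x, y - x⟫ / ‖D.m x‖ < -(ε * ‖y - x‖) := by linarith
    rw [div_lt_iff₀ hm] at this
    nlinarith [h2.2]

end DefiningFunction

/-- A short step along `ν₂ - ν₁` would lie in `Ω` according to `ν₁` and outside `Ω` according to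
`ν₂`. The tolerance `a / (2 ‖v‖)` is half the slope of this direction against either normal. -/
theorem IsOutwardNormal.unique {Ω : Set E3} {x ν₁ ν₂ : E3} (h₁ : IsOutwardNormal Ω x ν₁)
    (h₂ : IsOutwardNormal Ω x ν₂) : ν₁ = ν₂ := by
  by_contra hne
  have ha : 0 < 1 - ⟪ν₁, ν₂⟫ := by
    have h3 : ⟪ν₁, ν₂⟫ ≤ 1 := by
      have := real_inner_le_norm ν₁ ν₂
      rwa [h₁.1, h₂.1, one_mul] at this
    have h4 : ⟪ν₁, ν₂⟫ ≠ 1 := fun h =>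
      hne ((inner_eq_one_iff_of_norm_eq_one h₁.1 h₂.1).1 h)
    exact sub_pos.2 (lt_of_le_of_ne h3 h4)
  let v := ν₂ - ν₁
  have hv : 0 < ‖v‖ := norm_pos_iff.2 (sub_ne_zero.2 (Ne.symm hne))
  let a := 1 - ⟪ν₁, ν₂⟫
  have hv1 : ⟪v, ν₁⟫ = -a := by
    simp only [v, a, inner_sub_left, real_inner_self_eq_norm_sq, h₁.1, real_inner_comm]; ring
  have hv2 : ⟪v, ν₂⟫ = a := by
    simp only [v, a, inner_sub_left, real_inner_self_eq_norm_sq, h₂.1]; ring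
  obtain ⟨δ₁, hδ₁, H₁⟩ := h₁.2 (a / (2 * ‖v‖)) (by positivity)
  obtain ⟨δ₂, hδ₂, H₂⟩ := h₂.2 (a / (2 * ‖v‖)) (by positivity)
  let s := min δ₁ δ₂ / (2 * ‖v‖)
  have hmin : 0 < min δ₁ δ₂ := lt_min hδ₁ hδ₂
  have hs : 0 < s := by positivity
  have hn : ‖x + s • v - x‖ = min δ₁ δ₂ / 2 := by
    rw [add_sub_cancel_left, norm_smul, Real.norm_of_nonneg hs.le]
    simp only [s]; field_simp
  have h5 := (H₁ (x + s • v) (by rw [hn]; linarith [min_le_left δ₁ δ₂])).1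
  have h6 := (H₂ (x + s • v) (by rw [hn]; linarith [min_le_right δ₁ δ₂])).2
  have hsv : ‖s • v‖ = s * ‖v‖ := by rw [norm_smul, Real.norm_of_nonneg hs.le]
  rw [add_sub_cancel_left, hsv, real_inner_smul_left] at h5 h6
  rw [hv1] at h5
  rw [hv2] at h6
  have h7 : a / (2 * ‖v‖) * (s * ‖v‖) = s * a / 2 := by field_simp
  have hsa : 0 < s * a := mul_pos hs ha
  rw [neg_mul, h7] at h5
  rw [h7] at h6
  exact h6 (by linarith) (h5 (by linarith))

namespace DefiningFunction

variable {Ω : Set E3} (D : DefiningFunction Ω)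

theorem normal_eq {x : E3} (hx : x ∈ frontier Ω) : normal Ω x = -(‖D.m x‖⁻¹ • D.m x) := by
  have h : ∃ ν, IsOutwardNormal Ω x ν := ⟨_, D.isOutwardNormal hx⟩
  rw [normal, dif_pos h]
  exact h.choose_spec.unique (D.isOutwardNormal hx)

theorem m_eq {x : E3} (hx : x ∈ frontier Ω) : D.m x = -(‖D.m x‖ • normal Ω x) := by
  rw [D.normal_eq hx, smul_neg, neg_neg, smul_smul, mul_inv_cancel₀ (D.norm_m_pos hx).ne', one_smul]

theorem norm_normal (D : DefiningFunction Ω) {x : E3} (hx : x ∈ frontier Ω) : ‖normal Ω x‖ = 1 := by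
  rw [D.normal_eq hx]; exact (D.isOutwardNormal hx).1

theorem inner_normal_self (D : DefiningFunction Ω) {x : E3} (hx : x ∈ frontier Ω) : ⟪normal Ω x, normal Ω x⟫ = 1 := by
  rw [real_inner_self_eq_norm_sq, D.norm_normal hx]; norm_num

theorem inner_m {x : E3} (hx : x ∈ frontier Ω) (v : E3) :
    ⟪D.m x, v⟫ = -(‖D.m x‖ * ⟪v, normal Ω x⟫) := by
  conv_lhs => rw [D.m_eq hx]
  rw [inner_neg_left, real_inner_smul_left, real_inner_comm]

theorem inner_m_eq_zero_iff {x : E3} (hx : x ∈ frontier Ω) (v : E3) :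
    ⟪D.m x, v⟫ = 0 ↔ ⟪v, normal Ω x⟫ = 0 := by
  rw [D.inner_m hx, neg_eq_zero, mul_eq_zero, or_iff_right (D.norm_m_pos hx).ne']

theorem inner_tang_normal (D : DefiningFunction Ω) {x : E3} (hx : x ∈ frontier Ω) (v : E3) :
    ⟪tang Ω x v, normal Ω x⟫ = 0 := by
  rw [tang, inner_sub_left, real_inner_smul_left, D.inner_normal_self hx]; ring

theorem inner_m_tang {x : E3} (hx : x ∈ frontier Ω) (v : E3) : ⟪D.m x, tang Ω x v⟫ = 0 :=
  (D.inner_m_eq_zero_iff hx _).2 (D.inner_tang_normal hx v)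

theorem inner_tang {x τ : E3} (hx : x ∈ frontier Ω) (hτ : ⟪D.m x, τ⟫ = 0) (v : E3) :
    ⟪tang Ω x v, τ⟫ = ⟪v, τ⟫ := by
  rw [D.inner_m_eq_zero_iff hx, real_inner_comm] at hτ
  rw [tang, inner_sub_left, real_inner_smul_left, hτ]; ring

/-- The surface gradient, tested with a tangent vector. -/
theorem inner_surfaceGrad {x τ : E3} (hx : x ∈ frontier Ω) (hτ : ⟪D.m x, τ⟫ = 0) {g : E3 → ℝ}
    {A : E3 →L[ℝ] ℝ} (hA : HasFDerivWithinAt g A (closure Ω) x) :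
    ⟪surfaceGrad Ω g x, τ⟫ = A τ := by
  have h1 := hA.mono frontier_subset_closure
  rw [surfaceGrad, D.inner_tang hx hτ, inner_gradientWithin]
  exact D.apply_eq_of_hasFDerivWithinAt hx hτ h1.differentiableWithinAt.hasFDerivWithinAt h1

theorem hasFDerivAt_inv_norm {x : E3} (hx : x ∈ frontier Ω) :
    HasFDerivAt (fun y => ‖D.m y‖⁻¹)
      (-((‖D.m x‖ ^ 3)⁻¹ • (innerSL ℝ (D.m x)).comp (D.m' x))) x := by
  have hm := D.norm_m_pos hx
  have h1 : HasFDerivAt (fun y => ‖D.m y‖ ^ 2) (2 • (innerSL ℝ (D.m x)).comp (D.m' x)) x :=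
    (D.hasFDerivAt_m x).norm_sq
  have h2 : HasFDerivAt (fun y => ‖D.m y‖) (‖D.m x‖⁻¹ • (innerSL ℝ (D.m x)).comp (D.m' x)) x := by
    have h3 := h1.sqrt (by positivity)
    simp only [Real.sqrt_sq (norm_nonneg _)] at h3
    convert! h3 using 1
    ext a
    simp
    field_simp
  have h4 := (hasDerivAt_inv hm.ne').comp_hasFDerivAt x h2
  convert! h4 using 1
  ext a
  simp
  field_simp

/-- The product `⟪m, G⟫` vanishes on the whole closure, not only on the boundary, so it may be
differentiated in normal directions as well. -/
theorem orthogonal_deriv {x : E3} (hx : x ∈ closure Ω) {G : E3 → E3} {G' : E3 →L[ℝ] E3}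
    (hG : HasFDerivWithinAt G G' (closure Ω) x) (htan : ∀ y ∈ closure Ω, ⟪D.m y, G y⟫ = 0)
    (a : E3) : ⟪D.m x, G' a⟫ = -⟪D.m' x a, G x⟫ := by
  have h1 := ((D.hasFDerivAt_m x).hasFDerivWithinAt (s := closure Ω)).inner ℝ hG
  have h2 : HasFDerivWithinAt (fun y => ⟪D.m y, G y⟫) (0 : E3 →L[ℝ] ℝ) (closure Ω) x :=
    (hasFDerivWithinAt_const (0 : ℝ) x _).congr htan (htan x hx)
  have h3 := (D.uniqueDiffOn_closure x hx).eq h1 h2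
  have h4 := congrArg (fun A => A a) h3
  simp at h4
  linarith

/-- The surface divergence in terms of the full divergence of an extension that is tangential to the
level sets of the defining function. -/
theorem surfaceDiv_eq {x : E3} (hx : x ∈ frontier Ω) {v G : E3 → E3} {G' : E3 →L[ℝ] E3}
    (hG : HasFDerivWithinAt G G' (closure Ω) x) (htan : ∀ y ∈ closure Ω, ⟪D.m y, G y⟫ = 0)
    (hv : ∀ y ∈ frontier Ω, ‖D.m y‖ • v y = G y) :
    surfaceDiv Ω v x = ‖D.m x‖⁻¹ * tr G' := by
  have hm := D.norm_m_pos hx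
  have hvX : ∀ y ∈ frontier Ω, v y = ‖D.m y‖⁻¹ • G y := fun y hy => by
    rw [← hv y hy, smul_smul, inv_mul_cancel₀ (D.norm_m_pos hy).ne', one_smul]
  set N := -((‖D.m x‖ ^ 3)⁻¹ • (innerSL ℝ (D.m x)).comp (D.m' x)) with hN
  have hX : HasFDerivWithinAt v (‖D.m x‖⁻¹ • G' + N.smulRight (G x)) (frontier Ω) x :=
    (((D.hasFDerivAt_inv_norm hx).hasFDerivWithinAt.smul hG).mono frontier_subset_closure).congr
      hvX (hvX x hx)
  set X' := ‖D.m x‖⁻¹ • G' + N.smulRight (G x) with hX'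
  have h1 : ∀ i : Fin 3, fderivWithin ℝ v (frontier Ω) x (tang Ω x (EuclideanSpace.single i 1)) =
      X' (EuclideanSpace.single i 1) - normal Ω x i • X' (normal Ω x) := by
    intro i
    rw [D.apply_eq_of_hasFDerivWithinAt hx (D.inner_m_tang hx _)
      hX.differentiableWithinAt.hasFDerivWithinAt hX, tang, map_sub, map_smul]
    simp [EuclideanSpace.inner_single_left]
  have h2 : surfaceDiv Ω v x = tr X' - ⟪normal Ω x, X' (normal Ω x)⟫ := by
    simp only [surfaceDiv, h1, tr, inner_eq_sum, Fin.sum_univ_three]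
    simp
    ring
  have hGn : ⟪normal Ω x, G x⟫ = 0 := by
    rw [real_inner_comm]
    exact (D.inner_m_eq_zero_iff hx _).1 (htan x (frontier_subset_closure hx))
  -- The trace over the tangent plane omits the entry `⟪n, X' n⟫`. By the symmetry of the Hessian,
  -- this entry equals the derivative of `1 / |m|` along `G`, so the two corrections to `tr G' /
  -- |m|` cancel.
  have h3 := D.orthogonal_deriv (frontier_subset_closure hx) hG htan (normal Ω x)
  have h4 : ⟪D.m x, G' (normal Ω x)⟫ = -(‖D.m x‖ * ⟪normal Ω x, G' (normal Ω x)⟫) := by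
    rw [D.inner_m hx, real_inner_comm]
  have h5 : ⟪D.m x, D.m' x (G x)⟫ = -(‖D.m x‖ * ⟪D.m' x (normal Ω x), G x⟫) := by
    rw [D.inner_m hx, real_inner_comm, D.symm, real_inner_comm]
  have h6 : N (G x) = -((‖D.m x‖ ^ 3)⁻¹ * ⟪D.m x, D.m' x (G x)⟫) := by
    simp [hN]
  rw [h2, hX', tr_add, tr_smul, tr_smulRight, h6, h5]
  simp only [add_apply, smul_apply,
    ContinuousLinearMap.smulRight_apply, inner_add_right, inner_smul_right, hGn]
  rw [h4] at h3
  have h7 : ⟪D.m' x (normal Ω x), G x⟫ = ‖D.m x‖ * ⟪normal Ω x, G' (normal Ω x)⟫ := by linarith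
  rw [h7]
  field_simp
  ring

/-- The surface curl of the tangential part of a field is the normal component of its curl. -/
theorem surfaceCurl_tang (D : DefiningFunction Ω) {x : E3} (hx : x ∈ frontier Ω) {v : E3 → E3} {v' : E3 →L[ℝ] E3}
    (hv : HasFDerivWithinAt v v' (closure Ω) x) :
    surfaceCurl Ω (fun y => tang Ω y (v y)) x = ⟪curlOf v', normal Ω x⟫ := by
  -- The field `-m × v` is tangential to all level sets and equals `|m| n × v^τ` on the boundary.
  have hG : HasFDerivWithinAt (fun y => -crossL (D.m y) (v y)) _ (closure Ω) x :=
    (crossL.hasFDerivWithinAt_of_bilinear (D.hasFDerivAt_m x).hasFDerivWithinAt hv).neg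
  have h1 := D.surfaceDiv_eq hx (v := fun y => perp Ω y (tang Ω y (v y))) hG
    (fun y _ => by
      rw [crossL_apply, cross_eq, inner_eq_sum]
      simp
      ring)
    (fun y hy => by
      rw [crossL_apply, perp, tang]
      have := D.m_eq hy
      rw [this]
      simp only [norm_neg, norm_smul, norm_norm, D.norm_normal hy, mul_one, cross_eq]
      ext i; fin_cases i <;> simp <;> ring)
  rw [surfaceCurl, h1]
  have h2 : ⟪curlOf v', normal Ω x⟫ = -(‖D.m x‖⁻¹ * ⟪D.m x, curlOf v'⟫) := by
    rw [D.inner_m hx]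
    field_simp [(D.norm_m_pos hx).ne']
  rw [h2]
  -- Symmetry of the Hessian is `curl m = 0`, so `div (m × v) = -m · curl v`.
  have s01 := D.symm x (EuclideanSpace.single 0 1) (EuclideanSpace.single 1 1)
  have s02 := D.symm x (EuclideanSpace.single 0 1) (EuclideanSpace.single 2 1)
  have s12 := D.symm x (EuclideanSpace.single 1 1) (EuclideanSpace.single 2 1)
  simp [EuclideanSpace.inner_single_left, EuclideanSpace.inner_single_right] at s01 s02 s12
  congr 2
  simp only [tr, Fin.sum_univ_three, inner_eq_sum, curlOf]
  simp [crossL_apply, cross_eq, ContinuousLinearMap.precompR, ContinuousLinearMap.precompL]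
  rw [s01, s02, s12]
  ring

end DefiningFunction

/-! ### Separation of the inflow boundary; fields of class `C¹` on the cylinder -/

theorem isClosed_connectedComponentIn {F : Set E3} (hF : IsClosed F) (x : E3) :
    IsClosed (connectedComponentIn F x) := by
  by_cases hx : x ∈ F
  · refine isClosed_of_closure_subset ?_
    exact isPreconnected_connectedComponentIn.closure.subset_connectedComponentIn
      (subset_closure (mem_connectedComponentIn hx))
      (closure_minimal (connectedComponentIn_subset F x) hF)
  · rw [connectedComponentIn_eq_empty hx]; exact isClosed_empty

theorem IsFiniteUnionOfComponents.isClosed {A G : Set E3} (h : IsFiniteUnionOfComponents A G)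
    (hG : IsClosed G) : IsClosed A := by
  obtain ⟨S, hS, _, rfl⟩ := h
  exact hS.isClosed_biUnion fun x _ => isClosed_connectedComponentIn hG x

/-- A smooth cutoff function separating the inflow boundary from the rest of the boundary. -/
theorem IsBoundarySplitting.exists_cutoff {Ω Γp Γm Γz : Set E3}
    (h : IsBoundarySplitting Ω Γp Γm Γz) :
    ∃ (θ : E3 → ℝ) (θ' : E3 → E3 →L[ℝ] ℝ), (∀ x, HasFDerivAt θ (θ' x) x) ∧ Continuous θ' ∧
      (∀ x ∈ Γp, θ x = 1 ∧ θ' x = 0) ∧ ∀ x ∈ frontier Ω, x ∉ Γp → θ x = 0 ∧ θ' x = 0 := by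
  have hp := h.inflow.isClosed isClosed_frontier
  have hm := h.outflow.isClosed isClosed_frontier
  have hz := h.impermeable.isClosed isClosed_frontier
  have hdisj : Disjoint (Γm ∪ Γz) Γp :=
    disjoint_union_left.2 ⟨h.disjoint_pm.symm, h.disjoint_pz.symm⟩
  obtain ⟨g, hg0, hg1, -⟩ := exists_contMDiffMap_zero_one_nhds_of_isClosed
    (n := 1) (modelWithCornersSelf ℝ E3) (hm.union hz) hp hdisj
  have hg : ContDiff ℝ 1 g := g.contMDiff.contDiff
  rw [eventually_nhdsSet_iff_forall] at hg0 hg1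
  have hloc : ∀ (x : E3) (c : ℝ), (∀ᶠ y in 𝓝 x, g y = c) → g x = c ∧ fderiv ℝ g x = 0 := by
    intro x c hx
    have : (g : E3 → ℝ) =ᶠ[𝓝 x] fun _ => c := hx
    exact ⟨hx.self_of_nhds, by rw [this.fderiv_eq]; simp⟩
  refine ⟨g, fderiv ℝ g, fun x => (hg.differentiable (by simp) x).hasFDerivAt,
    hg.continuous_fderiv (by simp), fun x hx => hloc x 1 (hg1 x hx), fun x hx hxp => ?_⟩
  refine hloc x 0 (hg0 x ?_)
  rw [← h.union_eq, union_assoc] at hx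
  exact hx.resolve_left hxp

theorem timeDeriv_eq {Y : Type*} [NormedAddCommGroup Y] [NormedSpace ℝ Y] {T : ℝ} {g : ℝ → Y}
    {g' : Y} {t : ℝ} (hT : 0 < T) (ht : t ∈ Icc 0 T) (h : HasDerivWithinAt g g' (Icc 0 T) t) :
    timeDeriv T g t = g' := h.derivWithin (uniqueDiffOn_Icc hT t ht)

/-- The consequences of `C¹` regularity up to the boundary of the space-time cylinder. -/
structure IsC1Field (T : ℝ) (Ω : Set E3) (v : ℝ → E3 → E3) : Prop where
  hasFDerivWithinAt : ∀ t ∈ Icc 0 T, ∀ x ∈ closure Ω,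
    HasFDerivWithinAt (v t) (fderivWithin ℝ (v t) (closure Ω) x) (closure Ω) x
  hasDerivWithinAt : ∀ t ∈ Icc 0 T, ∀ x ∈ closure Ω,
    HasDerivWithinAt (fun s => v s x) (timeDeriv T (fun s => v s x) t) (Icc 0 T) t
  continuousOn : ContinuousOn (fun z : ℝ × E3 => v z.1 z.2) (cylinder T Ω)
  continuousOn_fderiv : ContinuousOn
    (fun z : ℝ × E3 => fderivWithin ℝ (v z.1) (closure Ω) z.2) (cylinder T Ω)
  continuousOn_timeDeriv : ContinuousOn
    (fun z : ℝ × E3 => timeDeriv T (fun s => v s z.2) z.1) (cylinder T Ω)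

/-- The partial derivatives are restrictions of the derivative within the cylinder, which gives
joint continuity in time and space up to the boundary. -/
theorem isC1Field {T : ℝ} (hT : 0 < T) {Ω : Set E3} (hΩ : UniqueDiffOn ℝ (closure Ω))
    {v : ℝ → E3 → E3} (hv : ContDiffOn ℝ 1 (Function.uncurry v) (cylinder T Ω)) :
    IsC1Field T Ω v := by
  have hu : UniqueDiffOn ℝ (cylinder T Ω) := (uniqueDiffOn_Icc hT).prod hΩ
  let W := fderivWithin ℝ (Function.uncurry v) (cylinder T Ω)
  have hW : ∀ z ∈ cylinder T Ω, HasFDerivWithinAt (Function.uncurry v) (W z) (cylinder T Ω) z :=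
    fun z hz => (hv.differentiableOn (by simp) z hz).hasFDerivWithinAt
  have hWc : ContinuousOn W (cylinder T Ω) := hv.continuousOn_fderivWithin hu (by simp)
  have h1 : ∀ t ∈ Icc 0 T, ∀ x ∈ closure Ω, HasFDerivWithinAt (v t)
      ((W (t, x)).comp (ContinuousLinearMap.inr ℝ ℝ E3)) (closure Ω) x := by
    intro t ht x hx
    have h2 : HasFDerivWithinAt (fun y : E3 => (t, y)) (ContinuousLinearMap.inr ℝ ℝ E3)
        (closure Ω) x := (hasFDerivAt_prodMk_right t x).hasFDerivWithinAt
    exact (hW (t, x) ⟨ht, hx⟩).comp x h2 fun y hy => ⟨ht, hy⟩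
  have h3 : ∀ t ∈ Icc 0 T, ∀ x ∈ closure Ω, HasDerivWithinAt (fun s => v s x)
      (W (t, x) (1, 0)) (Icc 0 T) t := by
    intro t ht x hx
    have h2 : HasDerivWithinAt (fun s : ℝ => (s, x)) ((1 : ℝ), (0 : E3)) (Icc 0 T) t :=
      ((hasDerivAt_id t).prodMk (hasDerivAt_const t x)).hasDerivWithinAt
    have h5 : MapsTo (fun s : ℝ => (s, x)) (Icc 0 T) (cylinder T Ω) := fun y hy => ⟨hy, hx⟩
    exact (hW (t, x) ⟨ht, hx⟩).comp_hasDerivWithinAt t h2 h5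
  refine ⟨fun t ht x hx => (h1 t ht x hx).differentiableWithinAt.hasFDerivWithinAt,
    fun t ht x hx => ?_, hv.continuousOn, ?_, ?_⟩
  · rw [timeDeriv_eq hT ht (h3 t ht x hx)]
    exact h3 t ht x hx
  · refine ContinuousOn.congr (f := fun z => (W z).comp (ContinuousLinearMap.inr ℝ ℝ E3)) ?_ ?_
    · exact hWc.clm_comp continuousOn_const
    · rintro ⟨t, x⟩ ⟨ht, hx⟩
      exact (h1 t ht x hx).fderivWithin (hΩ x hx)
  · refine ContinuousOn.congr (f := fun z => W z (1, 0)) (hWc.clm_apply continuousOn_const) ?_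
    rintro ⟨t, x⟩ ⟨ht, hx⟩
    exact timeDeriv_eq hT ht (h3 t ht x hx)

namespace IsC1Field

variable {T : ℝ} {Ω : Set E3} {v : ℝ → E3 → E3}

theorem slice {t : ℝ} (ht : t ∈ Icc 0 T) {Y : Type*} [TopologicalSpace Y] {F : ℝ × E3 → Y}
    (hF : ContinuousOn F (cylinder T Ω)) : ContinuousOn (fun x => F (t, x)) (closure Ω) :=
  hF.comp (by fun_prop) fun _ hx => ⟨ht, hx⟩

theorem continuousOn_slice (hv : IsC1Field T Ω v) {t : ℝ} (ht : t ∈ Icc 0 T) :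
    ContinuousOn (v t) (closure Ω) := slice ht hv.continuousOn

theorem continuousOn_fderiv_slice (hv : IsC1Field T Ω v) {t : ℝ} (ht : t ∈ Icc 0 T) :
    ContinuousOn (fun x => fderivWithin ℝ (v t) (closure Ω) x) (closure Ω) :=
  slice ht hv.continuousOn_fderiv

theorem continuousOn_timeDeriv_slice (hv : IsC1Field T Ω v) {t : ℝ} (ht : t ∈ Icc 0 T) :
    ContinuousOn (fun x => timeDeriv T (fun s => v s x) t) (closure Ω) :=
  slice ht hv.continuousOn_timeDeriv

theorem hasFDerivAt (hv : IsC1Field T Ω v) (hΩ : IsOpen Ω) {t : ℝ} (ht : t ∈ Icc 0 T) {x : E3}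
    (hx : x ∈ Ω) : HasFDerivAt (v t) (fderivWithin ℝ (v t) (closure Ω) x) x :=
  (hv.hasFDerivWithinAt t ht x (subset_closure hx)).hasFDerivAt
    (mem_of_superset (hΩ.mem_nhds hx) subset_closure)

theorem hasDerivAt (hv : IsC1Field T Ω v) {t : ℝ} (ht : t ∈ Ioo 0 T) {x : E3}
    (hx : x ∈ closure Ω) : HasDerivAt (fun s => v s x) (timeDeriv T (fun s => v s x) t) t :=
  (hv.hasDerivWithinAt t (Ioo_subset_Icc_self ht) x hx).hasDerivAt (Icc_mem_nhds ht.1 ht.2)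

end IsC1Field

/-! ### Harmonicity of the pressure difference -/

theorem advect_eq (Ω : Set E3) (v : E3 → E3) (x : E3) :
    advect Ω v x = fderivWithin ℝ v (closure Ω) x (v x) := by
  conv_rhs => rw [eq_sum_single (v x)]
  simp [advect, partialDeriv, map_sum]

theorem gradDotGradTranspose_eq (Ω : Set E3) (v : E3 → E3) (x : E3) :
    gradDotGradTranspose Ω v x =
      tr ((fderivWithin ℝ v (closure Ω) x).comp (fderivWithin ℝ v (closure Ω) x)) := by
  simp only [tr, gradDotGradTranspose, ContinuousLinearMap.comp_apply, partialDeriv]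
  refine Finset.sum_congr rfl fun i _ => ?_
  conv_rhs => rw [eq_sum_single (fderivWithin ℝ v (closure Ω) x (EuclideanSpace.single i 1))]
  simp [map_sum, mul_comm]

theorem exists_hasFDerivAt_gradient {Ω : Set E3} (hΩ : IsOpen Ω) {g : E3 → ℝ}
    (hg : ContDiffOn ℝ 2 g Ω) : ∃ Z' : E3 → E3 →L[ℝ] E3,
      (∀ x ∈ Ω, HasFDerivAt (gradient g) (Z' x) x) ∧ ContinuousOn Z' Ω ∧
      ∀ x ∈ Ω, tr (Z' x) = Laplacian.laplacian g x := by
  have hgrad : gradient g = fun x => ∑ i : Fin 3,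
      fderiv ℝ g x (EuclideanSpace.single i 1) • (EuclideanSpace.single i 1 : E3) := by
    ext1 x
    refine (eq_sum_single _).trans (Finset.sum_congr rfl fun i _ => ?_)
    have : gradient g x i = ⟪gradient g x, EuclideanSpace.single i 1⟫ := by
      rw [EuclideanSpace.inner_single_right]; simp
    rw [this]
    simp [gradient]
  have hd1 : ContDiffOn ℝ 1 (fderiv ℝ g) Ω := hg.fderiv_of_isOpen hΩ (by norm_num)
  have hd2 : ContDiffOn ℝ 0 (fderiv ℝ (fderiv ℝ g)) Ω := hd1.fderiv_of_isOpen hΩ (by norm_num)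
  refine ⟨fun x => ∑ i : Fin 3, (((ContinuousLinearMap.apply ℝ ℝ
    (EuclideanSpace.single i 1 : E3)).comp (fderiv ℝ (fderiv ℝ g) x)).smulRight (EuclideanSpace.single i 1 : E3)), ?_, ?_, ?_⟩
  · intro x hx
    rw [hgrad]
    refine HasFDerivAt.fun_sum fun i _ => HasFDerivAt.smul_const ?_ _
    have h2 := ((hd1.differentiableOn (by simp) x hx).differentiableAt
      (hΩ.mem_nhds hx)).hasFDerivAt.clm_apply
        (hasFDerivAt_const (EuclideanSpace.single i 1 : E3) x)
    convert! h2 using 1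
    ext a
    simp
  · have h2 : Continuous fun A : E3 →L[ℝ] E3 →L[ℝ] ℝ => ∑ i : Fin 3,
        (((ContinuousLinearMap.apply ℝ ℝ (EuclideanSpace.single i 1 : E3)).comp A).smulRight
          (EuclideanSpace.single i 1 : E3)) := by
      refine continuous_finsetSum _ fun i _ => ?_
      have h3 : Continuous fun p : (E3 →L[ℝ] ℝ) =>
        p.smulRight (EuclideanSpace.single i 1 : E3) := by fun_prop
      exact h3.comp (by fun_prop)
    exact h2.comp_continuousOn hd2.continuousOn
  · intro x hx
    rw [InnerProductSpace.laplacian_eq_iteratedFDeriv_orthonormalBasis g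
      (EuclideanSpace.basisFun (Fin 3) ℝ)]
    simp only [iteratedFDeriv_two_apply, tr, Fin.sum_univ_three]
    simp

/-- The continuous extension to the closure of the gradient of the difference of the Euler pressure
and the approximate pressure. -/
noncomputable def pressureGap (T : ℝ) (Ω : Set E3) (f u : ℝ → E3 → E3) (q : ℝ → E3 → ℝ) (t : ℝ)
    (x : E3) : E3 :=
  f t x - timeDeriv T (fun s => u s x) t - advect Ω (u t) x - gradientWithin (q t) (closure Ω) x

theorem continuousOn_gradientWithin {s : Set E3} (hs : UniqueDiffOn ℝ s) {g : E3 → ℝ}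
    (hg : ContDiffOn ℝ 1 g s) : ContinuousOn (gradientWithin g s) s :=
  (InnerProductSpace.toDual ℝ E3).symm.continuous.comp_continuousOn
    (hg.continuousOn_fderivWithin hs (by simp))

theorem IsC1Field.continuousOn_advect {T : ℝ} {Ω : Set E3} {u : ℝ → E3 → E3}
    (hu : IsC1Field T Ω u) {t : ℝ} (ht : t ∈ Icc 0 T) :
    ContinuousOn (advect Ω (u t)) (closure Ω) :=
  ((hu.continuousOn_fderiv_slice ht).clm_apply (hu.continuousOn_slice ht)).congr
    fun x _ => advect_eq Ω (u t) x

section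

variable {T : ℝ} {Ω : Set E3} {f u : ℝ → E3 → E3} {q : ℝ → E3 → ℝ}

theorem continuousOn_pressureGap (hΩ : UniqueDiffOn ℝ (closure Ω)) (hf : IsC1Field T Ω f)
    (hu : IsC1Field T Ω u) {t : ℝ} (ht : t ∈ Icc 0 T) (hq : ContDiffOn ℝ 1 (q t) (closure Ω)) :
    ContinuousOn (pressureGap T Ω f u q t) (closure Ω) :=
  (((hf.continuousOn_slice ht).sub (hu.continuousOn_timeDeriv_slice ht)).sub
    (hu.continuousOn_advect ht)).sub (continuousOn_gradientWithin hΩ hq)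

theorem hasFDerivAt_of_gradient {g : E3 → ℝ} {x : E3} (hg : DifferentiableAt ℝ g x) :
    HasFDerivAt g (innerSL ℝ (gradient g x)) x := by
  convert! hg.hasFDerivAt using 1
  ext v
  simp [gradient]

theorem gradientWithin_closure_eq (hΩ : IsOpen Ω) {g : E3 → ℝ} {x : E3} (hx : x ∈ Ω) :
    gradientWithin g (closure Ω) x = gradient g x := by
  rw [gradientWithin, gradient,
    fderivWithin_of_mem_nhds (mem_of_superset (hΩ.mem_nhds hx) subset_closure)]

/-- Differentiability of `p` is given only inside `Ω`. The momentum equation identifies `∇p - ∇q`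
with a field that is continuous up to the boundary. -/
theorem hasFDerivAt_pressure_sub (hΩ : IsOpen Ω) {u₀ : E3 → E3} {p : ℝ → E3 → ℝ}
    (hup : SolvesEuler T Ω f u₀ u p) {t : ℝ} (ht : t ∈ Ioo 0 T)
    (hq : ContDiffOn ℝ 1 (q t) (closure Ω)) {x : E3} (hx : x ∈ Ω) :
    HasFDerivAt (fun y => p t y - q t y) (innerSL ℝ (pressureGap T Ω f u q t x)) x := by
  have hqd : DifferentiableAt ℝ (q t) x :=
    (hq.differentiableOn (by simp) x (subset_closure hx)).differentiableAt
      (mem_of_superset (hΩ.mem_nhds hx) subset_closure)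
  have := (hasFDerivAt_of_gradient (hup.differentiable t ht x hx)).sub (hasFDerivAt_of_gradient hqd)
  rw [← map_sub] at this
  have e : pressureGap T Ω f u q t x = gradient (p t) x - gradient (q t) x := by
    rw [pressureGap, gradientWithin_closure_eq hΩ hx, ← hup.momentum t ht x hx]
    abel
  rwa [e]

end

/-- A divergence free field is orthogonal to gradients of compactly supported functions. -/
theorem integral_fderiv_divFree_eq_zero {Ω K : Set E3} (hΩ : IsOpen Ω) (hK : IsCompact K)
    (hKΩ : K ⊆ Ω) {φ : E3 → ℝ} {φ' : E3 → E3 →L[ℝ] ℝ} (hφ : ∀ x ∈ Ω, HasFDerivAt φ (φ' x) x)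
    (hφ' : ContinuousOn φ' Ω) (h0 : ∀ x ∈ Ω, x ∉ K → φ x = 0) {Z : E3 → E3}
    {Z' : E3 → E3 →L[ℝ] E3} (hZ : ∀ x ∈ Ω, HasFDerivAt Z (Z' x) x) (hZ' : ContinuousOn Z' Ω)
    (hdiv : ∀ x ∈ Ω, tr (Z' x) = 0) : ∫ x in K, φ' x (Z x) = 0 := by
  have := integral_mul_tr_add_eq_zero hΩ hK hKΩ hφ hφ' h0 hZ hZ'
  rw [setIntegral_congr_fun (g := fun x => φ' x (Z x)) hΩ.measurableSet
    (fun x hx => by simp [hdiv x hx]), setIntegral_eq_of_vanishing hΩ.measurableSet hKΩ] at this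
  · exact this
  · intro x hx hxK
    simp [fderiv_eq_zero_off hΩ hK.isClosed hφ h0 x hx hxK]

/-- The time derivative of a divergence free field is weakly divergence free. -/
theorem integral_fderiv_timeDeriv_eq_zero {T : ℝ} {Ω K : Set E3} (hΩ : IsOpen Ω) (hK : IsCompact K)
    (hKΩ : K ⊆ Ω) {φ : E3 → ℝ} {φ' : E3 → E3 →L[ℝ] ℝ} (hφ : ∀ x ∈ Ω, HasFDerivAt φ (φ' x) x)
    (hφ' : ContinuousOn φ' Ω) (h0 : ∀ x ∈ Ω, x ∉ K → φ x = 0) {u : ℝ → E3 → E3}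
    (hu : IsC1Field T Ω u)
    (hdiv : ∀ t ∈ Ioo 0 T, ∀ x ∈ Ω, tr (fderivWithin ℝ (u t) (closure Ω) x) = 0) {t : ℝ}
    (ht : t ∈ Ioo 0 T) : ∫ x in K, φ' x (timeDeriv T (fun s => u s x) t) = 0 := by
  have hKc : K ⊆ closure Ω := hKΩ.trans subset_closure
  -- Differentiating this weak identity in time avoids taking a spatial derivative of `∂_t u`, which
  -- need not exist.
  have hzero : ∀ s ∈ Ioo 0 T, ∫ x in K, φ' x (u s x) = 0 := fun s hs =>
    integral_fderiv_divFree_eq_zero hΩ hK hKΩ hφ hφ' h0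
      (fun x hx => hu.hasFDerivAt hΩ (Ioo_subset_Icc_self hs) hx)
      ((hu.continuousOn_fderiv_slice (Ioo_subset_Icc_self hs)).mono subset_closure) (hdiv s hs)
  obtain ⟨C, hC⟩ := (isCompact_Icc.prod hK).exists_bound_of_continuousOn
    (hu.continuousOn_timeDeriv.mono (prod_mono_right hKc) : ContinuousOn _ (Icc 0 T ×ˢ K))
  have hint : ∀ s ∈ Icc 0 T, IntegrableOn (fun x => φ' x (u s x)) K := fun s hs =>
    ((hφ'.mono hKΩ).clm_apply ((hu.continuousOn_slice hs).mono hKc)).integrableOn_compact hK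
  have hd := (hasDerivAt_integral_of_dominated_loc_of_deriv_le (μ := volume.restrict K)
    (F := fun s x => φ' x (u s x)) (F' := fun s x => φ' x (timeDeriv T (fun r => u r x) s))
    (bound := fun x => ‖φ' x‖ * C) (s := Ioo 0 T) (x₀ := t) (isOpen_Ioo.mem_nhds ht)
    (by
      filter_upwards [isOpen_Ioo.mem_nhds ht] with s hs
      exact (hint s (Ioo_subset_Icc_self hs)).aestronglyMeasurable)
    (hint t (Ioo_subset_Icc_self ht))
    (((hφ'.mono hKΩ).clm_apply ((hu.continuousOn_timeDeriv_slice
      (Ioo_subset_Icc_self ht)).mono hKc)).aestronglyMeasurable hK.measurableSet)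
    (by
      filter_upwards [ae_restrict_mem hK.measurableSet] with x hx s hs
      exact ((φ' x).le_opNorm _).trans (by gcongr; exact hC (s, x) ⟨Ioo_subset_Icc_self hs, hx⟩))
    (((hφ'.mono hKΩ).norm.mul continuousOn_const).integrableOn_compact hK)
    (by
      filter_upwards [ae_restrict_mem hK.measurableSet] with x hx s hs
      exact (φ' x).hasFDerivAt.comp_hasDerivAt s (hu.hasDerivAt hs (hKc hx)))).2
  refine hd.unique ((hasDerivAt_const t (0 : ℝ)).congr_of_eventuallyEq ?_)
  filter_upwards [isOpen_Ioo.mem_nhds ht] with s hs using hzero s hs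

theorem integral_sub_sub_sub_eq_zero {μ : Measure E3} {a b c e : E3 → ℝ} (ha : Integrable a μ)
    (hb : Integrable b μ) (hc : Integrable c μ) (he : Integrable e μ) (ha0 : ∫ x, a x ∂μ = 0)
    (hb0 : ∫ x, b x ∂μ = 0) (hc0 : ∫ x, c x ∂μ = 0) (he0 : ∫ x, e x ∂μ = 0) :
    ∫ x, (a x - b x - c x - e x) ∂μ = 0 := by
  change ∫ x, (a - b - c - e) x ∂μ = 0
  rw [integral_sub' ((ha.sub hb).sub hc) he, integral_sub' (ha.sub hb) hc, integral_sub' ha hb,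
    ha0, hb0, hc0, he0]
  norm_num

/-- The difference of the Euler pressure and the approximate pressure is weakly harmonic. -/
theorem integral_fderiv_pressureGap_eq_zero {T : ℝ} {Ω K : Set E3} (hΩ : IsOpen Ω)
    (hb : Bornology.IsBounded Ω) (hK : IsCompact K) (hKΩ : K ⊆ Ω)
    {φ : E3 → ℝ} {φ' : E3 → E3 →L[ℝ] ℝ} (hφ : ∀ x ∈ Ω, HasFDerivAt φ (φ' x) x)
    (hφ' : ContinuousOn φ' Ω) (h0 : ∀ x ∈ Ω, x ∉ K → φ x = 0) {f u : ℝ → E3 → E3} {q : ℝ → E3 → ℝ}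
    (hu : IsC1Field T Ω u) (hf : IsC1Field T Ω f)
    (hdivu : ∀ t ∈ Ioo 0 T, ∀ x ∈ Ω, tr (fderivWithin ℝ (u t) (closure Ω) x) = 0)
    (hdivf : ∀ t ∈ Ioo 0 T, ∀ x ∈ Ω, tr (fderivWithin ℝ (f t) (closure Ω) x) = 0) {t : ℝ}
    (ht : t ∈ Ioo 0 T) (hq : ContDiffOn ℝ 2 (q t) Ω)
    (hlap : ∀ x ∈ Ω, Laplacian.laplacian (q t) x = -gradDotGradTranspose Ω (u t) x) :
    ∫ x in K, φ' x (pressureGap T Ω f u q t x) = 0 := by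
  have ht' := Ioo_subset_Icc_self ht
  have hKc : K ⊆ closure Ω := hKΩ.trans subset_closure
  have hφ'K := hφ'.mono hKΩ
  have hφc : ContinuousOn φ K := fun x hx => (hφ x (hKΩ hx)).continuousAt.continuousWithinAt
  have hoff := fderiv_eq_zero_off hΩ hK.isClosed hφ h0
  obtain ⟨Z', hZ, hZ', htr⟩ := exists_hasFDerivAt_gradient hΩ hq
  have e1 : ∫ x in K, φ' x (f t x) = 0 := integral_fderiv_divFree_eq_zero hΩ hK hKΩ hφ hφ' h0
    (fun x hx => hf.hasFDerivAt hΩ ht' hx)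
    ((hf.continuousOn_fderiv_slice ht').mono subset_closure) (hdivf t ht)
  have e2 := integral_fderiv_timeDeriv_eq_zero hΩ hK hKΩ hφ hφ' h0 hu hdivu ht
  obtain ⟨C, hC⟩ := hb.isCompact_closure.exists_bound_of_continuousOn
    (hu.continuousOn_fderiv_slice ht')
  have e3 := integral_advect_weak hΩ hK hKΩ hφ hφ' h0 (fun x hx => hu.hasFDerivAt hΩ ht' hx)
    ((hu.continuousOn_fderiv_slice ht').mono subset_closure) (hdivu t ht)
    (fun x hx => hC x (subset_closure hx))
  have e4 := integral_mul_tr_add_eq_zero hΩ hK hKΩ hφ hφ' h0 hZ hZ'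
  rw [setIntegral_eq_of_vanishing hΩ.measurableSet hKΩ
    (fun x hx hxK => by simp [hoff x hx hxK, h0 x hx hxK])] at e3 e4
  have c1 : IntegrableOn (fun x => φ' x (f t x)) K :=
    (hφ'K.clm_apply ((hf.continuousOn_slice ht').mono hKc)).integrableOn_compact hK
  have c2 : IntegrableOn (fun x => φ' x (timeDeriv T (fun s => u s x) t)) K :=
    (hφ'K.clm_apply ((hu.continuousOn_timeDeriv_slice ht').mono hKc)).integrableOn_compact hK
  have hU := (hu.continuousOn_fderiv_slice ht').mono hKc
  have c3 : IntegrableOn (fun x => φ x * tr ((fderivWithin ℝ (u t) (closure Ω) x).comp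
      (fderivWithin ℝ (u t) (closure Ω) x)) + φ' x (fderivWithin ℝ (u t) (closure Ω) x (u t x))) K :=
    ((hφc.mul (continuous_tr.comp_continuousOn (hU.clm_comp hU))).add
      (hφ'K.clm_apply (hU.clm_apply ((hu.continuousOn_slice ht').mono hKc)))).integrableOn_compact hK
  have c4 : IntegrableOn (fun x => φ x * tr (Z' x) + φ' x (gradient (q t) x)) K := by
    have hg : ContinuousOn (gradient (q t)) K := fun x hx =>
      (hZ x (hKΩ hx)).continuousAt.continuousWithinAt
    exact ((hφc.mul (continuous_tr.comp_continuousOn (hZ'.mono hKΩ))).add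
      (hφ'K.clm_apply hg)).integrableOn_compact hK
  -- The inserted terms `φ tr (u' ∘ u')` and `φ Δq` cancel by the equation for `q`.
  have e5 : ∫ x in K, φ' x (pressureGap T Ω f u q t x) = ∫ x in K,
      (φ' x (f t x) - φ' x (timeDeriv T (fun s => u s x) t)
      - (φ x * tr ((fderivWithin ℝ (u t) (closure Ω) x).comp
      (fderivWithin ℝ (u t) (closure Ω) x)) + φ' x (fderivWithin ℝ (u t) (closure Ω) x (u t x)))
      - (φ x * tr (Z' x) + φ' x (gradient (q t) x))) := by
    refine setIntegral_congr_fun hK.measurableSet fun x hx => ?_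
    have hx' := hKΩ hx
    simp only [pressureGap, map_sub]
    rw [gradientWithin_closure_eq hΩ hx', advect_eq, htr x hx', hlap x hx', gradDotGradTranspose_eq]
    ring
  rw [e5]
  exact integral_sub_sub_sub_eq_zero c1 c2 c3 c4 e1 e2 e3 e4

/-- The boundary layer form of `∫_Γ r ∂_n r = ∫_Ω |∇r|² ≥ 0` for the weakly harmonic function `r`. -/
theorem DefiningFunction.layer_mul_inner_nonpos {Ω : Set E3} (D : DefiningFunction Ω)
    (hb : Bornology.IsBounded Ω) {r : E3 → ℝ} {R : E3 → E3}
    (hr : ∀ x ∈ Ω, HasFDerivAt r (innerSL ℝ (R x)) x) (hR : ContinuousOn R Ω)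
    (hweak : ∀ (n : ℕ) (φ : E3 → ℝ) (φ' : E3 → E3 →L[ℝ] ℝ), (∀ x ∈ Ω, HasFDerivAt φ (φ' x) x) →
      ContinuousOn φ' Ω → (∀ x ∈ Ω, x ∉ D.core n → φ x = 0) → ∫ x in D.core n, φ' x (R x) = 0)
    (n : ℕ) : D.layer n (fun x => r x * ⟪D.m x, R x⟫) ≤ 0 := by
  have hrc : ContinuousOn r Ω := fun x hx => (hr x hx).continuousAt.continuousWithinAt
  have hsub := D.core_subset n
  have hcpt := D.isCompact_core hb n
  -- Testing with the cutoff times `r` itself gives the cut-off Dirichlet integral plus the layer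
  -- integral. Since `m` points into `Ω`, the latter represents `-∫_Γ r ∂_n r`.
  have h1 := hweak n (fun x => layerStep n (D.d x) * r x)
    (fun x => layerStep n (D.d x) • innerSL ℝ (R x) +
      r x • (layerDensity n (D.d x) • innerSL ℝ (D.m x)))
    (fun x hx => ((hasDerivAt_layerStep n (D.d x)).comp_hasFDerivAt x (D.hasFDerivAt_d x)).mul
      (hr x hx))
    (((D.continuous_step n).continuousOn.smul ((innerSL ℝ).continuous.comp_continuousOn hR)).add
      (hrc.smul ((D.continuous_density n).smul
        ((innerSL ℝ).continuous.comp D.continuous_m)).continuousOn))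
    (fun x hx hxK => by simp [D.layerStep_off hx hxK])
  have h2 : D.layer n (fun x => r x * ⟪D.m x, R x⟫) =
      ∫ x in D.core n, layerDensity n (D.d x) * (r x * ⟪D.m x, R x⟫) :=
    setIntegral_eq_of_vanishing D.isOpen.measurableSet hsub
      fun x hx hxK => by simp [D.layerDensity_off hx hxK]
  have h3 : ∫ x in D.core n, (layerStep n (D.d x) * ⟪R x, R x⟫ +
      layerDensity n (D.d x) * (r x * ⟪D.m x, R x⟫)) = 0 := by
    rw [← h1]
    congr 1; ext x
    simp
    ring
  rw [integral_add] at h3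
  · have h4 : 0 ≤ ∫ x in D.core n, layerStep n (D.d x) * ⟪R x, R x⟫ :=
      integral_nonneg fun x => mul_nonneg (layerStep_nonneg _ _) real_inner_self_nonneg
    rw [h2]; linarith
  · exact (((D.continuous_step n).continuousOn).mul
      ((hR.mono hsub).inner (hR.mono hsub))).integrableOn_compact hcpt
  · exact (((D.continuous_density n).continuousOn).mul ((hrc.mono hsub).mul
      (D.continuous_m.continuousOn.inner (hR.mono hsub)))).integrableOn_compact hcpt

/-! ### Algebra of the curl -/

theorem apply_coord (A : E3 →L[ℝ] E3) (v : E3) (i : Fin 3) :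
    A v i = v 0 * A (EuclideanSpace.single 0 1) i + v 1 * A (EuclideanSpace.single 1 1) i
      + v 2 * A (EuclideanSpace.single 2 1) i := by
  conv_lhs => rw [eq_sum_single v]
  simp [Fin.sum_univ_three]

/-- The antisymmetric part of `A` acts as the cross product with half the curl. -/
theorem inner_apply_sub_inner_apply (A : E3 →L[ℝ] E3) (v z : E3) :
    ⟪v, A z⟫ - ⟪A v, z⟫ = ⟪curlOf A, cross z v⟫ := by
  simp only [inner_eq_sum, apply_coord A v, apply_coord A z, curlOf, cross_eq]
  simp
  ring

theorem curlOf_sub (A B : E3 →L[ℝ] E3) : curlOf (A - B) = curlOf A - curlOf B := by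
  ext i; fin_cases i <;> simp [curlOf] <;> ring

/-- The cross product of two tangential vectors is normal. -/
theorem inner_cross_eq_zero {n z v c : E3} (hn : ⟪n, n⟫ = 1) (hz : ⟪z, n⟫ = 0) (hv : ⟪v, n⟫ = 0)
    (hc : ⟪c, n⟫ = 0) : ⟪c, cross z v⟫ = 0 := by
  have h : ⟪c, cross z v⟫ = ⟪c, cross z v⟫ * (1 - ⟪n, n⟫) + ⟪n, cross z v⟫ * ⟪c, n⟫
      - ⟪c, cross n z⟫ * ⟪v, n⟫ + ⟪c, cross n v⟫ * ⟪z, n⟫ := by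
    simp only [inner_eq_sum, cross_eq]
    simp
    ring
  rw [h, hn, hz, hv, hc]
  ring

/-- The tangential part of `ω × u` when `ω` has the prescribed form. -/
theorem inner_vorticity_cross {n a u z : E3} {h : ℝ} (hz : ⟪z, n⟫ = 0) (hu : ⟪u, n⟫ ≠ 0) :
    ⟪(1 / ⟪u, n⟫) • cross n a + (1 / ⟪u, n⟫) • (h • (u - ⟪u, n⟫ • n)) + h • n, cross u z⟫ = ⟪a, z⟫ := by
  have e1 : ⟪cross n a, cross u z⟫ = ⟪u, n⟫ * ⟪a, z⟫ - ⟪a, u⟫ * ⟪z, n⟫ := by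
    simp only [inner_eq_sum, cross_eq]
    simp
    ring
  -- The two terms with `h` combine to a multiple of `u`, and hence drop out; only the term in `a`
  -- survives.
  have e2 : ⟪u, cross u z⟫ = 0 := by
    simp only [inner_eq_sum, cross_eq]
    simp
    ring
  simp only [inner_add_left, real_inner_smul_left, inner_sub_left, e1, e2, hz]
  field_simp
  ring

theorem inner_vorticity_normal {n a u : E3} {h c : ℝ} (hn : ⟪n, n⟫ = 1) :
    ⟪c • cross n a + c • (h • (u - ⟪u, n⟫ • n)) + h • n, n⟫ = h := by
  have e1 : ⟪cross n a, n⟫ = 0 := by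
    simp only [inner_eq_sum, cross_eq]
    simp
    ring
  simp only [inner_add_left, real_inner_smul_left, inner_sub_left, e1, hn]
  ring

theorem continuousOn_smulRight {X : Type*} [TopologicalSpace X] {S : Set X} {φ : X → E3 →L[ℝ] ℝ}
    {z : X → E3} (hφ : ContinuousOn φ S) (hz : ContinuousOn z S) :
    ContinuousOn (fun p => (φ p).smulRight (z p)) S := by
  have h2 : Continuous fun p : (E3 →L[ℝ] ℝ) × E3 => p.1.smulRight p.2 := by fun_prop
  exact h2.comp_continuousOn (hφ.prodMk hz)

namespace DefiningFunction

variable {Ω : Set E3} (D : DefiningFunction Ω)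

/-! ### Tangential fields -/

theorem contDiff_m : ContDiff ℝ 1 D.m := by
  rw [contDiff_one_iff_fderiv]
  refine ⟨fun x => (D.hasFDerivAt_m x).differentiableAt, ?_⟩
  have : fderiv ℝ D.m = D.m' := by ext1 x; exact (D.hasFDerivAt_m x).fderiv
  rw [this]; exact D.continuous_m'

theorem contDiff_κ : ContDiff ℝ 1 D.κ := by
  rw [contDiff_one_iff_fderiv]
  refine ⟨fun x => (D.hasFDerivAt_κ x).differentiableAt, ?_⟩
  have : fderiv ℝ D.κ = D.κ' := by ext1 x; exact (D.hasFDerivAt_κ x).fderiv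
  rw [this]; exact D.continuous_κ'

/-- A `C¹` extension of the orthogonal projection to the tangent space of the boundary, with values
tangential to the level sets of the defining function. -/
noncomputable def proj (x : E3) : E3 →L[ℝ] E3 :=
  D.κ x • (‖D.m x‖ ^ 2 • ContinuousLinearMap.id ℝ E3 - (innerSL ℝ (D.m x)).smulRight (D.m x))

theorem proj_apply (x v : E3) :
    D.proj x v = D.κ x • (‖D.m x‖ ^ 2 • v - ⟪D.m x, v⟫ • D.m x) := by
  simp [proj]

theorem inner_m_proj (x v : E3) : ⟪D.m x, D.proj x v⟫ = 0 := by
  rw [proj_apply, inner_smul_right, inner_sub_right, inner_smul_right, inner_smul_right,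
    real_inner_self_eq_norm_sq]
  ring

theorem proj_of_tangent {x v : E3} (hx : x ∈ frontier Ω) (hv : ⟪D.m x, v⟫ = 0) :
    D.proj x v = v := by
  rw [proj_apply, hv, zero_smul, sub_zero, smul_smul, (D.κ_eq x hx).self_of_nhds, one_smul]

theorem inner_proj_of_tangent {x v z : E3} (hx : x ∈ frontier Ω) (hz : ⟪D.m x, z⟫ = 0) :
    ⟪D.proj x v, z⟫ = ⟪v, z⟫ := by
  rw [proj_apply, real_inner_smul_left, inner_sub_left, real_inner_smul_left,
    real_inner_smul_left, hz, mul_zero, sub_zero, ← mul_assoc, (D.κ_eq x hx).self_of_nhds, one_mul]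

theorem contDiff_proj : ContDiff ℝ 1 D.proj := by
  have h2 : ContDiff ℝ 1 fun x => (innerSL ℝ (D.m x)).smulRight (D.m x) :=
    ((innerSL ℝ).contDiff.comp D.contDiff_m).smulRight D.contDiff_m
  exact D.contDiff_κ.smul (((D.contDiff_m.norm_sq ℝ).smul contDiff_const).sub h2)

/-- The derivative of `proj`. -/
noncomputable def proj' (x : E3) : E3 →L[ℝ] E3 →L[ℝ] E3 := fderiv ℝ D.proj x

theorem hasFDerivAt_proj (x : E3) : HasFDerivAt D.proj (D.proj' x) x :=
  (D.contDiff_proj.differentiable (by simp) x).hasFDerivAt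

theorem continuous_proj' : Continuous D.proj' := D.contDiff_proj.continuous_fderiv (by simp)

/-- The derivative of `y ↦ proj y (v y)` when `v` has derivative `A`. -/
noncomputable def projDeriv (x v : E3) (A : E3 →L[ℝ] E3) : E3 →L[ℝ] E3 :=
  (D.proj x).comp A + (D.proj' x).flip v

theorem hasFDerivWithinAt_proj {s : Set E3} {x : E3} {v : E3 → E3} {A : E3 →L[ℝ] E3}
    (hv : HasFDerivWithinAt v A s x) :
    HasFDerivWithinAt (fun y => D.proj y (v y)) (D.projDeriv x (v x) A) s x :=
  (D.hasFDerivAt_proj x).hasFDerivWithinAt.clm_apply hv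

/-- The tangential field `⟪U, m⟫ • proj z`. -/
noncomputable def flux (x U z : E3) : E3 := ⟪U, D.m x⟫ • D.proj x z

/-- The derivative of `y ↦ ⟪U y, m y⟫`. -/
noncomputable def massDeriv (x U : E3) (A : E3 →L[ℝ] E3) : E3 →L[ℝ] ℝ :=
  (innerSL ℝ U).comp (D.m' x) + (innerSL ℝ (D.m x)).comp A

/-- The derivative of `y ↦ flux y (U y) (z y)`. -/
noncomputable def fluxDeriv (x U : E3) (A : E3 →L[ℝ] E3) (z : E3) (B : E3 →L[ℝ] E3) :
    E3 →L[ℝ] E3 :=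
  ⟪U, D.m x⟫ • D.projDeriv x z B + (D.massDeriv x U A).smulRight (D.proj x z)

/-- On the boundary, `flux U z` is `-|m| U^n z^τ`; the factor `|m|` compensates the weight `1 / |m|`
implicit in layer integrals. By tangency to every level set, a `C¹` scalar multiple of a `C¹` flux
is admissible in `layer_tr_eq_zero`. -/
theorem inner_m_flux (x U z : E3) : ⟪D.m x, D.flux x U z⟫ = 0 := by
  rw [flux, inner_smul_right, inner_m_proj, mul_zero]

theorem hasFDerivWithinAt_mass {s : Set E3} {x : E3} {U : E3 → E3} {A : E3 →L[ℝ] E3}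
    (hU : HasFDerivWithinAt U A s x) :
    HasFDerivWithinAt (fun y => ⟪U y, D.m y⟫) (D.massDeriv x (U x) A) s x := by
  convert! hU.inner ℝ (D.hasFDerivAt_m x).hasFDerivWithinAt using 1
  ext a
  simp [massDeriv, fderivInnerCLM_apply, real_inner_comm]

theorem hasFDerivWithinAt_flux {s : Set E3} {x : E3} {U z : E3 → E3} {A B : E3 →L[ℝ] E3}
    (hU : HasFDerivWithinAt U A s x) (hz : HasFDerivWithinAt z B s x) :
    HasFDerivWithinAt (fun y => D.flux y (U y) (z y)) (D.fluxDeriv x (U x) A (z x) B) s x :=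
  (D.hasFDerivWithinAt_mass hU).smul (D.hasFDerivWithinAt_proj hz)

variable {X : Type*} [TopologicalSpace X] {S : Set X} {ξ : X → E3} {U z : X → E3}
  {A B : X → E3 →L[ℝ] E3}

theorem continuousOn_projDeriv (hξ : ContinuousOn ξ S) (hU : ContinuousOn U S)
    (hA : ContinuousOn A S) : ContinuousOn (fun p => D.projDeriv (ξ p) (U p) (A p)) S := by
  have h1 : ContinuousOn (fun p => D.proj (ξ p)) S :=
    D.contDiff_proj.continuous.comp_continuousOn hξ
  have h2 : ContinuousOn (fun p => (D.proj' (ξ p)).flip) S :=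
    (ContinuousLinearMap.flipₗᵢ ℝ E3 E3 E3).continuous.comp_continuousOn
      (D.continuous_proj'.comp_continuousOn hξ)
  exact (h1.clm_comp hA).add (h2.clm_apply hU)

theorem continuousOn_mass (hξ : ContinuousOn ξ S) (hU : ContinuousOn U S) :
    ContinuousOn (fun p => ⟪U p, D.m (ξ p)⟫) S :=
  hU.inner (D.continuous_m.comp_continuousOn hξ)

theorem continuousOn_massDeriv (hξ : ContinuousOn ξ S) (hU : ContinuousOn U S)
    (hA : ContinuousOn A S) : ContinuousOn (fun p => D.massDeriv (ξ p) (U p) (A p)) S :=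
  (((innerSL ℝ).continuous.comp_continuousOn hU).clm_comp
    (D.continuous_m'.comp_continuousOn hξ)).add
  (((innerSL ℝ).continuous.comp_continuousOn (D.continuous_m.comp_continuousOn hξ)).clm_comp hA)

theorem continuousOn_flux (hξ : ContinuousOn ξ S) (hU : ContinuousOn U S) (hz : ContinuousOn z S) :
    ContinuousOn (fun p => D.flux (ξ p) (U p) (z p)) S :=
  (D.continuousOn_mass hξ hU).smul
    ((D.contDiff_proj.continuous.comp_continuousOn hξ).clm_apply hz)

theorem continuousOn_fluxDeriv (hξ : ContinuousOn ξ S) (hU : ContinuousOn U S)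
    (hA : ContinuousOn A S) (hz : ContinuousOn z S) (hB : ContinuousOn B S) :
    ContinuousOn (fun p => D.fluxDeriv (ξ p) (U p) (A p) (z p) (B p)) S :=
  ((D.continuousOn_mass hξ hU).smul (D.continuousOn_projDeriv hξ hz hB)).add
    (continuousOn_smulRight (D.continuousOn_massDeriv hξ hU hA)
      ((D.contDiff_proj.continuous.comp_continuousOn hξ).clm_apply hz))

/-- The divergence of `r • flux U z + (|z|²/2) • (flux U z + flux U U)`. -/
noncomputable def energyDiv (x U : E3) (A : E3 →L[ℝ] E3) (z : E3) (B : E3 →L[ℝ] E3) (r : ℝ)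
    (R : E3) : ℝ :=
  r * tr (D.fluxDeriv x U A z B) + ⟪R, D.flux x U z⟫
    + 1 / 2 * ‖z‖ ^ 2 * (tr (D.fluxDeriv x U A z B) + tr (D.fluxDeriv x U A U A))
    + ⟪z, B (D.flux x U z + D.flux x U U)⟫

end DefiningFunction

/-! ### From the boundary inequality to the layer energy -/

namespace DefiningFunction

variable {Ω : Set E3} (D : DefiningFunction Ω)

/-- The limiting energy inequality at a fixed time, from a pointwise inequality on the boundary. -/
theorem eventually_energy_le (hb : Bornology.IsBounded Ω) {θ : E3 → ℝ} {θ' : E3 → E3 →L[ℝ] ℝ}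
    (hθ : ∀ x, HasFDerivAt θ (θ' x) x) (hθ' : Continuous θ') (hθ0 : ∀ x ∈ frontier Ω, θ' x = 0)
    {U z Ut zt : E3 → E3} {A B : E3 → E3 →L[ℝ] E3}
    (hU : ∀ x ∈ closure Ω, HasFDerivWithinAt U (A x) (closure Ω) x) (hA : ContinuousOn A (closure Ω))
    (hz : ∀ x ∈ closure Ω, HasFDerivWithinAt z (B x) (closure Ω) x) (hB : ContinuousOn B (closure Ω))
    (hUt : ContinuousOn Ut (closure Ω)) (hzt : ContinuousOn zt (closure Ω))
    {r : E3 → ℝ} {R : E3 → E3} (hr : ∀ x ∈ Ω, HasFDerivAt r (innerSL ℝ (R x)) x)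
    (hrc : ContinuousOn r (closure Ω)) (hR : ContinuousOn R (closure Ω))
    (hlayer : ∀ n, D.layer n (fun x => r x * ⟪D.m x, R x⟫) ≤ 0) {C : ℝ}
    (hbd : ∀ x ∈ frontier Ω, θ x * (⟪U x, D.m x⟫ * ⟪z x, zt x⟫ + 1 / 2 * ⟪Ut x, D.m x⟫ * ‖z x‖ ^ 2
      - C * (1 / 2 * ⟪U x, D.m x⟫ * ‖z x‖ ^ 2) + D.energyDiv x (U x) (A x) (z x) (B x) (r x) (R x))
      - r x * ⟪D.m x, R x⟫ ≤ 0) {δ : ℝ} (hδ : 0 < δ) :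
    ∀ᶠ n in atTop, D.layer n (fun x => θ x * (⟪U x, D.m x⟫ * ⟪z x, zt x⟫
        + 1 / 2 * ⟪Ut x, D.m x⟫ * ‖z x‖ ^ 2))
      - C * D.layer n (fun x => θ x * (1 / 2 * ⟪U x, D.m x⟫ * ‖z x‖ ^ 2)) ≤ δ := by
  have hθc : Continuous θ := continuous_iff_continuousAt.2 fun x => (hθ x).continuousAt
  have hUc : ContinuousOn U (closure Ω) := fun x hx => (hU x hx).continuousWithinAt
  have hzc : ContinuousOn z (closure Ω) := fun x hx => (hz x hx).continuousWithinAt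
  have hmc : ContinuousOn D.m (closure Ω) := D.continuous_m.continuousOn
  have hid : ContinuousOn (fun x : E3 => x) (closure Ω) := continuousOn_id
  -- The three fluxes integrate by parts, in turn, the pressure term, the gradient of `|z|²/2` along
  -- `z`, and its transport by the tangential part of `U`.
  let W : E3 → E3 := fun x => r x • D.flux x (U x) (z x)
    + (1 / 2 * ‖z x‖ ^ 2) • (D.flux x (U x) (z x) + D.flux x (U x) (U x))
  let W' : E3 → E3 →L[ℝ] E3 := fun x => (r x • D.fluxDeriv x (U x) (A x) (z x) (B x)
      + (innerSL ℝ (R x)).smulRight (D.flux x (U x) (z x)))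
    + ((1 / 2 * ‖z x‖ ^ 2) • (D.fluxDeriv x (U x) (A x) (z x) (B x)
        + D.fluxDeriv x (U x) (A x) (U x) (A x))
      + ((innerSL ℝ (z x)).comp (B x)).smulRight (D.flux x (U x) (z x) + D.flux x (U x) (U x)))
  have hUi : ∀ x ∈ Ω, HasFDerivAt U (A x) x := fun x hx => (hU x (subset_closure hx)).hasFDerivAt
    (mem_of_superset (D.isOpen.mem_nhds hx) subset_closure)
  have hzi : ∀ x ∈ Ω, HasFDerivAt z (B x) x := fun x hx => (hz x (subset_closure hx)).hasFDerivAt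
    (mem_of_superset (D.isOpen.mem_nhds hx) subset_closure)
  have hflux : ∀ (z : E3 → E3) (B : E3 → E3 →L[ℝ] E3), (∀ x ∈ Ω, HasFDerivAt z (B x) x) →
      ∀ x ∈ Ω, HasFDerivAt (fun y => D.flux y (U y) (z y))
        (D.fluxDeriv x (U x) (A x) (z x) (B x)) x := by
    intro z B hzi x hx
    rw [← hasFDerivWithinAt_univ]
    exact D.hasFDerivWithinAt_flux (hUi x hx).hasFDerivWithinAt (hzi x hx).hasFDerivWithinAt
  have hW : ∀ x ∈ Ω, HasFDerivAt W (W' x) x := by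
    intro x hx
    have h1 : HasFDerivAt (fun y => 1 / 2 * ‖z y‖ ^ 2) ((innerSL ℝ (z x)).comp (B x)) x := by
      convert! (hzi x hx).norm_sq.const_mul (1 / 2) using 1
      ext a
      simp
    exact ((hr x hx).smul (hflux z B hzi x hx)).add
      (h1.smul ((hflux z B hzi x hx).add (hflux U A hUi x hx)))
  have hfz := D.continuousOn_flux hid hUc hzc
  have hfU := D.continuousOn_flux hid hUc hUc
  have hfz' := D.continuousOn_fluxDeriv hid hUc hA hzc hB
  have hfU' := D.continuousOn_fluxDeriv hid hUc hA hUc hA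
  have hnc : ContinuousOn (fun x => 1 / 2 * ‖z x‖ ^ 2) (closure Ω) :=
    continuousOn_const.mul (hzc.norm.pow 2)
  have hWc : ContinuousOn W (closure Ω) := (hrc.smul hfz).add (hnc.smul (hfz.add hfU))
  have hW'c : ContinuousOn W' (closure Ω) :=
    ((hrc.smul hfz').add (continuousOn_smulRight ((innerSL ℝ).continuous.comp_continuousOn hR) hfz)).add
    ((hnc.smul (hfz'.add hfU')).add (continuousOn_smulRight
      (((innerSL ℝ).continuous.comp_continuousOn hzc).clm_comp hB) (hfz.add hfU)))
  have htrW : ∀ x, tr (W' x) = D.energyDiv x (U x) (A x) (z x) (B x) (r x) (R x) := by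
    intro x
    simp only [W', tr_add, tr_smul, tr_smulRight, energyDiv, innerSL_apply_apply,
      ContinuousLinearMap.comp_apply]
    ring
  have hY'c : ContinuousOn (fun x => θ x • W' x + (θ' x).smulRight (W x)) (closure Ω) :=
    (hθc.continuousOn.smul hW'c).add (continuousOn_smulRight hθ'.continuousOn hWc)
  -- The divergence of `θ W` can be added to the energy balance at no cost, since its layer
  -- integrals are exactly zero.
  have hdiv := fun n => D.layer_tr_eq_zero hb n (Y := fun x => θ x • W x)
    (Y' := fun x => θ x • W' x + (θ' x).smulRight (W x))
    (fun x hx => (hθ x).smul (hW x hx)) (hY'c.mono subset_closure)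
    (fun x hx => by
      simp only [W, inner_smul_right, inner_add_right, inner_m_flux]
      ring)
  let g : E3 → ℝ := fun x => θ x * (⟪U x, D.m x⟫ * ⟪z x, zt x⟫ + 1 / 2 * ⟪Ut x, D.m x⟫ * ‖z x‖ ^ 2)
  let e : E3 → ℝ := fun x => θ x * (1 / 2 * ⟪U x, D.m x⟫ * ‖z x‖ ^ 2)
  let k : E3 → ℝ := fun x => tr (θ x • W' x + (θ' x).smulRight (W x))
  let S : E3 → ℝ := fun x => r x * ⟪D.m x, R x⟫
  have hg : ContinuousOn g (closure Ω) := hθc.continuousOn.mul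
    (((hUc.inner hmc).mul (hzc.inner hzt)).add
      ((continuousOn_const.mul (hUt.inner hmc)).mul (hzc.norm.pow 2)))
  have he : ContinuousOn e (closure Ω) := hθc.continuousOn.mul
    ((continuousOn_const.mul (hUc.inner hmc)).mul (hzc.norm.pow 2))
  have hk : ContinuousOn k (closure Ω) := continuous_tr.comp_continuousOn hY'c
  have hS : ContinuousOn S (closure Ω) := hrc.mul (hmc.inner hR)
  -- In this sum the divergence `k` has zero layer integral and `S` a nonpositive one, so the bound
  -- passes to `g - C e`. The term with `θ'` disappears on the boundary.
  have hmain := D.eventually_layer_le hb (g := fun x => (g x + -C * e x) + (k x + -1 * S x))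
    ((hg.add (continuousOn_const.mul he)).add (hk.add (continuousOn_const.mul hS)))
    (fun x hx => by
      refine le_trans (le_of_eq ?_) (hbd x hx)
      simp only [g, e, k, S, tr_add, tr_smul, tr_smulRight, htrW, hθ0 x hx]
      simp
      ring) hδ
  have hsub := subset_closure (s := Ω)
  filter_upwards [hmain] with n hn
  have hg := hg.mono hsub
  have he := he.mono hsub
  have hk := hk.mono hsub
  have hS := hS.mono hsub
  have hCe : ContinuousOn (fun x => -C * e x) Ω := continuousOn_const.mul he
  have hSe : ContinuousOn (fun x => -1 * S x) Ω := continuousOn_const.mul hS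
  rw [D.layer_add hb n (g := fun x => g x + -C * e x) (h := fun x => k x + -1 * S x)
    (hg.add hCe) (hk.add hSe), D.layer_add hb n hg hCe, D.layer_add hb n hk hSe,
    D.layer_const_mul, D.layer_const_mul] at hn
  have h1 := hdiv n
  have h2 := hlayer n
  change D.layer n k = 0 at h1
  change D.layer n S ≤ 0 at h2
  change D.layer n g - C * D.layer n e ≤ δ
  linarith

end DefiningFunction

/-! ### Identities on the inflow boundary -/

theorem cross_swap (a b : E3) : cross a b = -cross b a := by
  simp only [cross_eq]
  ext i; fin_cases i <;> simp <;> ring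

namespace DefiningFunction

variable {Ω : Set E3} (D : DefiningFunction Ω) {T : ℝ} {Γp : Set E3} {Un : ℝ → E3 → ℝ}
  {U u f : ℝ → E3 → E3} {q : ℝ → E3 → ℝ}

/-- The normal component of the gap on the boundary. -/
theorem inner_pressureGap_normal (hT : 0 < T) (hu : IsC1Field T Ω u)
    (hun : ∀ t ∈ Icc 0 T, ∀ x ∈ frontier Ω, ⟪u t x, normal Ω x⟫ = Un t x)
    (hfn : ∀ t ∈ Icc 0 T, ∀ x ∈ frontier Ω, ⟪f t x, normal Ω x⟫ = 0)
    (hq : SolvesApproxPressure T Ω Γp Un U u q) {t : ℝ} (ht : t ∈ Icc 0 T) {x : E3}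
    (hx : x ∈ frontier Ω) :
    ⟪pressureGap T Ω f u q t x, normal Ω x⟫ =
      Γp.indicator (surfaceDiv Ω fun y => Un t y • (tang Ω y (u t y) - tang Ω y (U t y))) x := by
  have h1 : timeDeriv T (fun s => Un s x) t = ⟪timeDeriv T (fun s => u s x) t, normal Ω x⟫ := by
    have h2 : HasDerivWithinAt (fun s => ⟪u s x, normal Ω x⟫)
        ⟪timeDeriv T (fun s => u s x) t, normal Ω x⟫ (Icc 0 T) t := by
      have := (hu.hasDerivWithinAt t ht x (frontier_subset_closure hx)).inner ℝ
        (hasDerivWithinAt_const t (Icc 0 T) (normal Ω x))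
      simpa using this
    exact timeDeriv_eq hT ht
      (h2.congr (fun s hs => (hun s hs x hx).symm) (hun t ht x hx).symm)
  -- The Neumann condition cancels every normal term of the momentum equation except the surface
  -- divergence added in `N[u]` on the inflow part.
  have h3 := hq.neumann t ht x hx
  rw [modifiedAdvection, h1] at h3
  simp only [pressureGap, inner_sub_left, hfn t ht x hx, h3]
  ring

/-- Since `z` is tangential, the negative of its flux extends `|m| U^n z`, so the Neumann datum of
`r` becomes the full divergence of a tangential field. -/
theorem tr_fluxDeriv_eq (hU : IsC1Field T Ω U) (hu : IsC1Field T Ω u)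
    (hUn : ∀ t ∈ Icc 0 T, ∀ x ∈ frontier Ω, ⟪U t x, normal Ω x⟫ = Un t x)
    (hun : ∀ t ∈ Icc 0 T, ∀ x ∈ frontier Ω, ⟪u t x, normal Ω x⟫ = Un t x)
    {t : ℝ} (ht : t ∈ Icc 0 T) {x : E3} (hx : x ∈ frontier Ω) :
    ‖D.m x‖ * surfaceDiv Ω (fun y => Un t y • (tang Ω y (u t y) - tang Ω y (U t y))) x =
      -tr (D.fluxDeriv x (U t x) (fderivWithin ℝ (U t) (closure Ω) x) (u t x - U t x)
        (fderivWithin ℝ (u t) (closure Ω) x - fderivWithin ℝ (U t) (closure Ω) x)) := by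
  have hxc := frontier_subset_closure hx
  have h1 := hU.hasFDerivWithinAt t ht x hxc
  have h2 := (hu.hasFDerivWithinAt t ht x hxc).sub h1
  have h3 := (D.hasFDerivWithinAt_flux h1 h2).neg
  have h4 := D.surfaceDiv_eq hx
    (v := fun y => Un t y • (tang Ω y (u t y) - tang Ω y (U t y))) h3
    (fun y _ => by simp [inner_m_flux])
    (fun y hy => by
      have hz : ⟪D.m y, u t y - U t y⟫ = 0 := by
        rw [D.inner_m_eq_zero_iff hy, inner_sub_left, hun t ht y hy, hUn t ht y hy, sub_self]
      have e : tang Ω y (u t y) - tang Ω y (U t y) = u t y - U t y := by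
        rw [tang, tang, hun t ht y hy, hUn t ht y hy]; abel
      simp only [Pi.neg_apply, Pi.sub_apply, flux]
      rw [D.proj_of_tangent hy hz, e, real_inner_comm, D.inner_m hy, hUn t ht y hy, smul_smul,
        neg_smul, neg_neg])
  rw [h4, ← mul_assoc, mul_inv_cancel₀ (D.norm_m_pos hx).ne', one_mul,
    ← neg_one_smul ℝ (D.fluxDeriv _ _ _ _ _), tr_smul]
  simp

/-- The normal vorticity of the difference vanishes on the inflow boundary. -/
theorem inner_curlOf_sub_normal (hU : IsC1Field T Ω U) {t : ℝ} (ht : t ∈ Icc 0 T) {x : E3}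
    (D : DefiningFunction Ω) (hx : x ∈ frontier Ω)
    (hH : curl Ω (u t) x = boundaryVorticity T Ω Un U f u q t x) :
    ⟪curlOf (fderivWithin ℝ (u t) (closure Ω) x - fderivWithin ℝ (U t) (closure Ω) x),
      normal Ω x⟫ = 0 := by
  rw [curlOf_sub, inner_sub_left, ← curl_eq, hH,
    ← D.surfaceCurl_tang hx (hU.hasFDerivWithinAt t ht x (frontier_subset_closure hx)), sub_eq_zero]
  rw [boundaryVorticity, vorticityTangential, vorticityNormal, perp]
  exact inner_vorticity_normal (D.inner_normal_self hx)

theorem timeDeriv_tang (hT : 0 < T) (hU : IsC1Field T Ω U) {t : ℝ} (ht : t ∈ Icc 0 T) {x : E3}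
    (hx : x ∈ closure Ω) : timeDeriv T (fun s => tang Ω x (U s x)) t =
      tang Ω x (timeDeriv T (fun s => U s x) t) := by
  have hd := hU.hasDerivWithinAt t ht x hx
  have h4 := (hd.inner ℝ (hasDerivWithinAt_const t (Icc 0 T) (normal Ω x))).smul_const
    (normal Ω x)
  simp only [inner_zero_right, zero_add] at h4
  exact timeDeriv_eq hT ht (hd.sub h4)

theorem inner_surfaceGrad_add_half_sq {x z : E3} (hx : x ∈ frontier Ω) (hz : ⟪D.m x, z⟫ = 0)
    {g : E3 → ℝ} {U : E3 → E3} {A : E3 →L[ℝ] E3} (hg : DifferentiableWithinAt ℝ g (closure Ω) x)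
    (hU : HasFDerivWithinAt U A (closure Ω) x) :
    ⟪surfaceGrad Ω (fun y => g y + 1 / 2 * ‖U y‖ ^ 2) x, z⟫ =
      fderivWithin ℝ g (closure Ω) x z + ⟪U x, A z⟫ := by
  rw [D.inner_surfaceGrad hx hz (g := fun y => g y + 1 / 2 * ‖U y‖ ^ 2)
    (hg.hasFDerivWithinAt.add (hU.norm_sq.const_mul (1 / 2)))]
  simp

/-- The gap, tested with tangent vectors on the inflow boundary. -/
theorem inner_pressureGap_tangent (hT : 0 < T) (hU : IsC1Field T Ω U) {t : ℝ} (ht : t ∈ Icc 0 T)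
    {x z : E3} (hx : x ∈ frontier Ω) (hun : ⟪u t x, normal Ω x⟫ = Un t x) (hUn0 : Un t x ≠ 0)
    (hq : ContDiffOn ℝ 1 (q t) (closure Ω)) (hz : ⟪D.m x, z⟫ = 0)
    (hH : curl Ω (u t) x = boundaryVorticity T Ω Un U f u q t x) :
    ⟪pressureGap T Ω f u q t x, z⟫ =
      ⟪timeDeriv T (fun s => U s x) t, z⟫ - ⟪timeDeriv T (fun s => u s x) t, z⟫
      + ⟪U t x, fderivWithin ℝ (U t) (closure Ω) x z⟫
      - ⟪u t x, fderivWithin ℝ (u t) (closure Ω) x z⟫ := by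
  have hxc := frontier_subset_closure hx
  -- This is `u · ∇u = ∇(|u|²/2) + curl u × u` tested with `z`; it lets the prescribed vorticity
  -- enter.
  have h1 := inner_apply_sub_inner_apply (fderivWithin ℝ (u t) (closure Ω) x) (u t x) z
  have hzn := (D.inner_m_eq_zero_iff hx z).1 hz
  have h2 : ⟪boundaryVorticity T Ω Un U f u q t x, cross (u t x) z⟫ =
      ⟪-timeDeriv T (fun s => tang Ω x (U s x)) t
        - surfaceGrad Ω (fun y => q t y + 1 / 2 * ‖U t y‖ ^ 2) x + tang Ω x (f t x), z⟫ := by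
    rw [boundaryVorticity, vorticityTangential, vorticityNormal, perp, ← hun]
    exact inner_vorticity_cross hzn (by rwa [hun])
  rw [← curl_eq, hH, cross_swap, inner_neg_right, h2, timeDeriv_tang hT hU ht hxc, inner_add_left,
    inner_sub_left, inner_neg_left, D.inner_tang hx hz, D.inner_tang hx hz,
    D.inner_surfaceGrad_add_half_sq hx hz (hq.differentiableOn (by simp) x hxc)
      (hU.hasFDerivWithinAt t ht x hxc)] at h1
  simp only [pressureGap, inner_sub_left, inner_gradientWithin, advect_eq]
  linarith

/-- The two expressions for the derivative of `⟪U, z⟫` along `z` on the boundary agree. -/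
theorem inner_projDeriv_eq {x : E3} (hx : x ∈ frontier Ω) {U z : E3 → E3} {A B : E3 →L[ℝ] E3}
    (hU : HasFDerivWithinAt U A (closure Ω) x) (hz : HasFDerivWithinAt z B (closure Ω) x)
    (htan : ∀ y ∈ frontier Ω, ⟪D.m y, z y⟫ = 0) :
    ⟪A (z x), z x⟫ + ⟪U x, B (z x)⟫ =
      ⟪D.projDeriv x (U x) A (z x), z x⟫ + ⟪D.proj x (U x), B (z x)⟫ := by
  have h1 := (hU.inner ℝ hz).mono frontier_subset_closure
  have h2 := ((D.hasFDerivWithinAt_proj hU).inner ℝ hz).mono frontier_subset_closure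
  -- The functions `⟪U, z⟫` and `⟪proj U, z⟫` are known to agree only on the boundary, so their
  -- derivatives are compared along the tangent vector `z x`.
  have h3 := D.apply_eq_of_hasFDerivWithinAt hx (htan x hx) h1
    (h2.congr (fun y hy => (D.inner_proj_of_tangent hy (htan y hy)).symm)
      (D.inner_proj_of_tangent hx (htan x hx)).symm)
  simp [fderivInnerCLM_apply] at h3
  linarith

/-- On tangent vectors, the antisymmetric part of `B` involves only the normal component of its
curl. Its vanishing lets the derivative move from the direction `z` to the direction `proj v`. -/
theorem inner_proj_apply_eq {x v z : E3} {B : E3 →L[ℝ] E3} (hx : x ∈ frontier Ω)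
    (hz : ⟪D.m x, z⟫ = 0) (hB : ⟪curlOf B, normal Ω x⟫ = 0) :
    ⟪D.proj x v, B z⟫ = ⟪z, B (D.proj x v)⟫ := by
  have h := inner_apply_sub_inner_apply B (D.proj x v) z
  rw [inner_cross_eq_zero (D.inner_normal_self hx) ((D.inner_m_eq_zero_iff hx _).1 hz)
    ((D.inner_m_eq_zero_iff hx _).1 (D.inner_m_proj x v)) hB] at h
  rw [real_inner_comm (B (D.proj x v)) z]
  linarith

/-- The pointwise form of the energy balance on the inflow boundary. -/
theorem energyDiv_boundary {x : E3} (hx : x ∈ frontier Ω) {U z : E3 → E3} {A B : E3 →L[ℝ] E3}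
    (hU : HasFDerivWithinAt U A (closure Ω) x) (hz : HasFDerivWithinAt z B (closure Ω) x)
    (htan : ∀ y ∈ frontier Ω, ⟪D.m y, z y⟫ = 0) (hB : ⟪curlOf B, normal Ω x⟫ = 0)
    {R zt : E3} (hRm : ⟪D.m x, R⟫ = tr (D.fluxDeriv x (U x) A (z x) B))
    (hRz : ⟪R, z x⟫ = -⟪z x, zt⟫ + ⟪U x, A (z x)⟫ - ⟪U x + z x, (A + B) (z x)⟫) (r : ℝ) :
    ⟪U x, D.m x⟫ * ⟪z x, zt⟫ + D.energyDiv x (U x) A (z x) B r R - r * ⟪D.m x, R⟫ =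
      1 / 2 * ‖z x‖ ^ 2 * (tr (D.fluxDeriv x (U x) A (z x) B) + tr (D.fluxDeriv x (U x) A (U x) A))
      - ⟪U x, D.m x⟫ * ⟪D.projDeriv x (U x) A (z x), z x⟫ := by
  have h1 := D.inner_projDeriv_eq hx hU hz htan
  have h2 := D.inner_proj_apply_eq (v := U x) hx (htan x hx) hB
  rw [real_inner_comm (z x) (A (z x))] at h1
  rw [energyDiv, flux, flux, D.proj_of_tangent hx (htan x hx), ← smul_add, map_smul, map_add,
    inner_smul_right, inner_smul_right, inner_add_right, hRz, hRm]
  simp only [add_apply, inner_add_left, inner_add_right]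
  -- All terms with `B` cancel here: `h1` replaces `U` by its tangential part, and `h2` matches the
  -- result with the divergence of the transport flux. The terms with `r` cancel through `hRm`.
  have e : ⟪U x, A (z x)⟫ - (⟪U x, A (z x)⟫ + ⟪U x, B (z x)⟫ + (⟪z x, A (z x)⟫ + ⟪z x, B (z x)⟫))
      + (⟪z x, B (z x)⟫ + ⟪z x, B (D.proj x (U x))⟫) = -⟪D.projDeriv x (U x) A (z x), z x⟫ := by
    linarith
  linear_combination ⟪U x, D.m x⟫ * e

end DefiningFunction

/-! ### Time dependence of layer integrals -/

namespace DefiningFunction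

variable {Ω : Set E3} (D : DefiningFunction Ω) {T : ℝ}

theorem integrableOn_density_mul_const (hb : Bornology.IsBounded Ω) (n : ℕ) (C : ℝ) :
    IntegrableOn (fun x => ‖layerDensity n (D.d x)‖ * C) Ω :=
  (((D.continuous_density n).norm.mul continuous_const).continuousOn.integrableOn_compact
    hb.isCompact_closure).mono_set subset_closure

theorem aestronglyMeasurable_density_mul (n : ℕ) {g : E3 → ℝ} (hg : ContinuousOn g (closure Ω)) :
    AEStronglyMeasurable (fun x => layerDensity n (D.d x) * g x) (volume.restrict Ω) :=
  ((D.continuous_density n).continuousOn.mul (hg.mono subset_closure)).aestronglyMeasurable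
    D.isOpen.measurableSet

theorem continuousOn_layer (hb : Bornology.IsBounded Ω) (n : ℕ) {g : ℝ × E3 → ℝ}
    (hg : ContinuousOn g (cylinder T Ω)) :
    ContinuousOn (fun t => D.layer n fun x => g (t, x)) (Icc 0 T) := by
  obtain ⟨C, hC⟩ := (isCompact_Icc.prod hb.isCompact_closure).exists_bound_of_continuousOn hg
  refine continuousOn_of_dominated (bound := fun x => ‖layerDensity n (D.d x)‖ * C)
    (fun t ht => D.aestronglyMeasurable_density_mul n (IsC1Field.slice ht hg)) ?_
    (D.integrableOn_density_mul_const hb n C) ?_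
  · intro t ht
    filter_upwards [ae_restrict_mem D.isOpen.measurableSet] with x hx
    rw [norm_mul]
    gcongr
    exact hC (t, x) ⟨ht, subset_closure hx⟩
  · filter_upwards [ae_restrict_mem D.isOpen.measurableSet] with x hx
    exact continuousOn_const.mul (hg.comp (by fun_prop) fun t ht => ⟨ht, subset_closure hx⟩)

theorem hasDerivAt_layer (hb : Bornology.IsBounded Ω) (n : ℕ) {g g' : ℝ × E3 → ℝ}
    (hg : ContinuousOn g (cylinder T Ω)) (hg' : ContinuousOn g' (cylinder T Ω))
    (hder : ∀ t ∈ Ioo 0 T, ∀ x ∈ Ω, HasDerivAt (fun s => g (s, x)) (g' (t, x)) t) {t : ℝ}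
    (ht : t ∈ Ioo 0 T) :
    HasDerivAt (fun s => D.layer n fun x => g (s, x)) (D.layer n fun x => g' (t, x)) t := by
  obtain ⟨C, hC⟩ := (isCompact_Icc.prod hb.isCompact_closure).exists_bound_of_continuousOn hg'
  have ht' := Ioo_subset_Icc_self ht
  refine (hasDerivAt_integral_of_dominated_loc_of_deriv_le (μ := volume.restrict Ω)
    (F := fun s x => layerDensity n (D.d x) * g (s, x))
    (F' := fun s x => layerDensity n (D.d x) * g' (s, x))
    (bound := fun x => ‖layerDensity n (D.d x)‖ * C) (s := Ioo 0 T) (isOpen_Ioo.mem_nhds ht)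
    ?_ (D.integrableOn_layer hb n ((IsC1Field.slice ht' hg).mono subset_closure))
    (D.aestronglyMeasurable_density_mul n (IsC1Field.slice ht' hg')) ?_
    (D.integrableOn_density_mul_const hb n C) ?_).2
  · filter_upwards [isOpen_Ioo.mem_nhds ht] with s hs
    exact D.aestronglyMeasurable_density_mul n (IsC1Field.slice (Ioo_subset_Icc_self hs) hg)
  · filter_upwards [ae_restrict_mem D.isOpen.measurableSet] with x hx s hs
    rw [norm_mul]
    gcongr
    exact hC (s, x) ⟨Ioo_subset_Icc_self hs, subset_closure hx⟩
  · filter_upwards [ae_restrict_mem D.isOpen.measurableSet] with x hx s hs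
    exact (hder s hs x hx).const_mul _

end DefiningFunction

/-! ### The Gronwall constant and the boundary inequality -/

section

variable {T : ℝ} {Ω Γp Γm Γz : Set E3} {Un : ℝ → E3 → ℝ} {U u f : ℝ → E3 → E3} {q : ℝ → E3 → ℝ}

theorem IsBoundarySplitting.inflow_subset (h : IsBoundarySplitting Ω Γp Γm Γz) :
    Γp ⊆ frontier Ω := by
  rw [← h.union_eq, union_assoc]
  exact subset_union_left

namespace DefiningFunction

variable (D : DefiningFunction Ω)

/-- A constant for the Gronwall inequality. -/
theorem exists_rate (hb : Bornology.IsBounded Ω) (hΓ : IsClosed Γp)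
    (hΓf : Γp ⊆ frontier Ω) (hU : IsC1Field T Ω U) (hu : IsC1Field T Ω u)
    (hμ : ∀ t ∈ Icc 0 T, ∀ x ∈ Γp, 0 < ⟪U t x, D.m x⟫) :
    ∃ C ≥ 0, ∀ t ∈ Icc 0 T, ∀ x ∈ Γp,
      ⟪timeDeriv T (fun s => U s x) t, D.m x⟫
      + (tr (D.fluxDeriv x (U t x) (fderivWithin ℝ (U t) (closure Ω) x) (u t x - U t x)
          (fderivWithin ℝ (u t) (closure Ω) x - fderivWithin ℝ (U t) (closure Ω) x))
        + tr (D.fluxDeriv x (U t x) (fderivWithin ℝ (U t) (closure Ω) x) (U t x)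
          (fderivWithin ℝ (U t) (closure Ω) x)))
      + 2 * ⟪U t x, D.m x⟫ * ‖D.projDeriv x (U t x) (fderivWithin ℝ (U t) (closure Ω) x)‖
        ≤ C * ⟪U t x, D.m x⟫ := by
  have hsub : Icc 0 T ×ˢ Γp ⊆ cylinder T Ω := prod_mono_right (hΓf.trans frontier_subset_closure)
  have hξ : ContinuousOn (fun y : ℝ × E3 => y.2) (cylinder T Ω) := continuous_snd.continuousOn
  have hB := hu.continuousOn_fderiv.sub hU.continuousOn_fderiv
  have hz := hu.continuousOn.sub hU.continuousOn
  have hμc := D.continuousOn_mass hξ hU.continuousOn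
  have hk := (((D.continuousOn_mass hξ hU.continuousOn_timeDeriv).add
    ((continuous_tr.comp_continuousOn
      (D.continuousOn_fluxDeriv hξ hU.continuousOn hU.continuousOn_fderiv hz hB)).add
    (continuous_tr.comp_continuousOn
      (D.continuousOn_fluxDeriv hξ hU.continuousOn hU.continuousOn_fderiv hU.continuousOn
        hU.continuousOn_fderiv)))).add ((continuousOn_const (c := (2 : ℝ)).mul hμc).mul
    (D.continuousOn_projDeriv hξ hU.continuousOn hU.continuousOn_fderiv).norm))
  have hK : IsCompact Γp := hb.isCompact_closure.of_isClosed_subset hΓ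
    (hΓf.trans frontier_subset_closure)
  -- The quotient by the positive weight `⟪U, m⟫` is continuous on the compact set `[0, T] × Γp`.
  obtain ⟨C, hC⟩ := (isCompact_Icc.prod hK).exists_bound_of_continuousOn
    ((hk.mono hsub).div (hμc.mono hsub) fun y hy => (hμ y.1 hy.1 y.2 hy.2).ne')
  refine ⟨max C 0, le_max_right _ _, fun t ht x hx => ?_⟩
  have h1 := (le_abs_self _).trans ((hC (t, x) ⟨ht, hx⟩).trans (le_max_left C 0))
  exact (div_le_iff₀ (hμ t ht x hx)).1 h1

/-- The pointwise boundary inequality needed for the energy estimate. -/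
theorem boundary_inequality (hT : 0 < T)
    (hU : IsC1Field T Ω U) (hu : IsC1Field T Ω u)
    (hUn : ∀ t ∈ Icc 0 T, ∀ x ∈ frontier Ω, ⟪U t x, normal Ω x⟫ = Un t x)
    (hun : ∀ t ∈ Icc 0 T, ∀ x ∈ frontier Ω, ⟪u t x, normal Ω x⟫ = Un t x)
    (hfn : ∀ t ∈ Icc 0 T, ∀ x ∈ frontier Ω, ⟪f t x, normal Ω x⟫ = 0)
    (hin : ∀ t ∈ Icc 0 T, ∀ x ∈ Γp, Un t x ≠ 0)
    (hμ : ∀ t ∈ Icc 0 T, ∀ x ∈ Γp, 0 < ⟪U t x, D.m x⟫)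
    (hq : SolvesApproxPressure T Ω Γp Un U u q)
    (hH : ∀ t ∈ Icc 0 T, ∀ x ∈ Γp,
      curl Ω (u t) x = boundaryVorticity T Ω Un U f u q t x)
    {θ : E3 → ℝ} (hθ1 : ∀ x ∈ Γp, θ x = 1) (hθ0 : ∀ x ∈ frontier Ω, x ∉ Γp → θ x = 0)
    {C t : ℝ} (ht : t ∈ Icc 0 T) (hC : ∀ x ∈ Γp,
      ⟪timeDeriv T (fun s => U s x) t, D.m x⟫
      + (tr (D.fluxDeriv x (U t x) (fderivWithin ℝ (U t) (closure Ω) x) (u t x - U t x)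
          (fderivWithin ℝ (u t) (closure Ω) x - fderivWithin ℝ (U t) (closure Ω) x))
        + tr (D.fluxDeriv x (U t x) (fderivWithin ℝ (U t) (closure Ω) x) (U t x)
          (fderivWithin ℝ (U t) (closure Ω) x)))
      + 2 * ⟪U t x, D.m x⟫ * ‖D.projDeriv x (U t x) (fderivWithin ℝ (U t) (closure Ω) x)‖
        ≤ C * ⟪U t x, D.m x⟫) (r : E3 → ℝ) {x : E3} (hx : x ∈ frontier Ω) :
    θ x * (⟪U t x, D.m x⟫ * ⟪u t x - U t x,
        timeDeriv T (fun s => u s x) t - timeDeriv T (fun s => U s x) t⟫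
      + 1 / 2 * ⟪timeDeriv T (fun s => U s x) t, D.m x⟫ * ‖u t x - U t x‖ ^ 2
      - C * (1 / 2 * ⟪U t x, D.m x⟫ * ‖u t x - U t x‖ ^ 2)
      + D.energyDiv x (U t x) (fderivWithin ℝ (U t) (closure Ω) x) (u t x - U t x)
        (fderivWithin ℝ (u t) (closure Ω) x - fderivWithin ℝ (U t) (closure Ω) x) (r x)
        (pressureGap T Ω f u q t x))
      - r x * ⟪D.m x, pressureGap T Ω f u q t x⟫ ≤ 0 := by
  have hRn := inner_pressureGap_normal hT hu hun hfn hq ht hx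
  have hRm := D.inner_m hx (pressureGap T Ω f u q t x)
  rw [hRn] at hRm
  by_cases hxp : x ∈ Γp
  · have hxc := frontier_subset_closure hx
    rw [indicator_of_mem hxp, D.tr_fluxDeriv_eq hU hu hUn hun ht hx, neg_neg] at hRm
    have htan : ∀ y ∈ frontier Ω, ⟪D.m y, u t y - U t y⟫ = 0 := fun y hy => by
      rw [D.inner_m_eq_zero_iff hy, inner_sub_left, hun t ht y hy, hUn t ht y hy, sub_self]
    have hRz := D.inner_pressureGap_tangent hT hU ht hx (hun t ht x hx) (hin t ht x hxp)
      (hq.contDiffOn_closure t ht) (htan x hx) (hH t ht x hxp)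
    have h1 := D.energyDiv_boundary hx (hU.hasFDerivWithinAt t ht x hxc)
      ((hu.hasFDerivWithinAt t ht x hxc).sub (hU.hasFDerivWithinAt t ht x hxc)) htan
      (inner_curlOf_sub_normal hU ht D hx (hH t ht x hxp)) hRm
      (zt := timeDeriv T (fun s => u s x) t - timeDeriv T (fun s => U s x) t)
      (by
        simp only [Pi.sub_apply, add_sub_cancel]
        rw [hRz, inner_sub_right (u t x - U t x), real_inner_comm (timeDeriv T _ t) (u t x - U t x),
          real_inner_comm (timeDeriv T _ t) (u t x - U t x)]
        ring) (r x)
    simp only [Pi.sub_apply] at h1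
    have h2 := hC x hxp
    -- The only remaining term not already a multiple of `|z|²` is a quadratic form in `z`, bounded
    -- by the operator norm included in the rate.
    have h3 : -⟪D.projDeriv x (U t x) (fderivWithin ℝ (U t) (closure Ω) x) (u t x - U t x),
        u t x - U t x⟫ ≤
        ‖D.projDeriv x (U t x) (fderivWithin ℝ (U t) (closure Ω) x)‖ * ‖u t x - U t x‖ ^ 2 := by
      refine (neg_le_abs _).trans ((abs_real_inner_le_norm _ _).trans ?_)
      rw [pow_two, ← mul_assoc]
      gcongr
      exact ContinuousLinearMap.le_opNorm _ _
    have h4 := mul_le_mul_of_nonneg_left h3 (hμ t ht x hxp).le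
    have h5 := mul_le_mul_of_nonneg_left h2 (by positivity : 0 ≤ 1 / 2 * ‖u t x - U t x‖ ^ 2)
    rw [hθ1 x hxp, one_mul]
    linarith
  · rw [indicator_of_notMem hxp, mul_zero, neg_zero] at hRm
    rw [hθ0 x hx hxp, hRm]
    simp

end DefiningFunction

end

end InflowEuler

/-! ### The energy argument -/

open MeasureTheory Filter Topology Set InflowEuler

theorem proposition5p3
    (α : NNReal) (hα0 : 0 < α) (hα1 : α < 1)
    -- the domain and its boundary
    (Ω : Set E3) (hΩo : IsOpen Ω) (hΩc : IsConnected Ω) (hΩb : Bornology.IsBounded Ω)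
    (hΩ : InflowEuler.HasHolderBoundary 2 α Ω)
    (Γp Γm Γz : Set E3) (hΓ : InflowEuler.IsBoundarySplitting Ω Γp Γm Γz)
    -- the data
    (T : ℝ) (hT : 0 < T)
    (Un : ℝ → E3 → ℝ) (hUn : InflowEuler.IsNormalVelocity T Γp Γm Γz Un)
    (U : ℝ → E3 → E3) (hU : InflowEuler.IsCSigma 2 α T Ω Un U)
    (f : ℝ → E3 → E3) (hf : InflowEuler.IsCSigma 1 α T Ω (fun _ _ => 0) f)
    (u₀ : E3 → E3) (hu₀ : InflowEuler.IsCSigmaSpace 1 α Ω (Un 0) u₀)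
    (hu₀τ : ∀ x ∈ Γp, InflowEuler.tang Ω x (u₀ x) = InflowEuler.tang Ω x (U 0 x))
    -- the solution
    (u : ℝ → E3 → E3) (hu : InflowEuler.IsCSigma 1 α T Ω Un u)
    (p : ℝ → E3 → ℝ)
    (hp : InflowEuler.IsHolder 0 α (Function.uncurry p) (InflowEuler.cylinder T Ω))
    (hup : InflowEuler.SolvesEuler T Ω f u₀ u p)
    -- its vorticity on the inflow boundary
    (q : ℝ → E3 → ℝ) (hq : InflowEuler.SolvesApproxPressure T Ω Γp Un U u q)
    (hH : ∀ t ∈ Set.Icc 0 T, ∀ x ∈ Γp,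
      InflowEuler.curl Ω (u t) x = InflowEuler.boundaryVorticity T Ω Un U f u q t x) :
    ∀ t ∈ Set.Icc 0 T, ∀ x ∈ Γp, u t x = U t x := by
  obtain ⟨D⟩ := nonempty_definingFunction hΩo hΩb hΩ
  have hΩu := D.uniqueDiffOn_closure
  have hU1 : IsC1Field T Ω U := isC1Field hT hΩu (hU.holder.1.of_le (by norm_num))
  have hu1 : IsC1Field T Ω u := isC1Field hT hΩu hu.holder.1
  have hf1 : IsC1Field T Ω f := isC1Field hT hΩu hf.holder.1
  have hΓf := hΓ.inflow_subset
  -- The gradient `m` points inwards, so inflow makes the energy weight `⟪U, m⟫ = -|m| U^n`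
  -- positive.
  have hμ : ∀ t ∈ Icc 0 T, ∀ x ∈ Γp, 0 < ⟪U t x, D.m x⟫ := fun t ht x hx => by
    rw [real_inner_comm, D.inner_m (hΓf hx), hU.normal_eq t ht x (hΓf hx), ← mul_neg]
    exact mul_pos (D.norm_m_pos (hΓf hx)) (neg_pos.2 (hUn.inflow t ht x hx))
  obtain ⟨C, hC0, hC⟩ := D.exists_rate hΩb (hΓ.inflow.isClosed isClosed_frontier) hΓf hU1 hu1 hμ
  obtain ⟨θ, θ', hθ, hθ'c, hθp, hθz⟩ := hΓ.exists_cutoff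
  have hθc : Continuous θ := continuous_iff_continuousAt.2 fun x => (hθ x).continuousAt
  have hdivu : ∀ t ∈ Ioo 0 T, ∀ x ∈ Ω, tr (fderivWithin ℝ (u t) (closure Ω) x) = 0 :=
    fun t ht x hx => by rw [← div_eq]; exact hu.div_eq_zero t ht x hx
  have hdivf : ∀ t ∈ Ioo 0 T, ∀ x ∈ Ω, tr (fderivWithin ℝ (f t) (closure Ω) x) = 0 :=
    fun t ht x hx => by rw [← div_eq]; exact hf.div_eq_zero t ht x hx
  let zt : ℝ → E3 → E3 := fun t x =>
    timeDeriv T (fun s => u s x) t - timeDeriv T (fun s => U s x) t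
  let E : ℝ × E3 → ℝ := fun y => θ y.2 * (1 / 2 * ⟪U y.1 y.2, D.m y.2⟫ * ‖u y.1 y.2 - U y.1 y.2‖ ^ 2)
  let e : ℝ × E3 → ℝ := fun y => θ y.2 * (⟪U y.1 y.2, D.m y.2⟫ * ⟪u y.1 y.2 - U y.1 y.2, zt y.1 y.2⟫
    + 1 / 2 * ⟪timeDeriv T (fun s => U s y.2) y.1, D.m y.2⟫ * ‖u y.1 y.2 - U y.1 y.2‖ ^ 2)
  have hξ : ContinuousOn (fun y : ℝ × E3 => y.2) (cylinder T Ω) := continuous_snd.continuousOn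
  have hθξ := hθc.comp_continuousOn hξ
  have hzc := hu1.continuousOn.sub hU1.continuousOn
  have hEc : ContinuousOn E (cylinder T Ω) := hθξ.mul
    ((continuousOn_const.mul (D.continuousOn_mass hξ hU1.continuousOn)).mul (hzc.norm.pow 2))
  have hec : ContinuousOn e (cylinder T Ω) := hθξ.mul
    (((D.continuousOn_mass hξ hU1.continuousOn).mul
      (hzc.inner (hu1.continuousOn_timeDeriv.sub hU1.continuousOn_timeDeriv))).add
    ((continuousOn_const.mul (D.continuousOn_mass hξ hU1.continuousOn_timeDeriv)).mul
      (hzc.norm.pow 2)))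
  have hder : ∀ t ∈ Ioo 0 T, ∀ x ∈ Ω, HasDerivAt (fun s => E (s, x)) (e (t, x)) t := by
    intro t ht x hx
    have d1 := hU1.hasDerivAt ht (subset_closure hx)
    have d2 := ((hu1.hasDerivAt ht (subset_closure hx)).sub d1).norm_sq
    have d3 := (d1.inner ℝ (hasDerivAt_const t (D.m x))).const_mul (1 / 2)
    convert! (d3.mul d2).const_mul (θ x) using 1
    simp only [e, zt, inner_zero_right, zero_add, Pi.sub_apply]
    ring
  have hEz : ∀ t ∈ Icc 0 T, ∀ x ∈ frontier Ω, (x ∈ Γp → u t x = U t x) → E (t, x) = 0 := by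
    intro t ht x hx h
    by_cases hxp : x ∈ Γp
    · simp [E, h hxp]
    · simp [E, (hθz x hx hxp).1]
  have hinit : ∀ x ∈ Γp, u 0 x = U 0 x := by
    intro x hx
    have h0 : (0 : ℝ) ∈ Icc 0 T := ⟨le_rfl, hT.le⟩
    have hxc := frontier_subset_closure (hΓf hx)
    have h1 : u 0 x = u₀ x := by
      -- The initial condition is imposed only on `Ω`; continuity carries it to the inflow boundary.
      have : EqOn (u 0) u₀ (closure Ω) := EqOn.of_subset_closure hup.initial
        (hu1.continuousOn_slice h0) hu₀.holder.1.continuousOn subset_closure subset_rfl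
      exact this hxc
    have h2 := hu₀τ x hx
    rw [← h1, tang, tang, hu.normal_eq 0 h0 x (hΓf hx), hU.normal_eq 0 h0 x (hΓf hx)] at h2
    exact sub_left_injective h2
  obtain ⟨M, hM, hMn⟩ := D.exists_abs_layer_le hΩb
  obtain ⟨K₁, hK₁⟩ := (isCompact_Icc.prod hΩb.isCompact_closure).exists_bound_of_continuousOn hEc
  obtain ⟨K₂, hK₂⟩ := (isCompact_Icc.prod hΩb.isCompact_closure).exists_bound_of_continuousOn hec
  -- The bound combines the suprema of `E` and `e` over the cylinder with the uniform layer mass,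
  -- and is thus independent of `n` and `t`.
  have hlim := eventually_le_of_eventually_deriv_le (T := T) (M := max (max K₁ K₂) 0 * M) hC0
    (E := fun n t => D.layer n fun x => E (t, x)) (e := fun n t => D.layer n fun x => e (t, x))
    (fun n => D.continuousOn_layer hΩb n hEc)
    (fun n t ht => D.hasDerivAt_layer hΩb n hEc hec hder ht)
    (by
      filter_upwards [hMn] with n hn t ht
      have ht' := Ioo_subset_Icc_self ht
      refine ⟨hn _ _ ((IsC1Field.slice ht' hec).mono subset_closure) (fun x hx => ?_)
        (le_max_right _ _), hn _ _ ((IsC1Field.slice ht' hEc).mono subset_closure)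
        (fun x hx => ?_) (le_max_right _ _)⟩
      · exact (hK₂ (t, x) ⟨ht', subset_closure hx⟩).trans
          ((le_max_right _ _).trans (le_max_left _ _))
      · exact (hK₁ (t, x) ⟨ht', subset_closure hx⟩).trans
          ((le_max_left _ _).trans (le_max_left _ _)))
    (by
      intro t ht δ hδ
      have ht' := Ioo_subset_Icc_self ht
      have hqt := hq.contDiffOn_closure t ht'
      have hRc := continuousOn_pressureGap hΩu hf1 hu1 ht' hqt
      have hr := fun x hx => hasFDerivAt_pressure_sub hΩo hup ht hqt (x := x) hx
      exact D.eventually_energy_le hΩb hθ hθ'c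
        (fun x hx => (em (x ∈ Γp)).elim (fun h => (hθp x h).2) fun h => (hθz x hx h).2)
        (fun x hx => hU1.hasFDerivWithinAt t ht' x hx) (hU1.continuousOn_fderiv_slice ht')
        (fun x hx => (hu1.hasFDerivWithinAt t ht' x hx).sub (hU1.hasFDerivWithinAt t ht' x hx))
        ((hu1.continuousOn_fderiv_slice ht').sub (hU1.continuousOn_fderiv_slice ht'))
        (hU1.continuousOn_timeDeriv_slice ht')
        ((hu1.continuousOn_timeDeriv_slice ht').sub (hU1.continuousOn_timeDeriv_slice ht'))
        hr ((IsC1Field.slice ht' hp.1.continuousOn).sub hqt.continuousOn) hRc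
        (D.layer_mul_inner_nonpos hΩb hr (hRc.mono subset_closure)
          fun n φ φ' hφ hφ' h0 => integral_fderiv_pressureGap_eq_zero hΩo hΩb
            (D.isCompact_core hΩb n) (D.core_subset n) hφ hφ' h0 hu1 hf1 hdivu hdivf ht
            (hq.contDiffOn_interior t ht') (hq.laplace t ht'))
        (fun x hx => D.boundary_inequality hT hU1 hu1 hU.normal_eq hu.normal_eq hf.normal_eq
          (fun s hs y hy => (hUn.inflow s hs y hy).ne) hμ hq hH (fun y hy => (hθp y hy).1)
          (fun y hy hyp => (hθz y hy hyp).1) ht' (hC t ht') (fun y => p t y - q t y) hx) hδ)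
    (fun δ hδ => D.eventually_layer_le hΩb (IsC1Field.slice ⟨le_rfl, hT.le⟩ hEc)
      (fun x hx => (hEz 0 ⟨le_rfl, hT.le⟩ x hx (hinit x)).le) hδ)
  intro t ht x hx
  have h1 := D.eq_zero_of_layer_le hΩb (g := fun x => E (t, x)) (IsC1Field.slice ht hEc)
    (fun y hy => by
      by_cases hyp : y ∈ Γp
      · have := hμ t ht y hyp
        simp only [E, (hθp y hyp).1]
        positivity
      · exact (hEz t ht y hy fun h => absurd h hyp).ge) (hlim t ht) x (hΓf hx)
  have h2 := hμ t ht x hx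
  simp only [E, (hθp x hx).1, one_mul, mul_eq_zero, h2.ne', or_false] at h1
  have h3 : ‖u t x - U t x‖ = 0 := by
    rcases h1 with h1 | h1
    · norm_num at h1
    · exact pow_eq_zero_iff two_ne_zero |>.1 h1
  exact sub_eq_zero.1 (norm_eq_zero.1 h3)
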